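/- **Theorem 1.6.** Let $n,m\ge 1$ be integers and let $\Psi=(\psi_1,\dots,\psi_m)$ with $\psi_j:\mathbb Z^n\to\mathbb R_{\ge 0}$. For $\mathbf q\in\mathbb Z^n$ put $|\mathbf q|=\max_i|q_i|$. Let $\|\cdot\|$ denote the distance to the nearest integer, regard $\mathbf x=(\mathbf x_1,\dots,\mathbf x_m)\in[0,1]^{nm}$ as an $n\times m$ matrix with columns $\mathbf x_j$, and let $$W(n,m;\Psi)=\{\mathbf x\in[0,1]^{nm}:\ \|\mathbf q\mathbf x_j\|<\psi_j(\mathbf q)\ (1\le j\le m)\text{ for infinitely many }\mathbf q\in\mathbb Z^n\}.$$ A dimension function is a continuous non-decreasing $f:[0,\infty)\to[0,\infty)$ with $f(0)=0$. Write $f\preceq s$ (resp. $s\preceq f$) if $r\mapsto f(r)/r^s$ is non-increasing (resp. non-decreasing) on $(0,\infty)$, and $f\prec s$ if $f\preceq s$ and $f(r)/r^s\to\infty$ as $r\to0^+$. For $E\subset\mathbb R^{nm}$ let $$\mathcal H^f(E)=\lim_{\eta\to0^+}\inf\Big\{\sum_{i}f(\operatorname{diam}B_i):\ E\subset\bigcup_{i\ge1}B_i,\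 B_i\text{ balls with }\operatorname{diam}B_i\le\eta\Big\}.$$ Let $f$ be a dimension function with $f\prec nm$ and $(nm-a)\preceq f\preceq(nm-a+1)$ for some integer $1\le a\le m-1$. Assume one of the following: 1. $n\ge2$ and every $\psi_j$ is univariable, i.e. $\psi_j(\mathbf q)$ depends only on $|\mathbf q|$; 2. $\Psi$ is non-increasing, that is, either (2a) every $\psi_j$ satisfies $\psi_j(\mathbf q)\ge\psi_j(\mathbf q')$ whenever $q_\ell q'_\ell\ge0$ and $|q_\ell|\le|q'_\ell|$ for $1\le\ell\le n$, or (2b) every $\psi_j$ satisfies $\psi_j(\mathbf q)\ge\psi_j(\mathbf q')$ whenever $q_\ell\le q'_\ell$ for $1\le\ell\le n$. For $\mathbf q\in\mathbb Z^n\setminus\{0\}$ let $\mathcal K_{\mathbf q}(i)=\{1\le j\le m:\psi_j(\mathbf q)>\psi_i(\mathbf q)\}$ and $$t_{\mathbf q}(\Psi,f)=\min_{1\le i\le m}\bigg\{f\bigg(\frac{\psi_i(\mathbf q)}{|\mathbf q|}\bigg)\bigg(\frac{\psi_i(\mathbf q)}{|\mathbf q|}\bigg)^{(1-n)m}\prod_{j\in\mathcal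 K_{\mathbf q}(i)}\frac{\psi_j(\mathbf q)}{\psi_i(\mathbf q)}\bigg\},$$ where the $i$-th term is read as $0$ if $\psi_i(\mathbf q)=0$. Then: * if $\sum_{\mathbf q\in\mathbb Z^n\setminus\{0\}}t_{\mathbf q}(\Psi,f)|\mathbf q|^m<\infty$, then $\mathcal H^f(W(n,m;\Psi))=0$; * if $\sum_{\mathbf q\in\mathbb Z^n\setminus\{0\}}t_{\mathbf q}(\Psi,f)|\mathbf q|^m=\infty$, then $\mathcal H^f(W(n,m;\Psi))=\mathcal H^f([0,1]^{nm})$, provided, when only condition 1 is assumed, that every $\psi_j$ is bounded. -/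

import Mathlib

open scoped NNReal ENNReal Topology

noncomputable section

namespace WeightedApprox

/-- A dimension function: continuous and non-decreasing on `[0, ∞)` with `f 0 = 0`. -/
structure IsDimensionFunction (f : ℝ≥0 → ℝ≥0) : Prop where
  continuous : Continuous f
  monotone : Monotone f
  map_zero : f 0 = 0

/-- `f ⪯ s`: the function `r ↦ f r / r ^ s` is non-increasing on `(0, ∞)`. -/
def PrecEq (f : ℝ≥0 → ℝ≥0) (s : ℝ) : Prop :=
  ∀ x y : ℝ≥0, 0 < x → x < y → f y / y ^ s ≤ f x / x ^ s

/-- `s ⪯ f`: the function `r ↦ f r / r ^ s` is non-decreasing on `(0, ∞)`. -/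
def SuccEq (s : ℝ) (f : ℝ≥0 → ℝ≥0) : Prop :=
  ∀ x y : ℝ≥0, 0 < x → x < y → f x / x ^ s ≤ f y / y ^ s

/-- `f ≺ s`: `f ⪯ s`, and `f r / r ^ s → ∞` as `r → 0+`. -/
def Prec (f : ℝ≥0 → ℝ≥0) (s : ℝ) : Prop :=
  PrecEq f s ∧ Filter.Tendsto (fun r : ℝ≥0 => f r / r ^ s) (𝓝[>] 0) Filter.atTop

/-- `H^f_η(E)`: the infimum of `∑ f (diam B_i)` over countable covers of `E` by balls of
diameter at most `η`.  (Points are admitted as balls of radius `0`; since `f` is continuous with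
`f 0 = 0` this does not affect the infimum.) -/
def hausdorffPre {X : Type*} [PseudoMetricSpace X] (f : ℝ≥0 → ℝ≥0) (η : ℝ) (E : Set X) : ℝ≥0∞ :=
  ⨅ (c : ℕ → X) (r : ℕ → ℝ≥0)
    (_ : ∀ i, Metric.diam (Metric.closedBall (c i) (r i : ℝ)) ≤ η)
    (_ : E ⊆ ⋃ i, Metric.closedBall (c i) (r i : ℝ)),
    ∑' i, (f (Metric.diam (Metric.closedBall (c i) (r i : ℝ))).toNNReal : ℝ≥0∞)

/-- The Hausdorff `f`-measure `H^f(E) = lim_{η → 0+} H^f_η(E)`; the limit is a supremum because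
`H^f_η(E)` increases as `η` decreases. -/
def hausdorffMeasure {X : Type*} [PseudoMetricSpace X] (f : ℝ≥0 → ℝ≥0) (E : Set X) : ℝ≥0∞ :=
  ⨆ (η : ℝ) (_ : 0 < η), hausdorffPre f η E

/-- The space of real `n × m` matrices, as the Euclidean space `ℝ^{nm}`. -/
abbrev MatSpace (n m : ℕ) : Type := EuclideanSpace ℝ (Fin n × Fin m)

/-- The unit cube `[0,1]^{nm}`. -/
def unitCube (n m : ℕ) : Set (MatSpace n m) :=
  {x | ∀ p, x p ∈ Set.Icc (0 : ℝ) 1}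

/-- The distance of a real number to the nearest integer. -/
def distInt (y : ℝ) : ℝ := |y - round y|

/-- The product `q x_j` of the row vector `q` with the `j`-th column of the matrix `x`. -/
def rowMul {n m : ℕ} (q : Fin n → ℤ) (x : MatSpace n m) (j : Fin m) : ℝ :=
  ∑ i, (q i : ℝ) * x (i, j)

/-- The limsup set `W(n, m; Ψ)`. -/
def W {n m : ℕ} (Ψ : Fin m → (Fin n → ℤ) → ℝ≥0) : Set (MatSpace n m) :=
  {x | x ∈ unitCube n m ∧
    {q : Fin n → ℤ | ∀ j, distInt (rowMul q x j) < (Ψ j q : ℝ)}.Infinite}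

/-- `ψ q` depends only on `|q| = max_i |q_i|`, which is the norm on `Fin n → ℤ`. -/
def IsUnivariable {n : ℕ} (ψ : (Fin n → ℤ) → ℝ≥0) : Prop :=
  ∀ q q' : Fin n → ℤ, ‖q‖₊ = ‖q'‖₊ → ψ q = ψ q'

/-- `ψ` does not increase when coordinates move away from `0`: `ψ q' ≤ ψ q` whenever `q` and `q'`
lie in a common closed orthant and `|q_ℓ| ≤ |q'_ℓ|` for all `ℓ`. -/
def IsRadiallyNonincreasing {n : ℕ} (ψ : (Fin n → ℤ) → ℝ≥0) : Prop :=
  ∀ q q' : Fin n → ℤ, (∀ l, 0 ≤ q l * q' l ∧ |q l| ≤ |q' l|) → ψ q' ≤ ψ q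

/-- The members of the tuple are non-increasing, either all of them along the coordinates moving
away from `0`, or all of them for the coordinatewise order of the whole of `ℤ^n`. -/
def IsNonincreasingTuple {n m : ℕ} (Ψ : Fin m → (Fin n → ℤ) → ℝ≥0) : Prop :=
  (∀ j, IsRadiallyNonincreasing (Ψ j)) ∨ (∀ j, Antitone (Ψ j))

/-- `K_q(i)`, the set of `j` with `ψ_j(q) > ψ_i(q)`. -/
def K {n m : ℕ} (Ψ : Fin m → (Fin n → ℤ) → ℝ≥0) (q : Fin n → ℤ) (i : Fin m) : Finset (Fin m) :=
  Finset.univ.filter fun j => Ψ i q < Ψ j q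

/-- `t_q(Ψ, f)`, a minimum over the finite set of indices `i`.  If `ψ_i(q) = 0` then the `i`-th
term contains the factor `f 0 = 0` and is `0`. -/
def t {n m : ℕ} (Ψ : Fin m → (Fin n → ℤ) → ℝ≥0) (f : ℝ≥0 → ℝ≥0) (q : Fin n → ℤ) : ℝ≥0 :=
  ⨅ i : Fin m,
    f (Ψ i q / ‖q‖₊) * (Ψ i q / ‖q‖₊) ^ ((1 - (n : ℤ)) * (m : ℤ)) *
      ∏ j ∈ K Ψ q i, Ψ j q / Ψ i q

/-- The series `∑_{q ≠ 0} t_q(Ψ, f) |q|^m`, with value in `[0, ∞]`. -/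
def tSum {n m : ℕ} (Ψ : Fin m → (Fin n → ℤ) → ℝ≥0) (f : ℝ≥0 → ℝ≥0) : ℝ≥0∞ :=
  ∑' q : {q : Fin n → ℤ // q ≠ 0}, (t Ψ f q.1 : ℝ≥0∞) * (‖q.1‖₊ : ℝ≥0∞) ^ m

end WeightedApprox

end

open WeightedApprox

/-!
# A zero–infinity law for Hausdorff measures of weighted limsup sets

Write `N = n m` and `r_j = ψ_j(q) / |q|`. The points `x` with `‖q x_j‖ < ψ_j(q)` for all `j` form a
neighbourhood, with radii about `r_j`, of about `|q| ^ m` affine planes of codimension `m` in the unit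
cube. Covering it by balls of radius `s` takes about `|q| ^ m s ^ (-N) ∏ max (r_j) s` balls, so that
its `f`-content at scale `s` is `|q| ^ m` times `boxValue f N r s`. The number `t_q` is the minimum of
`boxValue` over the scales `s = r_i` (`t_eq_boxContent`), and the hypothesis that `f` lies between
the exponents `N - a` and `N - a + 1` makes it the minimum over all scales
(`IsGauge.boxContent_le_boxValue`).

*Convergence.* Covering each neighbourhood at its optimal scale gives `f`-sums at most a constant
times `t_q |q| ^ m` (`exists_cover_solutionSet`), and the tails of a convergent series tend to zero.

*Divergence.* If all `ψ_j` are non-increasing on the whole lattice and some `t_q` is positive, then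
`W Ψ` is the whole cube by recurrence on the torus (`W_eq_unitCube_of_antitone`). In the other cases
`Ψ` is bounded, and `W Ψ` is shown to have infinite measure in three stages.

* The series still diverges over the vectors `q` with one coordinate of constant sign and composed of
  few small primes (`exists_isRough_of_regular`, `exists_isRough_of_univariable`). For such `q`, every
  common divisor `d` of the coordinates satisfies `φ(d) ≥ c d`, and a Khintchine–Groshev theorem holds without
  monotonicity (`ae_infinite_torusSlab`): restricted to reduced fractions, the approximation sets on
  the torus are quasi-independent, and the ergodicity of `x ↦ 2 x` turns positive measure into full
  measure.
* Mass transference (`distributes_slabs`). Given `ε > 0`, thicken the radii to `max (r_j) ρ` with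
  `∏ max (r_j) ρ = min (ε t_q) (|q| ^ (-m))`. By the previous stage almost every point lies in
  infinitely many of the thickened neighbourhoods. So every cube contains finitely many disjoint
  dyadic cubes, filling a fixed proportion of it, each of side about `ρ` for some `q` and meeting the
  original neighbourhood of `q` substantially. Concentrating the mass of each small cube on the
  original neighbourhood inside it creates a density whose mass on smaller cubes of side `s` is at
  most a constant times `ε f(s)`, because `boxValue f N r s ≥ t_q`.
* A Cantor construction (`exists_scale_forall_cover`). Multiplying such densities at rapidly finer
  scales gives, for any prescribed total mass `M`, densities with mass at most `f(s)` on all small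
  cubes of side `s`, whose supports shrink to a compact subset of `W Ψ`. Hence the `f`-measure of
  `W Ψ` is at least a constant times `M`, for every `M`.
-/

namespace WeightedApprox

/-! ### Gauge functions and the weight of a box -/

/-- The properties of the dimension function that the argument uses, with natural exponents:
`r ↦ f r / r ^ N` and `r ↦ f r / r ^ (N - a + 1)` do not increase, `r ↦ f r / r ^ (N - a)` does
not decrease, and `f r / r ^ N` is unbounded near `0`. -/
structure IsGauge (f : ℝ≥0 → ℝ≥0) (N a : ℕ) : Prop where
  dim : IsDimensionFunction f
  pos : ∀ x, 0 < x → 0 < f x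
  upper : ∀ x y, 0 < x → x ≤ y → f y * x ^ N ≤ f x * y ^ N
  lower_mid : ∀ x y, 0 < x → x ≤ y → f x * y ^ (N - a) ≤ f y * x ^ (N - a)
  upper_mid : ∀ x y, 0 < x → x ≤ y → f y * x ^ (N - a + 1) ≤ f x * y ^ (N - a + 1)
  large : ∀ M : ℝ≥0, ∃ δ : ℝ≥0, 0 < δ ∧ ∀ x, 0 < x → x < δ → M * x ^ N ≤ f x

theorem PrecEq.mul_pow_le {f : ℝ≥0 → ℝ≥0} {s : ℝ} {k : ℕ} (h : PrecEq f s) (hs : s = k)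
    (x y : ℝ≥0) (hx : 0 < x) (hxy : x ≤ y) : f y * x ^ k ≤ f x * y ^ k := by
  subst hs
  rcases hxy.eq_or_lt with rfl | hlt
  · exact le_rfl
  have := h x y hx hlt
  rw [NNReal.rpow_natCast, NNReal.rpow_natCast] at this
  have hy : 0 < y := hx.trans hlt
  rwa [div_le_div_iff₀ (by positivity) (by positivity)] at this

theorem SuccEq.mul_pow_le {f : ℝ≥0 → ℝ≥0} {s : ℝ} {k : ℕ} (h : SuccEq s f) (hs : s = k)
    (x y : ℝ≥0) (hx : 0 < x) (hxy : x ≤ y) : f x * y ^ k ≤ f y * x ^ k := by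
  subst hs
  rcases hxy.eq_or_lt with rfl | hlt
  · exact le_rfl
  have := h x y hx hlt
  rw [NNReal.rpow_natCast, NNReal.rpow_natCast] at this
  have hy : 0 < y := hx.trans hlt
  rwa [div_le_div_iff₀ (by positivity) (by positivity)] at this

theorem isGauge_of_prec {f : ℝ≥0 → ℝ≥0} {n m a : ℕ} (hn : 1 ≤ n) (hf : IsDimensionFunction f)
    (hfnm : Prec f ((n : ℝ) * m)) (ham : a ≤ m)
    (hfl : SuccEq ((n : ℝ) * m - a) f) (hfu : PrecEq f ((n : ℝ) * m - a + 1)) :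
    IsGauge f (n * m) a := by
  have hle : a ≤ n * m := ham.trans (Nat.le_mul_of_pos_left m hn)
  have hsub : (n : ℝ) * m - a = ((n * m - a : ℕ) : ℝ) := by
    rw [Nat.cast_sub hle]; push_cast; ring
  have hsmall : ∀ M : ℝ≥0, ∃ δ : ℝ≥0, 0 < δ ∧ ∀ x, 0 < x → x < δ → M * x ^ (n * m) ≤ f x := by
    intro M
    have h := hfnm.2.eventually (Filter.eventually_ge_atTop M)
    rw [eventually_nhdsWithin_iff, NNReal.nhds_zero_basis.eventually_iff] at h
    obtain ⟨δ, hδ, h⟩ := h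
    refine ⟨δ, hδ, fun x hx hxδ => ?_⟩
    have := h hxδ hx
    have e : (n : ℝ) * m = ((n * m : ℕ) : ℝ) := by push_cast; ring
    rw [e, NNReal.rpow_natCast, le_div_iff₀ (by positivity)] at this
    exact this
  refine ⟨hf, ?_, hfnm.1.mul_pow_le (by push_cast; ring), hfl.mul_pow_le hsub,
    hfu.mul_pow_le (by rw [hsub]; push_cast; ring), hsmall⟩
  intro x hx
  obtain ⟨δ, hδ, h⟩ := hsmall 1
  have hy : 0 < min x (δ / 2) := lt_min hx (half_pos hδ)
  have h1 := h (min x (δ / 2)) hy ((min_le_right _ _).trans_lt (half_lt_self hδ))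
  have h2 : 0 < f (min x (δ / 2)) := lt_of_lt_of_le (by positivity) h1
  exact h2.trans_le (hf.monotone (min_le_left _ _))

namespace IsGauge

variable {f : ℝ≥0 → ℝ≥0} {N a : ℕ}

theorem map_mul_le (hf : IsGauge f N a) {c : ℝ≥0} (hc : 1 ≤ c) (x : ℝ≥0) :
    f (c * x) ≤ c ^ N * f x := by
  rcases eq_or_ne x 0 with rfl | hx
  · simp [hf.dim.map_zero]
  have hx : 0 < x := pos_iff_ne_zero.2 hx
  have h := hf.upper x (c * x) hx (le_mul_of_one_le_left zero_le hc)
  rw [mul_pow, ← mul_assoc] at h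
  have := le_of_mul_le_mul_right h (by positivity)
  rwa [mul_comm (f x)] at this

theorem pow_mul_le_map_mul (hf : IsGauge f N a) {c : ℝ≥0} (hc : c ≤ 1) (x : ℝ≥0) :
    c ^ N * f x ≤ f (c * x) := by
  rcases eq_or_ne c 0 with rfl | hc0
  · rcases eq_or_ne N 0 with rfl | hN
    · rcases eq_or_ne x 0 with rfl | hx
      · simp
      obtain ⟨δ, hδ, h⟩ := hf.large (f x + 1)
      have hx : 0 < x := pos_iff_ne_zero.2 hx
      have hy : 0 < min x (δ / 2) := lt_min hx (half_pos hδ)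
      have h1 := h _ hy ((min_le_right _ _).trans_lt (half_lt_self hδ))
      have h2 := hf.dim.monotone (min_le_left x (δ / 2))
      rw [pow_zero, mul_one] at h1
      exact absurd (h1.trans h2) (not_le.2 (lt_add_one _))
    · simp [hN]
  have hc0 : 0 < c := pos_iff_ne_zero.2 hc0
  have h := hf.map_mul_le (c := c⁻¹) (one_le_inv_iff₀.2 ⟨hc0, hc⟩) (c * x)
  rw [inv_mul_cancel_left₀ hc0.ne', inv_pow] at h
  calc c ^ N * f x ≤ c ^ N * ((c ^ N)⁻¹ * f (c * x)) := by gcongr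
    _ = f (c * x) := mul_inv_cancel_left₀ (by positivity) _

end IsGauge

/-- Inside a ball of radius `1` of `ℝ ^ N`, the neighbourhood with radii `r j` of a plane of
codimension `m` is covered by about `s ^ (-N) * ∏ max (r j) s` balls of radius `s`; `boxValue` is the
sum of `f` over these balls. -/
noncomputable def boxValue {m : ℕ} (f : ℝ≥0 → ℝ≥0) (N : ℕ) (r : Fin m → ℝ≥0) (s : ℝ≥0) : ℝ≥0 :=
  f s / s ^ N * ∏ j, max (r j) s

/-- The minimum of `boxValue` over the scales `s = r i`. -/
noncomputable def boxContent {m : ℕ} (f : ℝ≥0 → ℝ≥0) (N : ℕ) (r : Fin m → ℝ≥0) : ℝ≥0 :=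
  ⨅ i, boxValue f N r (r i)

theorem boxContent_le {m : ℕ} (f : ℝ≥0 → ℝ≥0) (N : ℕ) (r : Fin m → ℝ≥0) (i : Fin m) :
    boxContent f N r ≤ boxValue f N r (r i) :=
  ciInf_le (OrderBot.bddBelow _) i

theorem exists_boxContent_eq {m : ℕ} [NeZero m] (f : ℝ≥0 → ℝ≥0) (N : ℕ) (r : Fin m → ℝ≥0) :
    ∃ i, boxContent f N r = boxValue f N r (r i) := by
  obtain ⟨i, hi⟩ := exists_eq_ciInf_of_finite (f := fun i => boxValue f N r (r i))
  exact ⟨i, hi.symm⟩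

theorem prod_max_eq {m : ℕ} (r : Fin m → ℝ≥0) (s : ℝ≥0) :
    ∏ j, max (r j) s =
      (∏ j with s < r j, r j) * s ^ (Finset.univ.filter (fun j => ¬ s < r j)).card := by
  rw [← Finset.prod_filter_mul_prod_filter_not Finset.univ (fun j => s < r j)]
  congr 1
  · exact Finset.prod_congr rfl fun j hj => max_eq_left (Finset.mem_filter.1 hj).2.le
  · rw [← Finset.prod_const]
    exact Finset.prod_congr rfl fun j hj => max_eq_right (not_lt.1 (Finset.mem_filter.1 hj).2)

/-- The minimum of `boxValue` over all scales is attained at one of the radii: between two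
consecutive radii `boxValue` is monotone, non-decreasing above and non-increasing below the `a`-th
smallest radius. -/
theorem IsGauge.boxContent_le_boxValue {m a N : ℕ} {f : ℝ≥0 → ℝ≥0} (hf : IsGauge f N a)
    (ha : 1 ≤ a) (ham : a ≤ m) (haN : a ≤ N) (r : Fin m → ℝ≥0) {s : ℝ≥0} (hs : 0 < s) :
    boxContent f N r ≤ boxValue f N r s := by
  set k := (Finset.univ.filter (fun j => ¬ s < r j)).card with hk
  -- it suffices to find a radius `σ` on the right side of `s` with no radius in between
  have key : ∀ σ : ℝ≥0, 0 < σ → (∏ j, max (r j) σ) * s ^ k = (∏ j, max (r j) s) * σ ^ k →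
      f σ * σ ^ k * s ^ N ≤ f s * s ^ k * σ ^ N → boxValue f N r σ ≤ boxValue f N r s := by
    intro σ hσ h1 h2
    unfold boxValue
    have e : (∏ j, max (r j) σ) = (∏ j, max (r j) s) * σ ^ k / s ^ k := by
      rw [eq_div_iff (by positivity), h1]
    rw [e]
    calc f σ / σ ^ N * ((∏ j, max (r j) s) * σ ^ k / s ^ k)
        = (f σ * σ ^ k * s ^ N) * (∏ j, max (r j) s) / (σ ^ N * s ^ k * s ^ N) := by
          field_simp
      _ ≤ (f s * s ^ k * σ ^ N) * (∏ j, max (r j) s) / (σ ^ N * s ^ k * s ^ N) := by gcongr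
      _ = _ := by field_simp
  rcases le_or_gt a k with hak | hak
  · have hne : (Finset.univ.filter (fun j => ¬ s < r j)).Nonempty := by
      rw [← Finset.card_pos]; omega
    obtain ⟨i, hi, himax⟩ := Finset.exists_max_image _ r hne
    have his : r i ≤ s := not_lt.1 (Finset.mem_filter.1 hi).2
    refine (boxContent_le f N r i).trans ?_
    rcases eq_or_ne (r i) 0 with h0 | h0
    · simp [boxValue, h0, hf.dim.map_zero]
    have h0 : 0 < r i := pos_iff_ne_zero.2 h0
    refine key _ h0 ?_ ?_
    · have e : (∏ j, max (r j) (r i)) = (∏ j with s < r j, r j) * r i ^ k := by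
        rw [← Finset.prod_filter_mul_prod_filter_not Finset.univ (fun j => s < r j), hk]
        congr 1
        · exact Finset.prod_congr rfl fun j hj =>
            max_eq_left (his.trans (Finset.mem_filter.1 hj).2.le)
        · rw [← Finset.prod_const]
          exact Finset.prod_congr rfl fun j hj => max_eq_right (himax j hj)
      rw [e, prod_max_eq r s]; ring
    · have h := hf.lower_mid (r i) s h0 his
      obtain ⟨c, hc⟩ := Nat.exists_eq_add_of_le hak
      obtain ⟨b, rfl⟩ := Nat.exists_eq_add_of_le haN
      rw [Nat.add_sub_cancel_left] at h
      rw [hc]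
      calc f (r i) * r i ^ (a + c) * s ^ (a + b)
          = (f (r i) * s ^ b) * (r i ^ a * s ^ a * r i ^ c) := by ring
        _ ≤ (f s * r i ^ b) * (r i ^ a * s ^ a * s ^ c) := by gcongr
        _ = _ := by ring
  · have hne : (Finset.univ.filter (fun j => s < r j)).Nonempty := by
      have h := Finset.card_filter_add_card_filter_not (s := Finset.univ) (fun j => s < r j)
      rw [Finset.card_univ, Fintype.card_fin] at h
      rw [← Finset.card_pos]; omega
    obtain ⟨i, hi, himin⟩ := Finset.exists_min_image _ r hne
    have his : s < r i := (Finset.mem_filter.1 hi).2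
    refine (boxContent_le f N r i).trans (key _ (hs.trans his) ?_ ?_)
    · have e : (∏ j, max (r j) (r i)) = (∏ j with s < r j, r j) * r i ^ k := by
        rw [← Finset.prod_filter_mul_prod_filter_not Finset.univ (fun j => s < r j), hk]
        congr 1
        · exact Finset.prod_congr rfl fun j hj => max_eq_left (himin j hj)
        · rw [← Finset.prod_const]
          exact Finset.prod_congr rfl fun j hj =>
            max_eq_right ((not_lt.1 (Finset.mem_filter.1 hj).2).trans his.le)
      rw [e, prod_max_eq r s]; ring
    · have h := hf.upper_mid s (r i) hs his.le
      obtain ⟨c, hc⟩ := Nat.exists_eq_add_of_lt hak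
      clear_value k
      subst hc
      obtain ⟨b, rfl⟩ := Nat.exists_eq_add_of_le haN
      rw [Nat.add_sub_cancel_left] at h
      calc f (r i) * r i ^ k * s ^ (k + c + 1 + b)
          = (f (r i) * s ^ (b + 1)) * (r i ^ k * s ^ k * s ^ c) := by ring
        _ ≤ (f s * r i ^ (b + 1)) * (r i ^ k * s ^ k * r i ^ c) := by gcongr
        _ = _ := by ring

/-- `boxValue` is monotone in the radii at each fixed scale, hence so is its minimum over all
scales. -/
theorem IsGauge.boxContent_mono {m a N : ℕ} [NeZero m] {f : ℝ≥0 → ℝ≥0} (hf : IsGauge f N a)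
    (ha : 1 ≤ a) (ham : a ≤ m) (haN : a ≤ N) {r r' : Fin m → ℝ≥0} (h : r ≤ r') :
    boxContent f N r ≤ boxContent f N r' := by
  obtain ⟨i, hi⟩ := exists_boxContent_eq f N r'
  rcases eq_or_ne (r' i) 0 with h0 | h0
  · refine (boxContent_le f N r i).trans ?_
    have : r i = 0 := le_antisymm (h0 ▸ h i) zero_le
    simp [boxValue, this, hf.dim.map_zero]
  · rw [hi]
    refine (hf.boxContent_le_boxValue ha ham haN r (pos_iff_ne_zero.2 h0)).trans ?_
    unfold boxValue
    gcongr with j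
    exact h j

theorem IsGauge.pow_mul_boxContent_le {m a N : ℕ} [NeZero m] {f : ℝ≥0 → ℝ≥0}
    (hf : IsGauge f N a) (hmN : m ≤ N) {c : ℝ≥0} (hc0 : 0 < c) (hc : c ≤ 1) (r : Fin m → ℝ≥0) :
    c ^ N * boxContent f N r ≤ boxContent f N (fun j => c * r j) := by
  obtain ⟨i, hi⟩ := exists_boxContent_eq f N (fun j => c * r j)
  rw [hi]
  refine (mul_le_mul_right (boxContent_le f N r i) _).trans ?_
  unfold boxValue
  have e : ∏ j, max (c * r j) (c * r i) = c ^ m * ∏ j, max (r j) (r i) := by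
    simp_rw [← mul_max_of_nonneg _ _ hc0.le]
    rw [Finset.prod_mul_distrib]; simp
  rw [e]
  rcases eq_or_ne (r i) 0 with h0 | h0
  · simp [h0, hf.dim.map_zero]
  have h0 : 0 < r i := pos_iff_ne_zero.2 h0
  calc c ^ N * (f (r i) / r i ^ N * ∏ j, max (r j) (r i))
      = (c ^ N * f (r i)) / (c ^ N * r i ^ N) * (c ^ N * ∏ j, max (r j) (r i)) := by
        field_simp
    _ ≤ f (c * r i) / (c ^ N * r i ^ N) * (c ^ m * ∏ j, max (r j) (r i)) := by
        gcongr ?_ / _ * (?_ * _)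
        · exact hf.pow_mul_le_map_mul hc _
        · exact pow_le_pow_of_le_one zero_le hc hmN
    _ = _ := by rw [mul_pow]

theorem prod_max_div_eq {m : ℕ} (r : Fin m → ℝ≥0) (i : Fin m) (hi : 0 < r i) :
    ∏ j with r i < r j, r j / r i = (∏ j, max (r j) (r i)) / r i ^ m := by
  have h := Finset.card_filter_add_card_filter_not (s := Finset.univ) (fun j => r i < r j)
  rw [Finset.card_univ, Fintype.card_fin] at h
  rw [prod_max_eq, Finset.prod_div_distrib, Finset.prod_const, div_eq_div_iff (by positivity)
    (by positivity)]
  have e : r i ^ m = r i ^ (Finset.univ.filter (fun j => r i < r j)).card *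
      r i ^ (Finset.univ.filter (fun j => ¬ r i < r j)).card := by rw [← pow_add, h]
  rw [e]
  ring

theorem norm_pos_of_ne_zero {n : ℕ} {q : Fin n → ℤ} (hq : q ≠ 0) : 0 < ‖q‖₊ :=
  nnnorm_pos.2 hq

/-- `t_q` is the minimal value of `boxValue` for the radii `ψ_j(q) / |q|`. -/
theorem t_eq_boxContent {n m : ℕ} {f : ℝ≥0 → ℝ≥0} (hf : f 0 = 0)
    (Ψ : Fin m → (Fin n → ℤ) → ℝ≥0) {q : Fin n → ℤ} (hq : q ≠ 0) :
    t Ψ f q = boxContent f (n * m) (fun j => Ψ j q / ‖q‖₊) := by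
  unfold t boxContent
  congr 1
  ext1 i
  have hq' := norm_pos_of_ne_zero hq
  rcases eq_or_ne (Ψ i q) 0 with h0 | h0
  · simp [boxValue, h0, hf]
  have h0 : 0 < Ψ i q := pos_iff_ne_zero.2 h0
  set r : Fin m → ℝ≥0 := fun j => Ψ j q / ‖q‖₊ with hr
  have hri : 0 < r i := by positivity
  have e : ∏ j ∈ K Ψ q i, Ψ j q / Ψ i q = (∏ j, max (r j) (r i)) / r i ^ m := by
    rw [← prod_max_div_eq r i hri]
    have hK : K Ψ q i = Finset.univ.filter (fun j => r i < r j) := by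
      ext j
      simp [K, hr, div_lt_div_iff_of_pos_right hq']
    rw [hK]
    refine Finset.prod_congr rfl fun j _ => ?_
    simp only [hr]
    field_simp
  rw [e]
  change f (r i) * (r i) ^ ((1 - (n : ℤ)) * (m : ℤ)) * _ = f (r i) / r i ^ (n * m) * _
  have e2 : (r i) ^ ((1 - (n : ℤ)) * (m : ℤ)) = r i ^ m / r i ^ (n * m) := by
    rw [← zpow_natCast, ← zpow_natCast, ← zpow_sub₀ hri.ne']
    congr 1
    push_cast; ring
  rw [e2]
  field_simp

end WeightedApprox

namespace WeightedApprox

open MeasureTheory Set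

/-! ### Reduced fractions on the circle -/

/-- A pair `(p, p')` with `p < d`, `p' < d'` is determined by `p * d' - p' * d` up to `gcd d d'`
choices. -/
theorem card_fiber_cross_le {d d' : ℕ} (hd : 0 < d) (v : ℤ) :
    (((Finset.range d ×ˢ Finset.range d').filter
      (fun P : ℕ × ℕ => (P.1 : ℤ) * d' - P.2 * d = v)).card) ≤ Nat.gcd d d' := by
  have hg : 0 < Nat.gcd d d' := Nat.gcd_pos_of_pos_left _ hd
  obtain ⟨g, e, e', hg', hcop, hde, hde'⟩ := Nat.exists_coprime' (m := d) (n := d') hg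
  have hgg : Nat.gcd d d' = g := by
    rw [hde, hde', Nat.gcd_mul_right, hcop.gcd_eq_one, one_mul]
  have he : 0 < e := Nat.pos_of_ne_zero (by rintro rfl; simp at hde; omega)
  rw [hgg, ← Finset.card_range g]
  refine Finset.card_le_card_of_injOn (fun P => P.1 / e) ?_ ?_
  · intro P hP
    simp only [Finset.coe_filter, Finset.mem_product, Finset.mem_range, mem_ofPred_eq] at hP
    simp only [Finset.coe_range, mem_Iio]
    rw [Nat.div_lt_iff_lt_mul he, mul_comm, ← hde]
    exact hP.1.1
  · rintro ⟨p, p'⟩ hP ⟨s, s'⟩ hS hdiv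
    simp only [Finset.coe_filter, Finset.mem_product, Finset.mem_range, mem_ofPred_eq] at hP hS
    simp only at hdiv
    have h1 : ((p : ℤ) - s) * d' = (p' - s') * d := by linarith [hP.2, hS.2]
    have h2 : ((p : ℤ) - s) * e' = (p' - s') * e := by
      have hg0 : (g : ℤ) ≠ 0 := by exact_mod_cast hg'.ne'
      apply mul_right_cancel₀ hg0
      have e1 : (d : ℤ) = e * g := by exact_mod_cast hde
      have e2 : (d' : ℤ) = e' * g := by exact_mod_cast hde'
      rw [e1, e2] at h1
      linarith
    have h3 : (e : ℤ) ∣ (p : ℤ) - s := by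
      have hc : IsCoprime (e : ℤ) e' := Nat.isCoprime_iff_coprime.2 hcop
      exact hc.dvd_of_dvd_mul_right ⟨p' - s', by rw [h2]; ring⟩
    have hps : p = s := by
      have h4 : s ≡ p [MOD e] := (Nat.modEq_iff_dvd).2 h3
      have e1 := Nat.div_add_mod p e
      have e2 := Nat.div_add_mod s e
      have e3 : s % e = p % e := h4
      rw [hdiv] at e1
      omega
    subst hps
    have : (p' : ℤ) - s' = 0 := by
      have h5 : ((p' : ℤ) - s') * e = 0 := by rw [← h2]; ring
      rcases mul_eq_zero.1 h5 with h | h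
      · exact h
      · exfalso; have : e = 0 := by exact_mod_cast h
        omega
    have : p' = s' := by omega
    rw [this]

/-- The numerators of pairs of distinct fractions `p / d ≠ p' / d'` at distance at most
`B / (d d')` number at most `2 B`: the difference `p d' - p' d` is a non-zero multiple of
`gcd d d'`, and takes each value at most `gcd d d'` times. -/
theorem card_cross_lt_le {d d' : ℕ} (hd : 0 < d) {B : ℝ} (hB : 0 ≤ B) :
    ((((Finset.range d ×ˢ Finset.range d').filter
      (fun P : ℕ × ℕ => (P.1 : ℤ) * d' - P.2 * d ≠ 0 ∧ |((P.1 : ℝ) * d' - P.2 * d)| ≤ B)).card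
        : ℕ) : ℝ) ≤ 2 * B := by
  set g := Nat.gcd d d' with hgdef
  have hg : 0 < g := Nat.gcd_pos_of_pos_left _ hd
  have hgR : (0 : ℝ) < g := by exact_mod_cast hg
  set S := (Finset.range d ×ˢ Finset.range d').filter
      (fun P : ℕ × ℕ => (P.1 : ℤ) * d' - P.2 * d ≠ 0 ∧ |((P.1 : ℝ) * d' - P.2 * d)| ≤ B) with hS
  set k := ⌊B / g⌋ with hk
  have hk0 : 0 ≤ k := Int.floor_nonneg.2 (by positivity)
  set T : Finset ℤ := ((Finset.Icc (-k) k).erase 0).image (fun u => u * g) with hT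
  have hmaps : ∀ P ∈ S, ((P.1 : ℤ) * d' - P.2 * d) ∈ T := by
    intro P hP
    simp only [hS, Finset.mem_filter] at hP
    have hdvd : (g : ℤ) ∣ (P.1 : ℤ) * d' - P.2 * d := by
      apply dvd_sub
      · exact Dvd.dvd.mul_left (by exact_mod_cast Nat.gcd_dvd_right d d') _
      · exact Dvd.dvd.mul_left (by exact_mod_cast Nat.gcd_dvd_left d d') _
    obtain ⟨u, hu⟩ := hdvd
    have huR : ((P.1 : ℝ) * d' - P.2 * d) = g * u := by exact_mod_cast hu
    rw [hT, Finset.mem_image]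
    refine ⟨u, ?_, by rw [hu]; ring⟩
    rw [Finset.mem_erase, Finset.mem_Icc]
    refine ⟨by rintro rfl; exact hP.2.1 (by rw [hu]; ring), ?_⟩
    have h1 : |(u : ℝ)| ≤ B / g := by
      rw [le_div_iff₀ hgR]
      have := hP.2.2
      rw [huR, abs_mul, abs_of_pos hgR] at this
      linarith
    rw [← abs_le, hk, Int.le_floor]
    push_cast
    exact h1
  have h1 : S.card ≤ g * T.card := by
    refine Finset.card_le_mul_card_image_of_maps_to hmaps g ?_
    intro v _
    refine (Finset.card_le_card ?_).trans (card_fiber_cross_le hd (d' := d') v)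
    intro P hP
    simp only [hS, Finset.mem_filter] at hP ⊢
    exact ⟨hP.1.1, hP.2⟩
  have h2 : T.card ≤ (2 * k).toNat := by
    refine Finset.card_image_le.trans ?_
    rw [Finset.card_erase_of_mem (by simp [hk0]), Int.card_Icc]
    omega
  have h3 : (T.card : ℝ) ≤ 2 * (B / g) := by
    have : (T.card : ℤ) ≤ 2 * k := by omega
    have h4 : (T.card : ℝ) ≤ 2 * (k : ℝ) := by exact_mod_cast this
    have := Int.floor_le (B / g)
    rw [← hk] at this
    linarith
  have h1' : (S.card : ℝ) ≤ g * T.card := by exact_mod_cast h1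
  calc (S.card : ℝ) ≤ g * (2 * (B / g)) := h1'.trans (by gcongr)
    _ = 2 * B := by field_simp

/-- The union of the intervals of length `δ / d` to the right of the reduced fractions with
denominator `d` in `[0, 1)`. -/
def reducedIoc (d : ℕ) (δ : ℝ) : Set ℝ :=
  ⋃ p ∈ (Finset.range d).filter d.Coprime, Ioc ((p : ℝ) / d) ((p + δ) / d)

theorem measurableSet_reducedIoc (d : ℕ) (δ : ℝ) : MeasurableSet (reducedIoc d δ) :=
  Finset.measurableSet_biUnion _ fun _ _ => measurableSet_Ioc

theorem reducedIoc_subset {d : ℕ} (hd : 0 < d) {δ : ℝ} (hδ1 : δ ≤ 1) :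
    reducedIoc d δ ⊆ Ioc 0 1 := by
  intro y hy
  simp only [reducedIoc, mem_iUnion, Finset.mem_filter, Finset.mem_range] at hy
  obtain ⟨p, ⟨hp, -⟩, h1, h2⟩ := hy
  have hd' : (0 : ℝ) < d := by exact_mod_cast hd
  refine ⟨lt_of_le_of_lt (by positivity) h1, h2.trans ?_⟩
  rw [div_le_one hd']
  have : (p : ℝ) + 1 ≤ d := by exact_mod_cast hp
  linarith

theorem volume_reducedIoc {d : ℕ} (hd : 0 < d) {δ : ℝ} (hδ1 : δ ≤ 1) :
    volume (reducedIoc d δ) = ENNReal.ofReal (d.totient / d * δ) := by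
  have hd' : (0 : ℝ) < d := by exact_mod_cast hd
  rw [reducedIoc, measure_biUnion_finset ?_ fun _ _ => measurableSet_Ioc]
  · simp_rw [Real.volume_Ioc]
    have : ∀ p : ℕ, ((p : ℝ) + δ) / d - p / d = δ / d := fun p => by ring
    simp_rw [this]
    rw [Finset.sum_const, ← Nat.totient_eq_card_coprime, nsmul_eq_mul,
      div_mul_eq_mul_div, mul_div_assoc, ENNReal.ofReal_mul (by positivity), ENNReal.ofReal_natCast]
  · intro p _ p' _ hne
    rw [Function.onFun, Set.disjoint_left]
    rintro y ⟨h1, h2⟩ ⟨h3, h4⟩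
    have a1 := h1.trans_le h4
    have a2 := h3.trans_le h2
    rw [div_lt_div_iff_of_pos_right hd'] at a1 a2
    have b1 : (p : ℝ) < p' + 1 := by linarith
    have b2 : (p' : ℝ) < p + 1 := by linarith
    have c1 : p < p' + 1 := by exact_mod_cast b1
    have c2 : p' < p + 1 := by exact_mod_cast b2
    omega

/-- Distinct reduced fractions are separated, so for different denominators the two unions of
intervals overlap at most twice as much as independent sets would. -/
theorem volume_reducedIoc_inter_le {d d' : ℕ} (hd : 0 < d) (hd' : 0 < d') (hne : d ≠ d')
    {δ δ' : ℝ} (hδ : 0 ≤ δ) (hδ' : 0 ≤ δ') :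
    volume (reducedIoc d δ ∩ reducedIoc d' δ') ≤ ENNReal.ofReal (2 * δ * δ') := by
  have hdR : (0 : ℝ) < d := by exact_mod_cast hd
  have hdR' : (0 : ℝ) < d' := by exact_mod_cast hd'
  set Δ := max (δ / d) (δ' / d') with hΔ
  set B := Δ * (d * d') with hB
  have hB0 : 0 ≤ B := by positivity
  set S := (Finset.range d ×ˢ Finset.range d').filter
      (fun P : ℕ × ℕ => (P.1 : ℤ) * d' - P.2 * d ≠ 0 ∧ |((P.1 : ℝ) * d' - P.2 * d)| ≤ B) with hS
  have hsub : reducedIoc d δ ∩ reducedIoc d' δ' ⊆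
      ⋃ P ∈ S, Ioc ((P.1 : ℝ) / d) ((P.1 + δ) / d) ∩ Ioc ((P.2 : ℝ) / d') ((P.2 + δ') / d') := by
    rintro y ⟨h, h'⟩
    simp only [reducedIoc, mem_iUnion, Finset.mem_filter, Finset.mem_range] at h h'
    obtain ⟨p, ⟨hp, hpc⟩, hy⟩ := h
    obtain ⟨p', ⟨hp', hpc'⟩, hy'⟩ := h'
    simp only [mem_iUnion]
    refine ⟨(p, p'), ?_, hy, hy'⟩
    simp only [hS, Finset.mem_filter, Finset.mem_product, Finset.mem_range]
    refine ⟨⟨hp, hp'⟩, ?_, ?_⟩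
    · intro h0
      have h1 : p * d' = p' * d := by
        have : (p : ℤ) * d' = p' * d := by linarith
        exact_mod_cast this
      have h2 : d ∣ d' := hpc.dvd_of_dvd_mul_left ⟨p', by rw [h1]; ring⟩
      have h3 : d' ∣ d := hpc'.dvd_of_dvd_mul_left ⟨p, by rw [← h1]; ring⟩
      exact hne (Nat.dvd_antisymm h2 h3)
    · have a1 := hy.1.trans_le hy'.2
      have a2 := hy'.1.trans_le hy.2
      have e1 : (p : ℝ) / d - p' / d' ≤ Δ := by
        have := le_max_right (δ / d) (δ' / d'); rw [add_div] at a1; linarith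
      have e2 : (p' : ℝ) / d' - p / d ≤ Δ := by
        have := le_max_left (δ / d) (δ' / d'); rw [add_div] at a2; linarith
      have e3 : (p : ℝ) * d' - p' * d = (p / d - p' / d') * (d * d') := by field_simp
      rw [e3, abs_mul, abs_of_pos (mul_pos hdR hdR'), hB]
      gcongr
      exact abs_le.2 ⟨by linarith, e1⟩
  calc volume (reducedIoc d δ ∩ reducedIoc d' δ')
      ≤ ∑ P ∈ S, volume (Ioc ((P.1 : ℝ) / d) ((P.1 + δ) / d) ∩
          Ioc ((P.2 : ℝ) / d') ((P.2 + δ') / d')) :=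
        (measure_mono hsub).trans (measure_biUnion_finset_le _ _)
    _ ≤ ∑ P ∈ S, ENNReal.ofReal (min (δ / d) (δ' / d')) := by
        refine Finset.sum_le_sum fun P _ => ?_
        rw [ENNReal.ofReal_min]
        refine le_min ((measure_mono inter_subset_left).trans ?_)
          ((measure_mono inter_subset_right).trans ?_)
        · rw [Real.volume_Ioc]; apply le_of_eq; congr 1; ring
        · rw [Real.volume_Ioc]; apply le_of_eq; congr 1; ring
    _ = ENNReal.ofReal (S.card * min (δ / d) (δ' / d')) := by
        rw [Finset.sum_const, nsmul_eq_mul, ENNReal.ofReal_mul (by positivity),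
          ENNReal.ofReal_natCast]
    _ ≤ ENNReal.ofReal (2 * δ * δ') := by
        apply ENNReal.ofReal_le_ofReal
        have hc : (S.card : ℝ) ≤ 2 * B := card_cross_lt_le hd hB0
        calc (S.card : ℝ) * min (δ / d) (δ' / d') ≤ 2 * B * min (δ / d) (δ' / d') := by gcongr
          _ = 2 * (min (δ / d) (δ' / d') * max (δ / d) (δ' / d')) * (d * d') := by
              rw [hB, hΔ]; ring
          _ = 2 * δ * δ' := by rw [min_mul_max]; field_simp

/-- The subset of the circle corresponding to `reducedIoc d δ`. -/
def reducedArc (d : ℕ) (δ : ℝ) : Set UnitAddCircle :=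
  {u | (AddCircle.equivIoc (1 : ℝ) 0 u : ℝ) ∈ reducedIoc d δ}

theorem measurableSet_reducedArc (d : ℕ) (δ : ℝ) : MeasurableSet (reducedArc d δ) :=
  (measurable_subtype_coe.comp (AddCircle.measurableEquivIoc (1 : ℝ) 0).measurable)
    (measurableSet_reducedIoc d δ)

theorem volume_setOf_equivIoc {S : Set ℝ} (hS : MeasurableSet S) (hS1 : S ⊆ Ioc 0 1) :
    volume {u : UnitAddCircle | (AddCircle.equivIoc (1 : ℝ) 0 u : ℝ) ∈ S} = volume S := by
  have hm : MeasurableSet {u : UnitAddCircle | (AddCircle.equivIoc (1 : ℝ) 0 u : ℝ) ∈ S} :=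
    (measurable_subtype_coe.comp (AddCircle.measurableEquivIoc (1 : ℝ) 0).measurable) hS
  rw [AddCircle.add_projection_respects_measure (T := 1) 0 hm]
  congr 1
  ext y
  simp only [mem_inter_iff, mem_preimage, mem_ofPred_eq, zero_add]
  constructor
  · rintro ⟨h1, h2⟩
    have : (AddCircle.equivIoc (1 : ℝ) 0 (QuotientAddGroup.mk y) : ℝ) = y :=
      AddCircle.equivIoc_coe_of_mem (by simpa using h2)
    rwa [this] at h1
  · intro h
    have h2 := hS1 h
    refine ⟨?_, h2⟩
    have : (AddCircle.equivIoc (1 : ℝ) 0 (QuotientAddGroup.mk y) : ℝ) = y :=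
      AddCircle.equivIoc_coe_of_mem (by simpa using h2)
    rwa [this]

theorem volume_reducedArc {d : ℕ} (hd : 0 < d) {δ : ℝ} (hδ1 : δ ≤ 1) :
    volume (reducedArc d δ) = ENNReal.ofReal (d.totient / d * δ) := by
  rw [← volume_reducedIoc hd hδ1]
  exact volume_setOf_equivIoc (measurableSet_reducedIoc d δ) (reducedIoc_subset hd hδ1)

theorem volume_reducedArc_inter_le {d d' : ℕ} (hd : 0 < d) (hd' : 0 < d') (hne : d ≠ d')
    {δ δ' : ℝ} (hδ : 0 ≤ δ) (hδ' : 0 ≤ δ') (hδ1 : δ ≤ 1) :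
    volume (reducedArc d δ ∩ reducedArc d' δ') ≤ ENNReal.ofReal (2 * δ * δ') := by
  refine le_trans (le_of_eq ?_) (volume_reducedIoc_inter_le hd hd' hne hδ hδ')
  have e : reducedArc d δ ∩ reducedArc d' δ' =
      {u : UnitAddCircle |
        (AddCircle.equivIoc (1 : ℝ) 0 u : ℝ) ∈ reducedIoc d δ ∩ reducedIoc d' δ'} :=
    Set.ext fun u => Iff.rfl
  rw [e]
  exact volume_setOf_equivIoc
    ((measurableSet_reducedIoc d δ).inter (measurableSet_reducedIoc d' δ'))
    (inter_subset_left.trans (reducedIoc_subset hd hδ1))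

theorem norm_nsmul_le_of_mem_reducedArc {d : ℕ} {δ : ℝ} {u : UnitAddCircle}
    (hu : u ∈ reducedArc d δ) : ‖d • u‖ ≤ δ := by
  set y : ℝ := (AddCircle.equivIoc (1 : ℝ) 0 u : ℝ) with hy
  have hyu : (y : UnitAddCircle) = u := (AddCircle.equivIoc (1 : ℝ) 0).symm_apply_apply u
  have hmem : y ∈ reducedIoc d δ := hu
  simp only [reducedIoc, mem_iUnion, Finset.mem_filter, Finset.mem_range] at hmem
  obtain ⟨p, ⟨hp, -⟩, h1, h2⟩ := hmem
  have hd : (0 : ℝ) < d := by exact_mod_cast (Nat.zero_le p).trans_lt hp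
  rw [div_lt_iff₀ hd] at h1
  rw [le_div_iff₀ hd] at h2
  rw [← hyu, ← AddCircle.coe_nsmul, UnitAddCircle.norm_eq]
  have h3 := round_le (d • y) (p : ℤ)
  refine h3.trans ?_
  rw [nsmul_eq_mul, abs_le]
  push_cast
  constructor <;> nlinarith

end WeightedApprox

namespace WeightedApprox

open MeasureTheory Set

/-! ### Linear forms on the torus -/

/-- The row vector `k` times the matrix `x`, for matrices with entries in the circle. -/
def torusForm {n : ℕ} (m : ℕ) (k : Fin n → ℤ) :
    (Fin n × Fin m → UnitAddCircle) →+ (Fin m → UnitAddCircle) where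
  toFun x j := ∑ i, k i • x (i, j)
  map_zero' := by ext j; simp
  map_add' x y := by ext j; simp [smul_add, Finset.sum_add_distrib]

theorem torusForm_apply {n m : ℕ} (k : Fin n → ℤ) (x : Fin n × Fin m → UnitAddCircle)
    (j : Fin m) : torusForm m k x j = ∑ i, k i • x (i, j) := rfl

theorem continuous_torusForm {n m : ℕ} (k : Fin n → ℤ) : Continuous (torusForm m k) := by
  refine continuous_pi fun j => ?_
  simp only [torusForm_apply]
  fun_prop

theorem torusForm_nsmul {n m : ℕ} (d : ℕ) (k : Fin n → ℤ) (x : Fin n × Fin m → UnitAddCircle)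
    (j : Fin m) : torusForm m ((d : ℤ) • k) x j = d • torusForm m k x j := by
  simp only [torusForm_apply, Finset.smul_sum, Pi.smul_apply]
  refine Finset.sum_congr rfl fun i _ => ?_
  rw [smul_eq_mul, mul_smul, natCast_zsmul]

theorem surjective_torusForm {n m : ℕ} {k : Fin n → ℤ} (hk : k ≠ 0) :
    Function.Surjective (torusForm m k) := by
  obtain ⟨i0, hi0⟩ := Function.ne_iff.1 hk
  intro u
  choose y hy using fun j => QuotientAddGroup.mk_surjective (u j)
  refine ⟨fun p => if p.1 = i0 then ((y p.2 / k i0 : ℝ) : UnitAddCircle) else 0, ?_⟩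
  ext j
  rw [torusForm_apply, Finset.sum_eq_single i0 (by intro b _ hb; simp [hb]) (by simp)]
  simp only [if_true]
  rw [← AddCircle.coe_zsmul, zsmul_eq_mul, mul_div_cancel₀ _ (by exact_mod_cast hi0)]
  exact hy j

theorem surjective_torusForm_prod {n m : ℕ} {k k' : Fin n → ℤ} {i0 i1 : Fin n}
    (hk : k i0 * k' i1 - k i1 * k' i0 ≠ 0) :
    Function.Surjective ((torusForm m k).prod (torusForm m k')) := by
  rintro ⟨u, u'⟩
  choose y hy using fun j => QuotientAddGroup.mk_surjective (u j)
  choose y' hy' using fun j => QuotientAddGroup.mk_surjective (u' j)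
  have hne : i0 ≠ i1 := by rintro rfl; exact hk (by ring)
  have hD : ((k i0 : ℝ) * k' i1 - k i1 * k' i0) ≠ 0 := by exact_mod_cast hk
  set D : ℝ := (k i0 : ℝ) * k' i1 - k i1 * k' i0 with hDdef
  set x : Fin n × Fin m → UnitAddCircle := fun p =>
    if p.1 = i0 then (((y p.2 * k' i1 - y' p.2 * k i1) / D : ℝ) : UnitAddCircle)
    else if p.1 = i1 then (((k i0 * y' p.2 - k' i0 * y p.2) / D : ℝ) : UnitAddCircle) else 0
    with hx
  have hsum : ∀ (c : Fin n → ℤ) (j : Fin m), torusForm m c x j =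
      ((c i0 * ((y j * k' i1 - y' j * k i1) / D) + c i1 * ((k i0 * y' j - k' i0 * y j) / D) : ℝ)
        : UnitAddCircle) := by
    intro c j
    rw [torusForm_apply, ← Finset.sum_subset (Finset.subset_univ {i0, i1}), Finset.sum_pair hne]
    · simp only [hx, if_true, if_neg hne.symm]
      rw [← AddCircle.coe_zsmul, ← AddCircle.coe_zsmul, ← AddCircle.coe_add, zsmul_eq_mul,
        zsmul_eq_mul]
    · intro i _ hi
      simp only [Finset.mem_insert, Finset.mem_singleton, not_or] at hi
      simp [hx, hi.1, hi.2]
  refine ⟨x, Prod.ext ?_ ?_⟩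
  · ext j
    change torusForm m k x j = u j
    rw [hsum, ← hy j]
    congr 1
    field_simp
    rw [hDdef]; ring
  · ext j
    change torusForm m k' x j = u' j
    rw [hsum, ← hy' j]
    congr 1
    field_simp
    rw [hDdef]; ring

theorem volume_univ_torus (ι : Type*) [Fintype ι] :
    volume (univ : Set (ι → UnitAddCircle)) = 1 := by
  simp [volume_pi, Measure.pi_univ]

instance (ι : Type*) [Fintype ι] : IsProbabilityMeasure (volume : Measure (ι → UnitAddCircle)) :=
  ⟨volume_univ_torus ι⟩

theorem measurePreserving_torusForm {n m : ℕ} {k : Fin n → ℤ} (hk : k ≠ 0) :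
    MeasurePreserving (torusForm m k) volume volume :=
  (torusForm m k).measurePreserving (continuous_torusForm k) (surjective_torusForm hk)
    (by rw [volume_univ_torus, volume_univ_torus])

theorem measurePreserving_torusForm_prod {n m : ℕ} {k k' : Fin n → ℤ} {i0 i1 : Fin n}
    (hk : k i0 * k' i1 - k i1 * k' i0 ≠ 0) :
    MeasurePreserving ((torusForm m k).prod (torusForm m k')) volume volume := by
  have : (volume : Measure ((Fin m → UnitAddCircle) × (Fin m → UnitAddCircle))).IsAddHaarMeasure :=
    Measure.prod.instIsAddHaarMeasure volume volume
  exact ((torusForm m k).prod (torusForm m k')).measurePreserving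
    ((continuous_torusForm k).prodMk (continuous_torusForm k')) (surjective_torusForm_prod hk)
    (by rw [volume_univ_torus, Measure.volume_eq_prod, measure_univ])

theorem volume_torusForm_preimage {n m : ℕ} {k : Fin n → ℤ} (hk : k ≠ 0)
    {S : Fin m → Set UnitAddCircle} (hS : ∀ j, MeasurableSet (S j)) :
    volume (torusForm m k ⁻¹' (univ.pi S)) = ∏ j, volume (S j) := by
  rw [(measurePreserving_torusForm hk).measure_preimage
    (MeasurableSet.univ_pi hS).nullMeasurableSet, volume_pi_pi]

theorem volume_torusForm_preimage_inter {n m : ℕ} {k k' : Fin n → ℤ} {i0 i1 : Fin n}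
    (hk : k i0 * k' i1 - k i1 * k' i0 ≠ 0)
    {S S' : Fin m → Set UnitAddCircle} (hS : ∀ j, MeasurableSet (S j))
    (hS' : ∀ j, MeasurableSet (S' j)) :
    volume (torusForm m k ⁻¹' (univ.pi S) ∩ torusForm m k' ⁻¹' (univ.pi S')) =
      (∏ j, volume (S j)) * ∏ j, volume (S' j) := by
  have h := (measurePreserving_torusForm_prod (m := m) hk).measure_preimage
    ((MeasurableSet.univ_pi hS).prod (MeasurableSet.univ_pi hS')).nullMeasurableSet
  rw [Measure.volume_eq_prod, Measure.prod_prod, volume_pi_pi, volume_pi_pi] at h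
  exact h

/-- Proportional primitive integer vectors with a coordinate of the same sign are equal. -/
theorem eq_of_minors_eq_zero {n : ℕ} {k k' : Fin n → ℤ} (hk : Finset.univ.gcd k = 1)
    (hk' : Finset.univ.gcd k' = 1) {l : Fin n} (hl : 0 < k l * k' l)
    (h : ∀ i j, k i * k' j - k j * k' i = 0) : k = k' := by
  have h1 : Finset.univ.gcd (fun j => k l * k' j) = Finset.univ.gcd (fun j => k' l * k j) :=
    Finset.gcd_congr rfl fun j _ => by linarith [h l j]
  rw [Finset.gcd_mul_left, Finset.gcd_mul_left, hk, hk', mul_one, mul_one] at h1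
  have h2 : (k l).natAbs = (k' l).natAbs := by
    rw [← Int.abs_eq_normalize, ← Int.abs_eq_normalize] at h1
    rw [Int.abs_eq_natAbs, Int.abs_eq_natAbs] at h1
    exact_mod_cast h1
  have h0 : k l ≠ 0 := left_ne_zero_of_mul hl.ne'
  have h3 : k l = k' l := by
    rcases Int.natAbs_eq_natAbs_iff.1 h2 with h | h
    · exact h
    · exfalso; rw [h] at hl; nlinarith [sq_nonneg (k' l)]
  ext j
  have h4 := h l j
  rw [← h3] at h4
  have : k l * (k' j - k j) = 0 := by linarith
  rcases mul_eq_zero.1 this with h | h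
  · exact absurd h h0
  · linarith

/-! ### Divergence Borel-Cantelli with quasi-independence -/

/-- The second moment bound for the union of finitely many pairwise quasi-independent sets. -/
theorem measureReal_biUnion_ge {α ι : Type*} [MeasurableSpace α] {μ : Measure α}
    [IsProbabilityMeasure μ] {A : ι → Set α} (hA : ∀ i, MeasurableSet (A i)) {w : ι → ℝ} {c C : ℝ}
    (hw : ∀ i, 0 ≤ w i) (hc : 0 ≤ c) (hC : 0 ≤ C) (hlow : ∀ i, c * w i ≤ μ.real (A i))
    (hup : ∀ i, μ.real (A i) ≤ w i)
    (hpair : ∀ i j, i ≠ j → μ.real (A i ∩ A j) ≤ C * (w i * w j))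
    (F : Finset ι) (hF : 1 ≤ ∑ i ∈ F, w i) :
    c ^ 2 / (1 + C) ≤ μ.real (⋃ i ∈ F, A i) := by
  classical
  set S := ∑ i ∈ F, w i with hS
  set U := ⋃ i ∈ F, A i with hU
  have hUm : MeasurableSet U := Finset.measurableSet_biUnion _ fun i _ => hA i
  set N : α → ℝ := fun x => ∑ i ∈ F, (A i).indicator 1 x with hN
  have hint : ∀ i, Integrable ((A i).indicator (1 : α → ℝ)) μ := fun i =>
    (integrable_const (1 : ℝ)).indicator (hA i)
  have hint2 : ∀ i j, Integrable ((A i ∩ A j).indicator (1 : α → ℝ)) μ := fun i j =>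
    (integrable_const (1 : ℝ)).indicator ((hA i).inter (hA j))
  have hN2 : ∀ x, N x ^ 2 = ∑ i ∈ F, ∑ j ∈ F, (A i ∩ A j).indicator (1 : α → ℝ) x := by
    intro x
    rw [sq, hN, Finset.sum_mul_sum]
    refine Finset.sum_congr rfl fun i _ => Finset.sum_congr rfl fun j _ => ?_
    rw [Set.inter_indicator_one]; rfl
  set t : ℝ := c / ((1 + C) * S) with ht
  have hS0 : 0 < S := by linarith
  have ht0 : 0 ≤ t := by positivity
  -- the pointwise bound `1_U ≥ 2 t N - t² N²` replaces the Cauchy-Schwarz inequality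
  have hpt : ∀ x, 2 * t * N x - t ^ 2 * N x ^ 2 ≤ U.indicator (1 : α → ℝ) x := by
    intro x
    by_cases hx : x ∈ U
    · rw [Set.indicator_of_mem hx, Pi.one_apply]
      nlinarith [sq_nonneg (1 - t * N x)]
    · have : N x = 0 := by
        refine Finset.sum_eq_zero fun i hi => Set.indicator_of_notMem (fun h => hx ?_) _
        exact mem_biUnion hi h
      rw [Set.indicator_of_notMem hx, this]; simp
  have hi1 : ∫ x, N x ∂μ = ∑ i ∈ F, μ.real (A i) := by
    rw [hN, integral_finsetSum _ fun i _ => hint i]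
    exact Finset.sum_congr rfl fun i _ => integral_indicator_one (hA i)
  have hi2 : ∫ x, N x ^ 2 ∂μ = ∑ i ∈ F, ∑ j ∈ F, μ.real (A i ∩ A j) := by
    simp_rw [hN2]
    rw [integral_finsetSum _ fun i _ => integrable_finsetSum _ fun j _ => hint2 i j]
    refine Finset.sum_congr rfl fun i _ => ?_
    rw [integral_finsetSum _ fun j _ => hint2 i j]
    exact Finset.sum_congr rfl fun j _ => integral_indicator_one ((hA i).inter (hA j))
  have hNint : Integrable N μ := integrable_finsetSum _ fun i _ => hint i
  have hN2int : Integrable (fun x => N x ^ 2) μ := by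
    simp_rw [hN2]
    exact integrable_finsetSum _ fun i _ => integrable_finsetSum _ fun j _ => hint2 i j
  have hmain : 2 * t * (∫ x, N x ∂μ) - t ^ 2 * (∫ x, N x ^ 2 ∂μ) ≤ μ.real U := by
    rw [← integral_indicator_one hUm, ← integral_const_mul, ← integral_const_mul,
      ← integral_sub (hNint.const_mul _) (hN2int.const_mul _)]
    exact integral_mono ((hNint.const_mul _).sub (hN2int.const_mul _))
      ((integrable_const (1 : ℝ)).indicator hUm) hpt
  have hb1 : c * S ≤ ∫ x, N x ∂μ := by
    rw [hi1, hS, Finset.mul_sum]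
    exact Finset.sum_le_sum fun i _ => hlow i
  have hb2 : ∫ x, N x ^ 2 ∂μ ≤ (1 + C) * S ^ 2 := by
    have : ∫ x, N x ^ 2 ∂μ ≤ ∑ i ∈ F, (w i + C * (w i * S)) := by
      rw [hi2]
      refine Finset.sum_le_sum fun i hi => ?_
      rw [← Finset.add_sum_erase _ _ hi, inter_self]
      refine add_le_add (hup i) ?_
      rw [hS, Finset.mul_sum, Finset.mul_sum]
      calc ∑ j ∈ F.erase i, μ.real (A i ∩ A j) ≤ ∑ j ∈ F.erase i, C * (w i * w j) :=
            Finset.sum_le_sum fun j hj => hpair i j (Finset.ne_of_mem_erase hj).symm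
        _ ≤ ∑ j ∈ F, C * (w i * w j) :=
            Finset.sum_le_sum_of_subset_of_nonneg (Finset.erase_subset _ _) fun j _ _ =>
              mul_nonneg hC (mul_nonneg (hw i) (hw j))
    refine this.trans ?_
    rw [Finset.sum_add_distrib, ← hS, ← Finset.mul_sum, ← Finset.sum_mul, ← hS]
    nlinarith
  refine le_trans ?_ hmain
  have e : c ^ 2 / (1 + C) = 2 * t * (c * S) - t ^ 2 * ((1 + C) * S ^ 2) := by
    rw [ht]; field_simp; ring
  rw [e]
  gcongr

theorem setOf_infinite_eq_iInter {α ι : Type*} (A : ι → Set α) :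
    {x | {i | x ∈ A i}.Infinite} = ⋂ E : Finset ι, ⋃ i ∈ {i | i ∉ E}, A i := by
  ext x
  simp only [mem_ofPred_eq, mem_iInter, mem_iUnion, exists_prop]
  constructor
  · intro h E
    obtain ⟨i, hi, hiE⟩ := h.exists_notMem_finset E
    exact ⟨i, hiE, hi⟩
  · intro h hfin
    obtain ⟨i, hi, hx⟩ := h hfin.toFinset
    exact hi (hfin.mem_toFinset.2 hx)

theorem measurableSet_setOf_infinite {α ι : Type*} [Countable ι] [MeasurableSpace α]
    {A : ι → Set α} (hA : ∀ i, MeasurableSet (A i)) :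
    MeasurableSet {x | {i | x ∈ A i}.Infinite} := by
  rw [setOf_infinite_eq_iInter]
  exact MeasurableSet.iInter fun E => MeasurableSet.biUnion (Set.to_countable _) fun i _ => hA i

/-- The divergence part of the Borel-Cantelli lemma for sets that are pairwise quasi-independent:
the limsup set has measure bounded from below. -/
theorem measureReal_infinite_ge {α ι : Type*} [Countable ι] [MeasurableSpace α] {μ : Measure α}
    [IsProbabilityMeasure μ] {A : ι → Set α} (hA : ∀ i, MeasurableSet (A i)) {w : ι → ℝ} {c C : ℝ}
    (hw : ∀ i, 0 ≤ w i) (hc : 0 ≤ c) (hC : 0 ≤ C) (hlow : ∀ i, c * w i ≤ μ.real (A i))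
    (hup : ∀ i, μ.real (A i) ≤ w i)
    (hpair : ∀ i j, i ≠ j → μ.real (A i ∩ A j) ≤ C * (w i * w j)) (hsum : ¬ Summable w) :
    ENNReal.ofReal (c ^ 2 / (1 + C)) ≤ μ {x | {i | x ∈ A i}.Infinite} := by
  classical
  set T : Finset ι → Set α := fun E => ⋃ i ∈ {i | i ∉ E}, A i with hT
  have hTm : ∀ E, MeasurableSet (T E) := fun E =>
    MeasurableSet.biUnion (Set.to_countable _) fun i _ => hA i
  have hlo : ∀ E, ENNReal.ofReal (c ^ 2 / (1 + C)) ≤ μ (T E) := by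
    intro E
    have hex : ∃ F : Finset ι, Disjoint F E ∧ 1 ≤ ∑ i ∈ F, w i := by
      by_contra hcon
      push Not at hcon
      refine hsum (summable_of_sum_le hw (c := ∑ i ∈ E, w i + 1) fun F => ?_)
      rw [← Finset.sum_sdiff (Finset.inter_subset_left : F ∩ E ⊆ F), add_comm]
      refine add_le_add (Finset.sum_le_sum_of_subset_of_nonneg Finset.inter_subset_right
        fun i _ _ => hw i) (hcon _ ?_).le
      rw [Finset.sdiff_inter_self_left]
      exact Finset.sdiff_disjoint
    obtain ⟨F, hFE, hF⟩ := hex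
    have h := measureReal_biUnion_ge hA hw hc hC hlow hup hpair F hF
    have hsub : (⋃ i ∈ F, A i) ⊆ T E := by
      refine iUnion₂_subset fun i hi => ?_
      exact subset_biUnion_of_mem (u := A) (Finset.disjoint_left.1 hFE hi)
    calc ENNReal.ofReal (c ^ 2 / (1 + C)) ≤ ENNReal.ofReal (μ.real (⋃ i ∈ F, A i)) :=
          ENNReal.ofReal_le_ofReal h
      _ = μ (⋃ i ∈ F, A i) := ofReal_measureReal (measure_ne_top _ _)
      _ ≤ μ (T E) := measure_mono hsub
  rw [setOf_infinite_eq_iInter]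
  change _ ≤ μ (⋂ E, T E)
  rw [Directed.measure_iInter (fun E => (hTm E).nullMeasurableSet) ?_ ⟨∅, measure_ne_top _ _⟩]
  · exact le_iInf hlo
  · refine directed_of_isDirected_le fun E E' h => ?_
    exact biUnion_subset_biUnion_left fun i hi hiE => hi (h hiE)

end WeightedApprox

namespace WeightedApprox

open MeasureTheory Set

/-! ### A Khintchine-Groshev theorem on the torus -/

/-- The matrices `x` for which each `k x_j` lies right of a reduced fraction with denominator `d`,
at distance at most `δ j / d`. -/
def reducedSet {n m : ℕ} (k : Fin n → ℤ) (d : ℕ) (δ : Fin m → ℝ) :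
    Set (Fin n × Fin m → UnitAddCircle) :=
  torusForm m k ⁻¹' (univ.pi fun j => reducedArc d (δ j))

theorem measurableSet_reducedSet {n m : ℕ} (k : Fin n → ℤ) (d : ℕ) (δ : Fin m → ℝ) :
    MeasurableSet (reducedSet k d δ) :=
  (continuous_torusForm k).measurable (MeasurableSet.univ_pi fun _ => measurableSet_reducedArc _ _)

theorem measureReal_reducedSet {n m : ℕ} {k : Fin n → ℤ} (hk : k ≠ 0) {d : ℕ} (hd : 0 < d)
    {δ : Fin m → ℝ} (h0 : ∀ j, 0 ≤ δ j) (h1 : ∀ j, δ j ≤ 1) :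
    volume.real (reducedSet k d δ) = ∏ j, ((d.totient : ℝ) / d * δ j) := by
  rw [Measure.real, reducedSet, volume_torusForm_preimage hk fun _ => measurableSet_reducedArc _ _,
    ENNReal.toReal_prod]
  refine Finset.prod_congr rfl fun j _ => ?_
  rw [volume_reducedArc hd (h1 j), ENNReal.toReal_ofReal]
  have := h0 j
  positivity

theorem totient_div_le_one (d : ℕ) : (d.totient : ℝ) / d ≤ 1 :=
  div_le_one_of_le₀ (by exact_mod_cast Nat.totient_le d) (Nat.cast_nonneg d)

/-- Quasi-independence. For vectors that are not proportional the two sets are independent; for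
proportional ones, which coincide because they are primitive, the separation of reduced fractions
with different denominators takes over. -/
theorem measureReal_reducedSet_inter_le {n m : ℕ} {k k' : Fin n → ℤ}
    (hk : Finset.univ.gcd k = 1) (hk' : Finset.univ.gcd k' = 1) {l : Fin n} (hl : 0 < k l * k' l)
    {d d' : ℕ} (hd : 0 < d) (hd' : 0 < d') (hne : k = k' → d ≠ d')
    {δ δ' : Fin m → ℝ} (h0 : ∀ j, 0 ≤ δ j) (h1 : ∀ j, δ j ≤ 1)
    (h0' : ∀ j, 0 ≤ δ' j) (h1' : ∀ j, δ' j ≤ 1) :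
    volume.real (reducedSet k d δ ∩ reducedSet k' d' δ') ≤
      2 ^ m * ((∏ j, δ j) * ∏ j, δ' j) := by
  have hk0 : k ≠ 0 := by rintro rfl; simp at hl
  have hk0' : k' ≠ 0 := by rintro rfl; simp at hl
  by_cases h : ∀ i j, k i * k' j - k j * k' i = 0
  · obtain rfl := eq_of_minors_eq_zero hk hk' hl h
    have e : reducedSet k d δ ∩ reducedSet k d' δ' =
        torusForm m k ⁻¹' (univ.pi fun j => reducedArc d (δ j) ∩ reducedArc d' (δ' j)) := by
      rw [reducedSet, reducedSet, ← preimage_inter, pi_inter_distrib]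
    rw [e, Measure.real, volume_torusForm_preimage hk0
      fun _ => (measurableSet_reducedArc _ _).inter (measurableSet_reducedArc _ _),
      ENNReal.toReal_prod]
    calc ∏ j, (volume (reducedArc d (δ j) ∩ reducedArc d' (δ' j))).toReal
        ≤ ∏ j, (2 * δ j * δ' j) := by
          refine Finset.prod_le_prod (fun _ _ => ENNReal.toReal_nonneg) fun j _ => ?_
          refine ENNReal.toReal_le_of_le_ofReal ?_
            (volume_reducedArc_inter_le hd hd' (hne rfl) (h0 j) (h0' j) (h1 j))
          have := h0 j; have := h0' j; positivity
      _ = 2 ^ m * ((∏ j, δ j) * ∏ j, δ' j) := by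
          simp_rw [mul_assoc]
          rw [Finset.prod_mul_distrib, Finset.prod_mul_distrib]; simp
  · push Not at h
    obtain ⟨i0, i1, h⟩ := h
    have e : volume.real (reducedSet k d δ ∩ reducedSet k' d' δ') =
        volume.real (reducedSet k d δ) * volume.real (reducedSet k' d' δ') := by
      rw [Measure.real, Measure.real, Measure.real, ← ENNReal.toReal_mul, reducedSet, reducedSet,
        volume_torusForm_preimage_inter h (fun _ => measurableSet_reducedArc _ _)
          fun _ => measurableSet_reducedArc _ _,
        volume_torusForm_preimage hk0 fun _ => measurableSet_reducedArc _ _,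
        volume_torusForm_preimage hk0' fun _ => measurableSet_reducedArc _ _]
    have hb : ∀ {k : Fin n → ℤ} {d : ℕ} {δ : Fin m → ℝ}, k ≠ 0 → 0 < d → (∀ j, 0 ≤ δ j) →
        (∀ j, δ j ≤ 1) → volume.real (reducedSet k d δ) ≤ ∏ j, δ j := by
      intro k d δ hk hd h0 h1
      rw [measureReal_reducedSet hk hd h0 h1]
      refine Finset.prod_le_prod (fun j _ => ?_) fun j _ => ?_
      · have := h0 j; positivity
      · exact mul_le_of_le_one_left (h0 j) (totient_div_le_one d)
    have hp : 0 ≤ ∏ j, δ j := Finset.prod_nonneg fun j _ => h0 j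
    have hp' : 0 ≤ ∏ j, δ' j := Finset.prod_nonneg fun j _ => h0' j
    rw [e]
    calc volume.real (reducedSet k d δ) * volume.real (reducedSet k' d' δ')
        ≤ (∏ j, δ j) * ∏ j, δ' j :=
          mul_le_mul (hb hk0 hd h0 h1) (hb hk0' hd' h0' h1') measureReal_nonneg hp
      _ ≤ 2 ^ m * ((∏ j, δ j) * ∏ j, δ' j) :=
          le_mul_of_one_le_left (mul_nonneg hp hp') (one_le_pow₀ one_le_two)

/-- The points `x` of the torus with `‖q x_j‖ ≤ δ j` for all `j`. -/
def torusSlab {n m : ℕ} (q : Fin n → ℤ) (δ : Fin m → ℝ) : Set (Fin n × Fin m → UnitAddCircle) :=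
  {x | ∀ j, ‖torusForm m q x j‖ ≤ δ j}

theorem isClosed_torusSlab {n m : ℕ} (q : Fin n → ℤ) (δ : Fin m → ℝ) :
    IsClosed (torusSlab q δ) := by
  have : torusSlab q δ = ⋂ j, {x | ‖torusForm m q x j‖ ≤ δ j} := by
    ext x; simp [torusSlab]
  rw [this]
  exact isClosed_iInter fun j =>
    isClosed_le ((continuous_apply j).comp (continuous_torusForm q)).norm continuous_const

theorem ergodic_two_nsmul (ι : Type*) [Fintype ι] :
    Ergodic (fun x : ι → UnitAddCircle => 2 • x) volume := by
  refine AddMonoidHom.ergodic_of_dense_iUnion_preimage_zero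
    (nsmulAddMonoidHom (α := ι → UnitAddCircle) 2) ?_ (continuous_nsmul 2) ?_
  · -- torsion points of order a power of two are dense
    have hit : ∀ (N : ℕ) (x : ι → UnitAddCircle),
        (nsmulAddMonoidHom (α := ι → UnitAddCircle) 2)^[N] x = (2 ^ N) • x := by
      intro N x
      induction N with
      | zero => simp
      | succ N ih =>
        rw [Function.iterate_succ_apply', ih, nsmulAddMonoidHom_apply, smul_smul, pow_succ,
          mul_comm]
    rw [Metric.dense_iff]
    intro x r hr
    choose y hy using fun i => QuotientAddGroup.mk_surjective (x i)
    obtain ⟨N, hN⟩ := exists_pow_lt_of_lt_one (half_pos hr) (by norm_num : (1 / 2 : ℝ) < 1)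
    refine ⟨fun i => ((⌊y i * 2 ^ N⌋ / 2 ^ N : ℝ) : UnitAddCircle), ?_, ?_⟩
    · rw [Metric.mem_ball, dist_pi_lt_iff hr]
      intro i
      have e : (((⌊y i * 2 ^ N⌋ / 2 ^ N : ℝ) : UnitAddCircle)) - x i =
          ((⌊y i * 2 ^ N⌋ / 2 ^ N - y i : ℝ) : UnitAddCircle) := by
        rw [AddCircle.coe_sub, ← hy i]
      rw [dist_eq_norm, e]
      refine lt_of_le_of_lt (le_trans ?_ hN.le) (half_lt_self hr)
      rw [UnitAddCircle.norm_eq]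
      refine (round_le _ 0).trans ?_
      have h2 : (0 : ℝ) < 2 ^ N := by positivity
      have e2 : (⌊y i * 2 ^ N⌋ / 2 ^ N - y i : ℝ) - ((0 : ℤ) : ℝ) =
          -(Int.fract (y i * 2 ^ N) / 2 ^ N) := by
        rw [Int.fract]; push_cast; field_simp
        ring
      rw [e2, abs_neg, abs_of_nonneg (div_nonneg (Int.fract_nonneg _) h2.le), div_pow, one_pow]
      gcongr
      exact (Int.fract_lt_one _).le
    · refine mem_iUnion.2 ⟨N, ?_⟩
      rw [mem_preimage, hit, Set.mem_zero]
      ext i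
      rw [Pi.smul_apply, ← AddCircle.coe_nsmul, nsmul_eq_mul]
      push_cast
      rw [mul_div_cancel₀ _ (by positivity)]
      exact (AddCircle.coe_eq_zero_iff (1 : ℝ)).2 ⟨⌊y i * 2 ^ N⌋, by simp⟩
  · intro x
    choose y hy using fun i => QuotientAddGroup.mk_surjective (x i)
    refine ⟨fun i => ((y i / 2 : ℝ) : UnitAddCircle), ?_⟩
    ext i
    rw [nsmulAddMonoidHom_apply, Pi.smul_apply, ← AddCircle.coe_nsmul, nsmul_eq_mul]
    push_cast
    rw [mul_div_cancel₀ _ two_ne_zero]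
    exact hy i

theorem exists_primitive {n : ℕ} {q : Fin n → ℤ} {l : Fin n} (hq : q l ≠ 0) :
    ∃ (d : ℕ) (k : Fin n → ℤ), 0 < d ∧ q = (d : ℤ) • k ∧ Finset.univ.gcd k = 1 := by
  obtain ⟨g, hg, hg1⟩ := Finset.extract_gcd (s := Finset.univ) q ⟨l, Finset.mem_univ l⟩
  have hnn : 0 ≤ Finset.univ.gcd q := by
    rw [← Finset.normalize_gcd]; exact Int.nonneg_of_normalize_eq_self (normalize_idem _)
  have h0 : Finset.univ.gcd q ≠ 0 := fun h => hq (Finset.gcd_eq_zero_iff.1 h l (Finset.mem_univ l))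
  refine ⟨(Finset.univ.gcd q).toNat, g, by omega, ?_, hg1⟩
  ext i
  rw [Pi.smul_apply, smul_eq_mul, Int.toNat_of_nonneg hnn]
  exact hg i (Finset.mem_univ i)

/-- A Khintchine-Groshev theorem without monotonicity, for vectors `q` in a half-space whose
divisors `d` satisfy `φ(d) ≥ c d`.  Restricting to reduced fractions makes the approximation sets
quasi-independent, which gives positive measure uniformly when the radii are multiplied by a
constant; the intersection over all these constants is invariant under doubling, hence full. -/
theorem ae_infinite_torusSlab {ι : Type*} [Countable ι] {n m : ℕ} {q : ι → Fin n → ℤ}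
    (hinj : Function.Injective q) {l : Fin n} {σ : ℤ} (hσ : ∀ i, 0 < σ * q i l)
    {c : ℝ} (hc : 0 < c) (hdiv : ∀ i, ∀ d : ℕ, (d : ℤ) ∣ q i l → c * d ≤ d.totient)
    {δ : ι → Fin m → ℝ} (h0 : ∀ i j, 0 ≤ δ i j) (h1 : ∀ i j, δ i j ≤ 1)
    (hsum : ¬ Summable fun i => ∏ j, δ i j) :
    ∀ᵐ x : Fin n × Fin m → UnitAddCircle, {i | x ∈ torusSlab (q i) (δ i)}.Infinite := by
  have hql : ∀ i, q i l ≠ 0 := fun i h => by have := hσ i; rw [h] at this; simp at this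
  choose d k hd hqk hk using fun i => exists_primitive (hql i)
  have hkl : ∀ i j, 0 < k i l * k j l := by
    have hsgn : ∀ i, 0 < σ * k i l := by
      intro i
      have h := hσ i
      rw [hqk i, Pi.smul_apply, smul_eq_mul] at h
      have hdi : (0 : ℤ) < d i := by exact_mod_cast hd i
      have : 0 < (d i : ℤ) * (σ * k i l) := by linarith
      exact (pos_iff_pos_of_mul_pos this).1 hdi
    intro i j
    have h := mul_pos (hsgn i) (hsgn j)
    have : 0 < σ ^ 2 * (k i l * k j l) := by linarith
    exact pos_of_mul_pos_right this (sq_nonneg σ)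
  have hk0 : ∀ i, k i ≠ 0 := fun i h => by have := hkl i i; rw [h] at this; simp at this
  have hφ : ∀ i, c ≤ ((d i).totient : ℝ) / d i := by
    intro i
    have hdi : (0 : ℝ) < d i := by exact_mod_cast hd i
    rw [le_div_iff₀ hdi]
    exact hdiv i (d i) ⟨k i l, by rw [hqk i]; rfl⟩
  set c' : ℝ := c ^ m with hc'
  set c0 : ℝ := c' ^ 2 / (1 + 2 ^ m) with hc0
  have hc0pos : 0 < c0 := by positivity
  -- the uniform lower bound
  have hlow : ∀ N : ℕ, ENNReal.ofReal c0 ≤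
      volume {x : Fin n × Fin m → UnitAddCircle |
        {i | x ∈ torusSlab (q i) (fun j => (1 / 2) ^ N * δ i j)}.Infinite} := by
    intro N
    set ε : ℝ := (1 / 2) ^ N with hε
    have hε0 : 0 < ε := by positivity
    have hε1 : ε ≤ 1 := pow_le_one₀ (by norm_num) (by norm_num)
    have hδ0 : ∀ i j, 0 ≤ ε * δ i j := fun i j => mul_nonneg hε0.le (h0 i j)
    have hδ1 : ∀ i j, ε * δ i j ≤ 1 := fun i j => mul_le_one₀ hε1 (h0 i j) (h1 i j)
    have hBC := measureReal_infinite_ge (μ := (volume : Measure (Fin n × Fin m → UnitAddCircle)))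
      (A := fun i => reducedSet (k i) (d i) (fun j => ε * δ i j))
      (fun i => measurableSet_reducedSet _ _ _) (w := fun i => ∏ j, (ε * δ i j)) (c := c')
      (C := 2 ^ m) (fun i => Finset.prod_nonneg fun j _ => hδ0 i j) (by positivity) (by positivity)
      ?_ ?_ ?_ ?_
    · refine hBC.trans (measure_mono fun x hx => hx.mono fun i hi j => ?_)
      rw [hqk i, torusForm_nsmul]
      exact norm_nsmul_le_of_mem_reducedArc (hi j (mem_univ j))
    · intro i
      rw [measureReal_reducedSet (hk0 i) (hd i) (hδ0 i) (hδ1 i),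
        Finset.prod_mul_distrib (f := fun _ => ((d i).totient : ℝ) / d i)]
      refine mul_le_mul_of_nonneg_right ?_ (Finset.prod_nonneg fun j _ => hδ0 i j)
      rw [Finset.prod_const, Finset.card_univ, Fintype.card_fin]
      exact pow_le_pow_left₀ hc.le (hφ i) m
    · intro i
      rw [measureReal_reducedSet (hk0 i) (hd i) (hδ0 i) (hδ1 i)]
      refine Finset.prod_le_prod (fun j _ => ?_) fun j _ => ?_
      · have := hδ0 i j; positivity
      · exact mul_le_of_le_one_left (hδ0 i j) (totient_div_le_one _)
    · intro i j hij
      refine measureReal_reducedSet_inter_le (hk i) (hk j) (hkl i j) (hd i) (hd j) ?_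
        (hδ0 i) (hδ1 i) (hδ0 j) (hδ1 j)
      intro hkk hdd
      exact hij (hinj (by rw [hqk i, hqk j, hkk, hdd]))
    · intro hs
      refine hsum ?_
      simp_rw [Finset.prod_mul_distrib, Finset.prod_const] at hs
      exact (summable_mul_left_iff (by positivity)).1 hs
  set F : ℕ → Set (Fin n × Fin m → UnitAddCircle) := fun N =>
    {x | {i | x ∈ torusSlab (q i) (fun j => (1 / 2) ^ N * δ i j)}.Infinite} with hF
  have hFm : ∀ N, MeasurableSet (F N) := fun N =>
    measurableSet_setOf_infinite fun i => (isClosed_torusSlab _ _).measurableSet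
  have hFanti : Antitone F := by
    intro N N' h x hx
    refine hx.mono fun i hi j => (hi j).trans ?_
    exact mul_le_mul_of_nonneg_right (pow_le_pow_of_le_one (by norm_num) (by norm_num) h) (h0 i j)
  have hFpos : ENNReal.ofReal c0 ≤ volume (⋂ N, F N) := by
    rw [hFanti.directed_ge.measure_iInter (fun N => (hFm N).nullMeasurableSet)
      ⟨0, measure_ne_top _ _⟩]
    exact le_iInf hlow
  have hinv : (⋂ N, F N) ⊆ (fun x : Fin n × Fin m → UnitAddCircle => 2 • x) ⁻¹' (⋂ N, F N) := by
    intro x hx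
    refine mem_iInter.2 fun N => ?_
    refine (mem_iInter.1 hx (N + 1)).mono fun i hi j => ?_
    rw [map_nsmul, Pi.smul_apply]
    refine (norm_nsmul_le (n := 2) (a := torusForm m (q i) x j)).trans ?_
    have h := hi j
    rw [pow_succ] at h
    push_cast
    linarith
  have herg := (ergodic_two_nsmul (Fin n × Fin m)).ae_empty_or_univ_of_ae_le_preimage
    (MeasurableSet.iInter hFm).nullMeasurableSet (Filter.Eventually.of_forall hinv)
  rcases herg with h | h
  · exfalso
    rw [measure_congr h, measure_empty] at hFpos
    exact absurd hFpos (not_le.2 (ENNReal.ofReal_pos.2 hc0pos))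
  · filter_upwards [Filter.eventuallyEq_univ.1 h] with x hx
    have := mem_iInter.1 hx 0
    simpa [hF] using this

end WeightedApprox

namespace WeightedApprox

open MeasureTheory Set

/-! ### Dyadic cubes -/

section Dyadic

variable {ι : Type*}

/-- The index of the half-open dyadic cube of side `2 ^ (-l)` that contains `x`. -/
noncomputable def dyIdx (l : ℕ) (x : ι → ℝ) : ι → ℤ := fun p => ⌊x p * 2 ^ l⌋

/-- The half-open dyadic cube of side `2 ^ (-l)` with index `κ`. -/
def dyCube (l : ℕ) (κ : ι → ℤ) : Set (ι → ℝ) := {x | dyIdx l x = κ}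

/-- The side length `2 ^ (-l)` of the dyadic cubes of level `l`. -/
noncomputable def dySide (l : ℕ) : ℝ≥0 := (1 / 2) ^ l

theorem dySide_pos (l : ℕ) : 0 < dySide l := by unfold dySide; positivity

theorem dySide_anti {l l' : ℕ} (h : l ≤ l') : dySide l' ≤ dySide l :=
  pow_le_pow_of_le_one zero_le (by norm_num) h

theorem coe_dySide (l : ℕ) : ((dySide l : ℝ≥0) : ℝ) = 1 / 2 ^ l := by
  simp [dySide]

theorem exists_dySide_lt {δ : ℝ≥0} (hδ : 0 < δ) : ∃ l, dySide l < δ :=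
  exists_pow_lt_of_lt_one hδ (by norm_num)

theorem mem_dyCube {l : ℕ} {κ : ι → ℤ} {x : ι → ℝ} : x ∈ dyCube l κ ↔ dyIdx l x = κ := Iff.rfl

theorem dyIdx_add (l k : ℕ) (x : ι → ℝ) (p : ι) :
    dyIdx l x p = dyIdx (l + k) x p / 2 ^ k := by
  have h := Int.floor_div_natCast (x p * 2 ^ (l + k)) (2 ^ k)
  unfold dyIdx
  push_cast at h
  rw [← h]
  congr 1
  rw [pow_add]; field_simp

theorem dyIdx_eq_of_le {l l' : ℕ} (h : l ≤ l') {x y : ι → ℝ} (hxy : dyIdx l' x = dyIdx l' y) :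
    dyIdx l x = dyIdx l y := by
  obtain ⟨k, rfl⟩ := Nat.exists_eq_add_of_le h
  ext p
  rw [dyIdx_add l k, dyIdx_add l k, hxy]

theorem dyCube_eq_pi (l : ℕ) (κ : ι → ℤ) :
    dyCube l κ = univ.pi fun p => Ico ((κ p : ℝ) / 2 ^ l) ((κ p + 1) / 2 ^ l) := by
  ext x
  have h2 : (0 : ℝ) < 2 ^ l := by positivity
  simp only [mem_dyCube, funext_iff, mem_univ_pi, mem_Ico, dyIdx, Int.floor_eq_iff,
    div_le_iff₀ h2, lt_div_iff₀ h2]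

theorem measurableSet_dyCube [Fintype ι] (l : ℕ) (κ : ι → ℤ) : MeasurableSet (dyCube l κ) := by
  rw [dyCube_eq_pi]
  exact MeasurableSet.univ_pi fun _ => measurableSet_Ico

theorem volume_dyCube [Fintype ι] (l : ℕ) (κ : ι → ℤ) :
    volume (dyCube l κ) = (dySide l : ℝ≥0∞) ^ Fintype.card ι := by
  rw [dyCube_eq_pi, volume_pi_pi, ← Finset.card_univ, ← Finset.prod_const]
  refine Finset.prod_congr rfl fun p _ => ?_
  rw [Real.volume_Ico, ← ENNReal.ofReal_coe_nnreal, coe_dySide]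
  congr 1
  ring

theorem dyCube_nonempty (l : ℕ) (κ : ι → ℤ) : (dyCube l κ).Nonempty := by
  refine ⟨fun p => κ p / 2 ^ l, ?_⟩
  ext p
  simp [dyIdx]

theorem disjoint_dyCube {l : ℕ} {κ κ' : ι → ℤ} (h : κ ≠ κ') :
    Disjoint (dyCube l κ) (dyCube l κ') :=
  Set.disjoint_left.2 fun _ hx hx' => h (hx.symm.trans hx')

theorem dyCube_subset_of_le {l l' : ℕ} (h : l ≤ l') {κ κ' : ι → ℤ} {x : ι → ℝ}
    (hx : x ∈ dyCube l κ) (hx' : x ∈ dyCube l' κ') : dyCube l' κ' ⊆ dyCube l κ := fun _ hy =>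
  (dyIdx_eq_of_le h (hy.trans hx'.symm)).trans hx

theorem disjoint_or_subset_dyCube {l l' : ℕ} (h : l ≤ l') (κ κ' : ι → ℤ) :
    Disjoint (dyCube l κ) (dyCube l' κ') ∨ dyCube l' κ' ⊆ dyCube l κ := by
  by_cases hd : Disjoint (dyCube l κ) (dyCube l' κ')
  · exact Or.inl hd
  · obtain ⟨x, hx, hx'⟩ := Set.not_disjoint_iff.1 hd
    exact Or.inr (dyCube_subset_of_le h hx hx')

theorem dist_le_of_mem_dyCube [Fintype ι] {l : ℕ} {κ : ι → ℤ} {x y : ι → ℝ} (hx : x ∈ dyCube l κ)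
    (hy : y ∈ dyCube l κ) : dist x y ≤ dySide l := by
  refine (dist_pi_le_iff (NNReal.coe_nonneg _)).2 fun p => ?_
  rw [coe_dySide, le_div_iff₀ (by positivity), Real.dist_eq,
    ← abs_of_pos (by positivity : (0 : ℝ) < 2 ^ l), ← abs_mul, sub_mul]
  exact (Int.abs_sub_lt_one_of_floor_eq_floor (congrFun (hx.trans hy.symm) p)).le

/-- A function that is constant on the dyadic cubes of level `L`. -/
def DyConst {β : Type*} (L : ℕ) (h : (ι → ℝ) → β) : Prop :=
  ∀ x y, dyIdx L x = dyIdx L y → h x = h y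

theorem DyConst.mono {β : Type*} {L L' : ℕ} {h : (ι → ℝ) → β} (hh : DyConst L h) (hL : L ≤ L') :
    DyConst L' h := fun x y hxy => hh x y (dyIdx_eq_of_le hL hxy)

/-- Multiplying a step function by a density that has the mass of Lebesgue measure on each of its
steps does not change its integral over unions of steps. -/
theorem lintegral_mul_eq_of_dyConst [Fintype ι] {L : ℕ} {h φ : (ι → ℝ) → ℝ≥0∞} (hh : DyConst L h)
    (hφ : Measurable φ)
    (hunit : ∀ κ, (∀ x ∈ dyCube L κ, h x ≠ 0) → ∫⁻ x in dyCube L κ, φ x = volume (dyCube L κ))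
    (P : Set (ι → ℤ)) :
    ∫⁻ x in {x | dyIdx L x ∈ P}, h x * φ x = ∫⁻ x in {x | dyIdx L x ∈ P}, h x := by
  have hP : {x : ι → ℝ | dyIdx L x ∈ P} = ⋃ κ ∈ P, dyCube L κ := by
    ext x; simp [mem_dyCube]
  have hdis : P.PairwiseDisjoint (dyCube (ι := ι) L) := fun κ _ κ' _ hne => disjoint_dyCube hne
  rw [hP, lintegral_biUnion (Set.to_countable _) (fun κ _ => measurableSet_dyCube L κ) hdis,
    lintegral_biUnion (Set.to_countable _) (fun κ _ => measurableSet_dyCube L κ) hdis]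
  refine tsum_congr fun κ => ?_
  obtain ⟨x0, hx0⟩ := dyCube_nonempty L κ.1
  have hc : ∀ x ∈ dyCube L κ.1, h x = h x0 := fun x hx => hh x x0 (hx.trans hx0.symm)
  rw [setLIntegral_congr_fun (g := fun x => h x0 * φ x) (measurableSet_dyCube L κ.1)
    (fun x hx => by simp only [hc x hx]), setLIntegral_congr_fun (g := fun _ => h x0)
      (measurableSet_dyCube L κ.1) hc, lintegral_const_mul _ hφ, setLIntegral_const]
  by_cases h0 : h x0 = 0
  · simp [h0]
  · rw [hunit κ.1 fun x hx => by rwa [hc x hx]]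

/-! ### Cantor construction -/

/-- A step density on the unit cube, with a Frostman bound for the gauge `f` on the dyadic cubes
of level at least `l0`. -/
structure Stage (ι : Type*) [Fintype ι] (f : ℝ≥0 → ℝ≥0) (l0 : ℕ) (M : ℝ≥0∞) where
  density : (ι → ℝ) → ℝ≥0∞
  level : ℕ
  measurable : Measurable density
  const : DyConst level density
  bound : ∃ B : ℝ≥0, ∀ x, density x ≤ B
  supp : ∀ x, density x ≠ 0 → x ∈ dyCube 0 (0 : ι → ℤ)
  frostman : ∀ l, l0 ≤ l → ∀ κ : ι → ℤ, ∫⁻ x in dyCube l κ, density x ≤ f (dySide l)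
  mass : ∫⁻ x, density x = M

/-- The set `A` carries densities that look like Lebesgue measure on the cubes of a given level
and satisfy, at finer levels, a Frostman bound with an arbitrarily small constant. -/
def Distributes [Fintype ι] (f : ℝ≥0 → ℝ≥0) (C : ℝ≥0) (A : Set (ι → ℝ)) : Prop :=
  ∀ ε : ℝ≥0, 0 < ε → ∀ L : ℕ, ∃ (L' : ℕ) (φ : (ι → ℝ) → ℝ≥0∞) (Z : Set (ι → ℝ)),
    Measurable φ ∧ DyConst L' φ ∧ (∃ B : ℝ≥0, ∀ x, φ x ≤ B) ∧ IsClosed Z ∧ Z ⊆ A ∧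
    (∀ x, φ x ≠ 0 → x ∈ Z) ∧
    (∀ κ : ι → ℤ, dyCube L κ ⊆ dyCube 0 0 → ∫⁻ x in dyCube L κ, φ x = volume (dyCube L κ)) ∧
    (∀ l, L ≤ l → ∀ κ : ι → ℤ,
      ∫⁻ x in dyCube l κ, φ x ≤ C * volume (dyCube l κ) + ε * f (dySide l))

/-- One step of the construction. Multiplying by a density of a fine level leaves the mass of the
coarser cubes unchanged; on finer cubes the Frostman bound survives because the previous density is
bounded and `f r / r ^ N` is large for small `r`. -/
theorem Stage.exists_next [Fintype ι] {f : ℝ≥0 → ℝ≥0} {a : ℕ}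
    (hf : IsGauge f (Fintype.card ι) a) {l0 : ℕ} {M : ℝ≥0∞} (s : Stage ι f l0 M) {C : ℝ≥0} {A : Set (ι → ℝ)} (hA : Distributes f C A) :
    ∃ (s' : Stage ι f l0 M) (Z : Set (ι → ℝ)), IsClosed Z ∧ Z ⊆ A ∧
      ∀ x, s'.density x ≠ 0 → s.density x ≠ 0 ∧ x ∈ Z := by
  obtain ⟨B, hB⟩ := s.bound
  obtain ⟨δ, hδ, hlarge⟩ := hf.large (2 * B * C)
  obtain ⟨L1, hL1⟩ := exists_dySide_lt hδ
  set L := max s.level (max L1 l0) with hL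
  have hε : 0 < (2 * (B + 1))⁻¹ := by positivity
  obtain ⟨L', φ, Z, hφm, hφc, ⟨B', hB'⟩, hZ, hZA, hφZ, hunit, hfrost⟩ :=
    hA (2 * (B + 1))⁻¹ hε L
  have hsL : DyConst L s.density := s.const.mono (le_max_left _ _)
  have hunit' : ∀ κ : ι → ℤ, (∀ x ∈ dyCube L κ, s.density x ≠ 0) →
      ∫⁻ x in dyCube L κ, φ x = volume (dyCube L κ) := fun κ h =>
    hunit κ fun x hx => s.supp x (h x hx)
  refine ⟨⟨fun x => s.density x * φ x, max L L', s.measurable.mul hφm, ?_, ⟨B * B', ?_⟩,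
    ?_, ?_, ?_⟩, Z, hZ, hZA, ?_⟩
  · intro x y hxy
    simp only
    rw [hsL.mono (le_max_left L L') x y hxy, hφc.mono (le_max_right L L') x y hxy]
  · intro x
    push_cast
    exact mul_le_mul' (hB x) (hB' x)
  · intro x hx
    exact s.supp x (left_ne_zero_of_mul hx)
  · intro l hl κ
    rcases le_total l L with h | h
    · obtain ⟨k, hk⟩ := Nat.exists_eq_add_of_le h
      have e : dyCube l κ = {x : ι → ℝ | dyIdx L x ∈ {κ' : ι → ℤ | ∀ p, κ' p / 2 ^ k = κ p}} := by
        ext x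
        simp only [mem_dyCube, mem_ofPred_eq, funext_iff, hk]
        exact forall_congr' fun p => by rw [dyIdx_add l k]
      rw [e, lintegral_mul_eq_of_dyConst hsL hφm hunit', ← e]
      exact s.frostman l hl κ
    · have h1 : ∫⁻ x in dyCube l κ, s.density x * φ x ≤ B * ∫⁻ x in dyCube l κ, φ x := by
        rw [← lintegral_const_mul _ hφm]
        exact lintegral_mono fun x => mul_le_mul' (hB x) le_rfl
      refine h1.trans ((mul_le_mul' le_rfl (hfrost l h κ)).trans ?_)
      rw [volume_dyCube]
      have hlt : dySide l < δ :=
        (dySide_anti (((le_max_left _ _).trans (le_max_right _ _)).trans h)).trans_lt hL1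
      have h2 := hlarge (dySide l) (dySide_pos l) hlt
      norm_cast
      have h3 : B * C * dySide l ^ Fintype.card ι ≤ f (dySide l) / 2 := by
        rw [le_div_iff₀ two_pos]; linarith
      have h4 : B * ((2 * (B + 1))⁻¹ * f (dySide l)) ≤ f (dySide l) / 2 := by
        have : B * (2 * (B + 1))⁻¹ ≤ 1 / 2 := by
          rw [← div_eq_mul_inv, div_le_div_iff₀ (by positivity) two_pos]
          linarith
        calc B * ((2 * (B + 1))⁻¹ * f (dySide l)) = B * (2 * (B + 1))⁻¹ * f (dySide l) := by ring
          _ ≤ 1 / 2 * f (dySide l) := by gcongr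
          _ = _ := by ring
      calc B * (C * dySide l ^ Fintype.card ι + (2 * (B + 1))⁻¹ * f (dySide l))
          = B * C * dySide l ^ Fintype.card ι + B * ((2 * (B + 1))⁻¹ * f (dySide l)) := by ring
        _ ≤ f (dySide l) / 2 + f (dySide l) / 2 := add_le_add h3 h4
        _ = f (dySide l) := add_halves _
  · have e : (univ : Set (ι → ℝ)) = {x | dyIdx L x ∈ (univ : Set (ι → ℤ))} := by simp
    refine Eq.trans ?_ s.mass
    rw [← setLIntegral_univ, ← setLIntegral_univ s.density, e,
      lintegral_mul_eq_of_dyConst hsL hφm hunit']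
  · intro x hx
    exact ⟨left_ne_zero_of_mul hx, hφZ x (right_ne_zero_of_mul hx)⟩

theorem exists_initial_stage [Fintype ι] {f : ℝ≥0 → ℝ≥0} {a : ℕ} (hf : IsGauge f (Fintype.card ι) a)
    (M : ℝ≥0) : ∃ l0, Nonempty (Stage ι f l0 M) := by
  obtain ⟨δ, hδ, hlarge⟩ := hf.large M
  obtain ⟨l0, hl0⟩ := exists_dySide_lt hδ
  refine ⟨l0, ⟨⟨(dyCube 0 (0 : ι → ℤ)).indicator fun _ => (M : ℝ≥0∞), 0,
    measurable_const.indicator (measurableSet_dyCube _ _), ?_, ⟨M, ?_⟩, ?_, ?_, ?_⟩⟩⟩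
  · intro x y hxy
    by_cases hx : x ∈ dyCube 0 (0 : ι → ℤ)
    · have hy : y ∈ dyCube 0 (0 : ι → ℤ) := hxy.symm.trans hx
      rw [indicator_of_mem hx, indicator_of_mem hy]
    · have hy : y ∉ dyCube 0 (0 : ι → ℤ) := fun hy => hx (hxy.trans hy)
      rw [indicator_of_notMem hx, indicator_of_notMem hy]
  · intro x
    exact indicator_le_self' (fun _ _ => zero_le) x
  · intro x hx
    by_contra h
    exact hx (indicator_of_notMem h _)
  · intro l hl κ
    calc ∫⁻ x in dyCube l κ, (dyCube 0 (0 : ι → ℤ)).indicator (fun _ => (M : ℝ≥0∞)) x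
        ≤ ∫⁻ _ in dyCube l κ, (M : ℝ≥0∞) :=
          lintegral_mono (indicator_le_self' fun _ _ => zero_le)
      _ = M * (dySide l : ℝ≥0∞) ^ Fintype.card ι := by rw [setLIntegral_const, volume_dyCube]
      _ ≤ f (dySide l) := by
          exact_mod_cast hlarge _ (dySide_pos l) ((dySide_anti hl).trans_lt hl0)
  · rw [lintegral_indicator (measurableSet_dyCube _ _), setLIntegral_const, volume_dyCube]
    simp [dySide]

theorem Stage.lintegral_ball_le [Fintype ι] {f : ℝ≥0 → ℝ≥0} (hf : Monotone f) {l0 : ℕ} {M : ℝ≥0∞}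
    (s : Stage ι f l0 M) (c : ι → ℝ) {ρ : ℝ≥0} (hρ : 0 < ρ) (hρl : ρ ≤ dySide l0) :
    ∫⁻ x in Metric.ball c ρ, s.density x ≤ (5 : ℝ≥0∞) ^ Fintype.card ι * f ρ := by
  have hρ1 : ρ ≤ 1 := hρl.trans (pow_le_one₀ zero_le (by norm_num))
  obtain ⟨k, hk1, hk2⟩ := exists_nat_pow_near_of_lt_one hρ hρ1 (by norm_num : (0 : ℝ≥0) < 1 / 2)
    (by norm_num)
  set l := k + 1 with hl
  have hlρ : dySide l < ρ := hk1
  have hl0 : l0 ≤ l := by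
    by_contra h
    exact absurd (hlρ.trans_le hρl) (not_lt.2 (dySide_anti (le_of_not_ge h)))
  have hρ2 : (ρ : ℝ) * 2 ^ l ≤ 2 := by
    have h1 : (ρ : ℝ) ≤ (1 / 2) ^ k := by exact_mod_cast hk2
    calc (ρ : ℝ) * 2 ^ l ≤ (1 / 2) ^ k * 2 ^ l := by gcongr
      _ = 2 := by rw [hl, pow_succ, ← mul_assoc, ← mul_pow]; norm_num
  classical
  set T : Finset (ι → ℤ) :=
    Fintype.piFinset fun p => Finset.Icc (dyIdx l c p - 2) (dyIdx l c p + 2) with hT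
  have hcard : T.card = 5 ^ Fintype.card ι := by
    rw [hT, Fintype.card_piFinset, ← Finset.card_univ, ← Finset.prod_const]
    refine Finset.prod_congr rfl fun p _ => ?_
    rw [Int.card_Icc]; omega
  have hcov : Metric.ball c (ρ : ℝ) ⊆ ⋃ κ ∈ T, dyCube l κ := by
    intro x hx
    simp only [mem_iUnion, exists_prop, mem_dyCube, exists_eq_right', hT, Fintype.mem_piFinset,
      Finset.mem_Icc]
    intro p
    have h1 : |x p - c p| < ρ := by
      rw [← Real.dist_eq]; exact (dist_le_pi_dist x c p).trans_lt hx
    have h2 : |x p * 2 ^ l - c p * 2 ^ l| < 2 := by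
      rw [← sub_mul, abs_mul, abs_of_pos (by positivity : (0 : ℝ) < 2 ^ l)]
      exact (mul_lt_mul_of_pos_right h1 (by positivity)).trans_le hρ2
    rw [abs_lt] at h2
    unfold dyIdx
    have a1 := Int.floor_le (x p * 2 ^ l)
    have a2 := Int.lt_floor_add_one (x p * 2 ^ l)
    have a3 := Int.floor_le (c p * 2 ^ l)
    have a4 := Int.lt_floor_add_one (c p * 2 ^ l)
    constructor
    · have : ((⌊c p * 2 ^ l⌋ : ℤ) : ℝ) < ⌊x p * 2 ^ l⌋ + 3 := by linarith
      have : ⌊c p * 2 ^ l⌋ < ⌊x p * 2 ^ l⌋ + 3 := by exact_mod_cast this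
      omega
    · have : ((⌊x p * 2 ^ l⌋ : ℤ) : ℝ) < ⌊c p * 2 ^ l⌋ + 3 := by linarith
      have : ⌊x p * 2 ^ l⌋ < ⌊c p * 2 ^ l⌋ + 3 := by exact_mod_cast this
      omega
  calc ∫⁻ x in Metric.ball c ρ, s.density x
      ≤ ∫⁻ x in ⋃ κ ∈ T, dyCube l κ, s.density x := lintegral_mono_set hcov
    _ ≤ ∑ κ ∈ T, ∫⁻ x in dyCube l κ, s.density x := by
        rw [lintegral_biUnion_finset (fun κ _ κ' _ h => disjoint_dyCube h)
          fun κ _ => measurableSet_dyCube l κ]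
    _ ≤ ∑ _κ ∈ T, (f ρ : ℝ≥0∞) := Finset.sum_le_sum fun κ _ =>
        (s.frostman l hl0 κ).trans (by exact_mod_cast hf hlρ.le)
    _ = (5 : ℝ≥0∞) ^ Fintype.card ι * f ρ := by
        rw [Finset.sum_const, hcard, nsmul_eq_mul]; push_cast; rfl

/-- Mass distribution: sets that all carry Lebesgue-like densities with small Frostman constants
intersect, within the unit cube, in a set that cannot be covered economically by small balls. -/
theorem exists_scale_forall_cover [Fintype ι] {f : ℝ≥0 → ℝ≥0} {a : ℕ}
    (hf : IsGauge f (Fintype.card ι) a) {C : ℝ≥0} {A : ℕ → Set (ι → ℝ)} (hA : ∀ k, Distributes f C (A k)) (M : ℝ≥0) :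
    ∃ η : ℝ≥0, 0 < η ∧ ∀ (c : ℕ → ι → ℝ) (ρ : ℕ → ℝ≥0), (∀ i, 0 < ρ i) → (∀ i, ρ i ≤ η) →
      (Icc 0 1 ∩ ⋂ k, A k) ⊆ ⋃ i, Metric.ball (c i) (ρ i) →
      (M : ℝ≥0∞) ≤ 5 ^ Fintype.card ι * ∑' i, (f (ρ i) : ℝ≥0∞) := by
  obtain ⟨l0, ⟨s0⟩⟩ := exists_initial_stage hf M
  choose next Z hZc hZA hZ using fun (k : ℕ) (s : Stage ι f l0 M) => s.exists_next hf (hA k)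
  let s : ℕ → Stage ι f l0 M := fun k => Nat.rec s0 (fun k s => next k s) k
  have hs : ∀ k, s (k + 1) = next k (s k) := fun k => rfl
  set Kc : ℕ → Set (ι → ℝ) := fun k => Icc 0 1 ∩ ⋂ i < k, Z i (s i) with hKc
  have hsupp : ∀ k x, (s k).density x ≠ 0 → x ∈ Kc k := by
    intro k
    induction k with
    | zero =>
      intro x hx
      refine ⟨?_, by simp⟩
      have h := (s 0).supp x hx
      rw [dyCube_eq_pi] at h
      constructor
      · intro p; have := (h p (mem_univ p)).1; simpa using this
      · intro p; have := (h p (mem_univ p)).2.le; simpa using this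
    | succ k ih =>
      intro x hx
      rw [hs] at hx
      obtain ⟨h1, h2⟩ := hZ k (s k) x hx
      refine ⟨(ih x h1).1, mem_iInter₂.2 fun i hi => ?_⟩
      rcases Nat.lt_succ_iff_lt_or_eq.1 hi with h | rfl
      · exact mem_iInter₂.1 (ih x h1).2 i h
      · exact h2
  have hKcomp : ∀ k, IsCompact (Kc k) := fun k =>
    isCompact_Icc.inter_right (isClosed_biInter fun i _ => hZc i (s i))
  have hKanti : Antitone Kc := fun k k' h =>
    inter_subset_inter_right _ (biInter_subset_biInter_left fun i hi => lt_of_lt_of_le hi h)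
  refine ⟨dySide l0, dySide_pos l0, fun c ρ hρ0 hρ hcov => ?_⟩
  have hsub : (⋂ k, Kc k) ⊆ ⋃ i, Metric.ball (c i) (ρ i : ℝ) := by
    intro x hx
    refine hcov ⟨(mem_iInter.1 hx 0).1, mem_iInter.2 fun k => hZA k (s k) ?_⟩
    exact mem_iInter₂.1 (mem_iInter.1 hx (k + 1)).2 k (Nat.lt_succ_self k)
  -- by compactness the cover already covers the support of one of the densities
  obtain ⟨k, hk⟩ := exists_subset_nhds_of_isCompact hKanti.directed_ge hKcomp
    (U := ⋃ i, Metric.ball (c i) (ρ i : ℝ))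
    fun x hx => (isOpen_iUnion fun i => Metric.isOpen_ball).mem_nhds (hsub hx)
  calc (M : ℝ≥0∞) = ∫⁻ x, (s k).density x := (s k).mass.symm
    _ ≤ ∫⁻ x in ⋃ i, Metric.ball (c i) (ρ i : ℝ), (s k).density x := by
        rw [← lintegral_indicator (MeasurableSet.iUnion fun i => measurableSet_ball)]
        refine lintegral_mono fun x => ?_
        by_cases hx : (s k).density x = 0
        · rw [hx]; exact zero_le
        · rw [indicator_of_mem (hk (hsupp k x hx))]
    _ ≤ ∑' i, ∫⁻ x in Metric.ball (c i) (ρ i : ℝ), (s k).density x := lintegral_iUnion_le _ _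
    _ ≤ ∑' i, (5 : ℝ≥0∞) ^ Fintype.card ι * f (ρ i) := ENNReal.tsum_le_tsum fun i =>
        (s k).lintegral_ball_le hf.dim.monotone (c i) (hρ0 i) (hρ i)
    _ = _ := ENNReal.tsum_mul_left

end Dyadic

end WeightedApprox

namespace WeightedApprox

open MeasureTheory Set

/-! ### Volumes of neighbourhoods of hyperplanes inside small boxes -/

/-- The matrices `x` such that each `q x_j` lies at distance less than `δ j` from an integer. -/
def slab {n m : ℕ} (q : Fin n → ℤ) (δ : Fin m → ℝ) : Set (Fin n × Fin m → ℝ) :=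
  {x | ∀ j, ∃ p : ℤ, |∑ i, (q i : ℝ) * x (i, j) - p| < δ j}

theorem isOpen_slab {n m : ℕ} (q : Fin n → ℤ) (δ : Fin m → ℝ) : IsOpen (slab q δ) := by
  have : slab q δ = ⋂ j, ⋃ p : ℤ, {x | |∑ i, (q i : ℝ) * x (i, j) - p| < δ j} := by
    ext x; simp [slab]
  rw [this]
  refine isOpen_iInter_of_finite fun j => isOpen_iUnion fun p => ?_
  exact isOpen_lt (by fun_prop) continuous_const

/-- The map that replaces the `i0`-th row of `x` by `q x / q i0`. -/
noncomputable def shear {n : ℕ} (m : ℕ) (q : Fin n → ℤ) (i0 : Fin n) :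
    (Fin n × Fin m → ℝ) →ₗ[ℝ] (Fin n × Fin m → ℝ) :=
  Matrix.toLin' (Matrix.kroneckerMap (fun a b => a * b)
    ((1 : Matrix (Fin n) (Fin n) ℝ).updateRow i0 fun i => (q i : ℝ) / q i0)
    (1 : Matrix (Fin m) (Fin m) ℝ))

theorem shear_apply {n m : ℕ} (q : Fin n → ℤ) (i0 : Fin n) (x : Fin n × Fin m → ℝ)
    (i : Fin n) (j : Fin m) : shear m q i0 x (i, j) =
      if i = i0 then (∑ i', (q i' : ℝ) * x (i', j)) / q i0 else x (i, j) := by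
  rw [shear, Matrix.toLin'_apply, Matrix.mulVec, dotProduct, Fintype.sum_prod_type]
  simp only [Matrix.kroneckerMap_apply, Matrix.one_apply, mul_ite, mul_one, mul_zero, ite_mul,
    zero_mul, Finset.sum_ite_eq, Finset.mem_univ, if_true]
  split_ifs with h
  · subst h
    rw [Finset.sum_div]
    refine Finset.sum_congr rfl fun i' _ => ?_
    rw [Matrix.updateRow_self]; ring
  · rw [Matrix.updateRow_ne h]
    simp [Matrix.one_apply]

/-- The shear preserves volume, as its matrix is the identity except for one row, which has the
diagonal entry `1`. -/
theorem volume_shear_preimage {n m : ℕ} {q : Fin n → ℤ} {i0 : Fin n} (hq : q i0 ≠ 0)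
    (T : Set (Fin n × Fin m → ℝ)) : volume (shear m q i0 ⁻¹' T) = volume T := by
  have hq' : (q i0 : ℝ) ≠ 0 := by exact_mod_cast hq
  have hdet : LinearMap.det (shear m q i0) = 1 := by
    rw [shear, LinearMap.det_toLin', Matrix.det_kronecker, ← Matrix.cramer_transpose_apply]
    simp [hq']
  rw [Measure.addHaar_preimage_linearMap _ (by rw [hdet]; exact one_ne_zero), hdet]
  simp

theorem prod_ite_row {n : ℕ} {M : Type*} [CommMonoid M] (i0 : Fin n) (a b : M) :
    (∏ i, if i = i0 then a else b) = a * b ^ (n - 1) := by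
  rw [Fintype.prod_eq_mul_prod_compl i0, if_pos rfl]
  congr 1
  rw [Finset.prod_congr rfl (g := fun _ => b)]
  · rw [Finset.prod_const, Finset.card_compl]; simp
  · intro i hi
    rw [if_neg (by simpa using hi)]

theorem volume_pi_rows {n m : ℕ} (i0 : Fin n) (A : Fin m → Set ℝ) (B : Fin n × Fin m → Set ℝ)
    {b : ℝ≥0∞} (hB : ∀ p, volume (B p) = b) :
    volume (univ.pi fun p : Fin n × Fin m => if p.1 = i0 then A p.2 else B p) =
      ∏ j, (volume (A j) * b ^ (n - 1)) := by
  rw [volume_pi_pi, Fintype.prod_prod_type_right]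
  refine Finset.prod_congr rfl fun j _ => ?_
  rw [← prod_ite_row i0]
  refine Finset.prod_congr rfl fun i _ => ?_
  simp only
  split_ifs with h
  · rfl
  · exact hB _

theorem sum_mul_sub_le {n m : ℕ} {q : Fin n → ℤ} {i0 : Fin n} (hmax : ∀ i, |q i| ≤ |q i0|)
    {x y : Fin n × Fin m → ℝ} {j : Fin m} {s : ℝ} (h : ∀ i, |x (i, j) - y (i, j)| ≤ s) :
    |∑ i, (q i : ℝ) * x (i, j) - ∑ i, (q i : ℝ) * y (i, j)| ≤ n * (|(q i0 : ℝ)| * s) := by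
  rw [← Finset.sum_sub_distrib]
  refine (Finset.abs_sum_le_sum_abs _ _).trans ?_
  calc ∑ i, |(q i : ℝ) * x (i, j) - q i * y (i, j)| ≤ ∑ _i : Fin n, |(q i0 : ℝ)| * s := by
        refine Finset.sum_le_sum fun i _ => ?_
        rw [← mul_sub, abs_mul]
        exact mul_le_mul (by exact_mod_cast hmax i) (h i) (abs_nonneg _) (abs_nonneg _)
    _ = _ := by simp

/-- The shear turns the intersection into a product. In the direction of the `j`-th column it is
contained both in an interval of length `2 n s` and in the union of the intervals around those
fractions with denominator `q i0` that are close to the centre. -/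
theorem volume_slab_inter_closedBall_le {n m : ℕ} {q : Fin n → ℤ} {i0 : Fin n} (hq : q i0 ≠ 0)
    (hmax : ∀ i, |q i| ≤ |q i0|) (δ : Fin m → ℝ) (hδ : ∀ j, 0 ≤ δ j)
    (a : Fin n × Fin m → ℝ) {s : ℝ} (hs : 0 ≤ s) :
    volume (slab q δ ∩ Metric.closedBall a s) ≤ ENNReal.ofReal (∏ j,
      (min (2 * n * s) ((2 * (n * (|(q i0 : ℝ)| * s) + δ j) + 1) * (2 * (δ j / |(q i0 : ℝ)|))) *
        (2 * s) ^ (n - 1))) := by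
  have hq' : (q i0 : ℝ) ≠ 0 := by exact_mod_cast hq
  set Q : ℝ := |(q i0 : ℝ)| with hQ
  have hQ0 : 0 < Q := abs_pos.2 hq'
  set w : Fin m → ℝ := fun j => (∑ i, (q i : ℝ) * a (i, j)) with hw
  set P : Fin m → Finset ℤ := fun j => Finset.Icc ⌈w j - (n * (Q * s) + δ j)⌉
    ⌊w j + (n * (Q * s) + δ j)⌋ with hP
  set A : Fin m → Set ℝ := fun j => Icc (w j / q i0 - n * s) (w j / q i0 + n * s) ∩
    ⋃ p ∈ P j, Icc ((p : ℝ) / q i0 - δ j / Q) (p / q i0 + δ j / Q) with hA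
  set B : Fin n × Fin m → Set ℝ := fun p => Icc (a p - s) (a p + s) with hB
  have hsub : slab q δ ∩ Metric.closedBall a s ⊆ shear m q i0 ⁻¹'
      (univ.pi fun p : Fin n × Fin m => if p.1 = i0 then A p.2 else B p) := by
    rintro x ⟨hx, hxa⟩
    have hxa' : ∀ p, |x p - a p| ≤ s := fun p => by
      rw [← Real.dist_eq]; exact (dist_le_pi_dist x a p).trans hxa
    rintro ⟨i, j⟩ -
    rw [shear_apply]
    dsimp only
    split_ifs with h
    · obtain ⟨p, hp⟩ := hx j
      have h1 := sum_mul_sub_le hmax (j := j) fun i => hxa' (i, j)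
      rw [← hQ] at h1
      set y := ∑ i', (q i' : ℝ) * x (i', j) with hy
      have hdiv : ∀ u v r : ℝ, |u - v| ≤ r → |u / q i0 - v / q i0| ≤ r / Q := by
        intro u v r h
        rw [← sub_div, abs_div]
        gcongr
      refine ⟨?_, mem_iUnion₂.2 ⟨p, ?_, ?_⟩⟩
      · have h2 := hdiv _ _ _ h1
        rw [show n * (Q * s) / Q = n * s by field_simp, abs_le] at h2
        exact ⟨by linarith [h2.1], by linarith [h2.2]⟩
      · rw [hP, Finset.mem_Icc, Int.ceil_le, Int.le_floor]
        rw [abs_lt] at hp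
        rw [abs_le] at h1
        constructor <;> linarith [h1.1, h1.2, hp.1, hp.2]
      · have h2 := hdiv _ _ _ hp.le
        rw [abs_le] at h2
        exact ⟨by linarith [h2.1], by linarith [h2.2]⟩
    · have h1 := hxa' (i, j)
      rw [abs_le] at h1
      exact ⟨by linarith [h1.1], by linarith [h1.2]⟩
  have hBv : ∀ p, volume (B p) = ENNReal.ofReal (2 * s) := by
    intro p
    rw [hB, Real.volume_Icc]; congr 1; ring
  have hAv : ∀ j, volume (A j) ≤ ENNReal.ofReal
      (min (2 * n * s) ((2 * (n * (Q * s) + δ j) + 1) * (2 * (δ j / Q)))) := by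
    intro j
    rw [ENNReal.ofReal_min]
    refine le_min ?_ ?_
    · refine (measure_mono inter_subset_left).trans ?_
      rw [Real.volume_Icc]; apply le_of_eq; congr 1; ring
    · refine (measure_mono inter_subset_right).trans ((measure_biUnion_finset_le _ _).trans ?_)
      simp_rw [Real.volume_Icc]
      have e : ∀ p : ℤ, (p : ℝ) / q i0 + δ j / Q - (p / q i0 - δ j / Q) = 2 * (δ j / Q) :=
        fun p => by ring
      simp_rw [e]
      have hr0 : 0 ≤ n * (Q * s) + δ j := by have := hδ j; positivity
      have hcard : ((P j).card : ℝ) ≤ 2 * (n * (Q * s) + δ j) + 1 := by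
        rw [hP, Int.card_Icc]
        have a1 := Int.floor_le (w j + (n * (Q * s) + δ j))
        have a2 := Int.le_ceil (w j - (n * (Q * s) + δ j))
        have h3 : ((max (⌊w j + (n * (Q * s) + δ j)⌋ + 1 - ⌈w j - (n * (Q * s) + δ j)⌉) 0 : ℤ) : ℝ)
            ≤ 2 * (n * (Q * s) + δ j) + 1 := by
          push_cast
          refine max_le ?_ (by linarith)
          linarith
        have h4 : (((⌊w j + (n * (Q * s) + δ j)⌋ + 1 - ⌈w j - (n * (Q * s) + δ j)⌉).toNat : ℤ) : ℝ)
            ≤ 2 * (n * (Q * s) + δ j) + 1 := by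
          rw [Int.toNat_eq_max]; exact h3
        exact_mod_cast h4
      rw [Finset.sum_const, nsmul_eq_mul, ← ENNReal.ofReal_natCast,
        ← ENNReal.ofReal_mul (Nat.cast_nonneg _)]
      apply ENNReal.ofReal_le_ofReal
      have := hδ j
      gcongr
  calc volume (slab q δ ∩ Metric.closedBall a s)
      ≤ ∏ j, (volume (A j) * ENNReal.ofReal (2 * s) ^ (n - 1)) := by
        refine (measure_mono hsub).trans ?_
        rw [volume_shear_preimage hq, volume_pi_rows i0 A B hBv]
    _ ≤ ∏ j, ENNReal.ofReal (min (2 * n * s)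
          ((2 * (n * (Q * s) + δ j) + 1) * (2 * (δ j / Q))) * (2 * s) ^ (n - 1)) := by
        refine Finset.prod_le_prod' fun j _ => ?_
        have h0 : 0 ≤ min (2 * n * s) ((2 * (n * (Q * s) + δ j) + 1) * (2 * (δ j / Q))) := by
          have := hδ j; positivity
        rw [ENNReal.ofReal_mul h0, ENNReal.ofReal_pow (by positivity)]
        exact mul_le_mul' (hAv j) le_rfl
    _ = _ := by
        rw [ENNReal.ofReal_prod_of_nonneg]
        intro j _
        have := hδ j; positivity

/-- The interval of radius `r` around `v` contains an interval of length at least `min r ρ / 2` that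
stays within `3 ρ / 2` of `w`, when `w` is at distance at most `max r ρ` from `v`. -/
theorem exists_Ioo_near {v w r ρ : ℝ} (hr : 0 < r) (hρ : 0 < ρ) (h : |w - v| ≤ max r ρ) :
    ∃ α β : ℝ, min r ρ / 2 ≤ β - α ∧ ∀ y ∈ Ioo α β, |y - v| < r ∧ |y - w| ≤ 3 * ρ / 2 := by
  rcases le_total r ρ with hrρ | hrρ
  · rw [max_eq_right hrρ, abs_le] at h
    rw [min_eq_left hrρ]
    refine ⟨v - r / 2, v + r / 2, by linarith, fun y hy => ?_⟩
    rw [abs_lt, abs_le]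
    exact ⟨⟨by linarith [hy.1], by linarith [hy.2]⟩, by linarith [hy.1], by linarith [hy.2]⟩
  · rw [max_eq_left hrρ, abs_le] at h
    rw [min_eq_right hrρ]
    rcases le_total v w with hvw | hvw
    · refine ⟨w - ρ / 2, w, by linarith, fun y hy => ?_⟩
      rw [abs_lt, abs_le]
      exact ⟨⟨by linarith [hy.1], by linarith [hy.2]⟩, by linarith [hy.1], by linarith [hy.2]⟩
    · refine ⟨w, w + ρ / 2, by linarith, fun y hy => ?_⟩
      rw [abs_lt, abs_le]
      exact ⟨⟨by linarith [hy.1], by linarith [hy.2]⟩, by linarith [hy.1], by linarith [hy.2]⟩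

/-- Near a point of the neighbourhood of radii `max (r j) ρ`, the neighbourhood of radii `r j`
takes up a proportionate part of a ball of radius `2 ρ`. -/
theorem le_volume_slab_inter_closedBall {n m : ℕ} {q : Fin n → ℤ} {i0 : Fin n} (hq : q i0 ≠ 0)
    (hmax : ∀ i, |q i| ≤ |q i0|) {r : Fin m → ℝ} (hr : ∀ j, 0 < r j) {ρ : ℝ} (hρ : 0 < ρ)
    {x : Fin n × Fin m → ℝ}
    (hx : ∀ j, ∃ p : ℤ, |∑ i, (q i : ℝ) * x (i, j) - p| ≤ |(q i0 : ℝ)| * max (r j) ρ) :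
    ENNReal.ofReal (∏ j, (min (r j) ρ / 2 * (ρ / n) ^ (n - 1))) ≤
      volume (slab q (fun j => |(q i0 : ℝ)| * r j) ∩ Metric.closedBall x (2 * ρ)) := by
  have hq' : (q i0 : ℝ) ≠ 0 := by exact_mod_cast hq
  set Q : ℝ := |(q i0 : ℝ)| with hQ
  have hQ0 : 0 < Q := abs_pos.2 hq'
  have hn : 0 < n := Fin.pos i0
  have hnR : (0 : ℝ) < n := by exact_mod_cast hn
  choose p hp using hx
  have hdiv : ∀ j, |(∑ i, (q i : ℝ) * x (i, j)) / q i0 - (p j : ℝ) / q i0| ≤ max (r j) ρ := by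
    intro j
    rw [← sub_div, abs_div, ← hQ, div_le_iff₀ hQ0, mul_comm]
    exact hp j
  choose α β hlen hI using fun j => exists_Ioo_near (hr j) hρ (hdiv j)
  set A : Fin m → Set ℝ := fun j => Ioo (α j) (β j) with hA
  set B : Fin n × Fin m → Set ℝ := fun p => Icc (x p - ρ / (2 * n)) (x p + ρ / (2 * n)) with hB
  have hsub : shear m q i0 ⁻¹'
      (univ.pi fun p : Fin n × Fin m => if p.1 = i0 then A p.2 else B p) ⊆
      slab q (fun j => Q * r j) ∩ Metric.closedBall x (2 * ρ) := by
    intro z hz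
    have hz1 : ∀ j, (∑ i, (q i : ℝ) * z (i, j)) / q i0 ∈ Ioo (α j) (β j) := by
      intro j
      have := hz (i0, j) (mem_univ _)
      rw [shear_apply] at this
      dsimp only at this
      rwa [if_pos rfl, if_pos rfl] at this
    have hz2 : ∀ i j, i ≠ i0 → |z (i, j) - x (i, j)| ≤ ρ / (2 * n) := by
      intro i j hi
      have := hz (i, j) (mem_univ _)
      rw [shear_apply] at this
      dsimp only at this
      rw [if_neg hi, if_neg hi] at this
      rw [abs_le]
      exact ⟨by linarith [this.1], by linarith [this.2]⟩
    refine ⟨fun j => ⟨p j, ?_⟩, ?_⟩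
    · have h := (hI j _ (hz1 j)).1
      rw [← sub_div, abs_div, ← hQ, div_lt_iff₀ hQ0] at h
      linarith
    · rw [Metric.mem_closedBall, dist_pi_le_iff (by positivity)]
      rintro ⟨i, j⟩
      rw [Real.dist_eq]
      by_cases hi : i = i0
      · subst hi
        have h := (hI j _ (hz1 j)).2
        rw [← sub_div, ← Finset.sum_sub_distrib, ← Finset.add_sum_erase _ _ (Finset.mem_univ i),
          ← mul_sub, add_div, mul_div_cancel_left₀ _ hq'] at h
        have h2 : |(∑ k ∈ Finset.univ.erase i, ((q k : ℝ) * z (k, j) - q k * x (k, j))) / q i|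
            ≤ ρ / 2 := by
          rw [abs_div, ← hQ, div_le_iff₀ hQ0]
          refine (Finset.abs_sum_le_sum_abs _ _).trans ?_
          calc ∑ k ∈ Finset.univ.erase i, |(q k : ℝ) * z (k, j) - q k * x (k, j)|
              ≤ ∑ _k ∈ Finset.univ.erase i, Q * (ρ / (2 * n)) := by
                refine Finset.sum_le_sum fun k hk => ?_
                rw [← mul_sub, abs_mul]
                exact mul_le_mul (by rw [hQ]; exact_mod_cast hmax k)
                  (hz2 k j (Finset.ne_of_mem_erase hk)) (abs_nonneg _) hQ0.le
            _ ≤ ∑ _k : Fin n, Q * (ρ / (2 * n)) :=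
                Finset.sum_le_sum_of_subset_of_nonneg (Finset.erase_subset _ _)
                  fun _ _ _ => by positivity
            _ = ρ / 2 * Q := by
                rw [Finset.sum_const, Finset.card_univ, Fintype.card_fin, nsmul_eq_mul]
                field_simp
        rw [abs_le] at h h2 ⊢
        exact ⟨by linarith [h.1, h2.2], by linarith [h.2, h2.1]⟩
      · refine (hz2 i j hi).trans ?_
        rw [div_le_iff₀ (by positivity)]
        have : (1 : ℝ) ≤ n := by exact_mod_cast hn
        nlinarith
  refine le_trans ?_ (measure_mono hsub)
  have hBv : ∀ p, volume (B p) = ENNReal.ofReal (ρ / n) := by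
    intro p
    rw [hB, Real.volume_Icc]; congr 1; field_simp; ring
  rw [volume_shear_preimage hq, volume_pi_rows i0 A B hBv, ENNReal.ofReal_prod_of_nonneg]
  · refine Finset.prod_le_prod' fun j _ => ?_
    have := hr j
    rw [ENNReal.ofReal_mul (by positivity), ENNReal.ofReal_pow (by positivity)]
    refine mul_le_mul' ?_ le_rfl
    rw [hA, Real.volume_Ioo]
    exact ENNReal.ofReal_le_ofReal (hlen j)
  · intro j _
    have := hr j
    positivity

theorem exists_max_coord {n : ℕ} {q : Fin n → ℤ} (hq : q ≠ 0) :
    ∃ i0, q i0 ≠ 0 ∧ (∀ i, |q i| ≤ |q i0|) ∧ ((‖q‖₊ : ℝ≥0) : ℝ) = |(q i0 : ℝ)| := by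
  obtain ⟨i, hi⟩ := Function.ne_iff.1 hq
  have : Nonempty (Fin n) := ⟨i⟩
  obtain ⟨i0, hi0⟩ := Finite.exists_max fun i => |q i|
  refine ⟨i0, ?_, hi0, ?_⟩
  · intro h
    have := hi0 i
    rw [h] at this
    simp at this
    exact hi this
  · rw [coe_nnnorm]
    refine le_antisymm ?_ ?_
    · rw [pi_norm_le_iff_of_nonneg (abs_nonneg _)]
      intro i
      rw [Int.norm_eq_abs]
      exact_mod_cast hi0 i
    · have := norm_le_pi_norm q i0
      rwa [Int.norm_eq_abs] at this

end WeightedApprox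

namespace WeightedApprox

open MeasureTheory Set

/-! ### Distributing mass over disjoint dyadic cubes -/

section Packing

variable {ι : Type*}

theorem measurable_dyIdx (l : ℕ) : Measurable (dyIdx (ι := ι) l) :=
  measurable_pi_lambda _ fun p => ((measurable_pi_apply p).mul_const _).floor

theorem DyConst.measurable [Finite ι] {β : Type*} [MeasurableSpace β] {L : ℕ}
    {h : (ι → ℝ) → β} (hh : DyConst L h) : Measurable h := by
  have e : h = (fun κ : ι → ℤ => h (dyCube_nonempty L κ).some) ∘ dyIdx L := by
    ext x
    exact hh _ _ (dyCube_nonempty L (dyIdx L x)).some_mem.symm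
  rw [e]
  exact (Measurable.of_discrete).comp (measurable_dyIdx L)

/-- The part of `A` that is made up of whole dyadic cubes of level `L`. -/
def dyInner (L : ℕ) (A : Set (ι → ℝ)) : Set (ι → ℝ) := {x | dyCube L (dyIdx L x) ⊆ A}

theorem dyInner_subset (L : ℕ) (A : Set (ι → ℝ)) : dyInner L A ⊆ A := fun _ hx => hx rfl

theorem dyInner_mono {L L' : ℕ} (h : L ≤ L') (A : Set (ι → ℝ)) : dyInner L A ⊆ dyInner L' A :=
  fun x hx => (dyCube_subset_of_le (x := x) h rfl rfl).trans hx

theorem dyConst_indicator_dyInner {β : Type*} [Zero β] (L : ℕ) (A : Set (ι → ℝ)) (b : β) :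
    DyConst L ((dyInner L A).indicator fun _ => b) := by
  intro x y hxy
  have : x ∈ dyInner L A ↔ y ∈ dyInner L A := by
    simp only [dyInner, mem_ofPred_eq, hxy]
  by_cases hx : x ∈ dyInner L A
  · rw [indicator_of_mem hx, indicator_of_mem (this.1 hx)]
  · rw [indicator_of_notMem hx, indicator_of_notMem fun h => hx (this.2 h)]

theorem measurableSet_dyInner [Finite ι] (L : ℕ) (A : Set (ι → ℝ)) :
    MeasurableSet (dyInner L A) := by
  have : dyInner L A = dyIdx L ⁻¹' {κ | dyCube L κ ⊆ A} := rfl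
  rw [this]
  exact measurable_dyIdx L (MeasurableSet.of_discrete)

/-- Half of the volume of the intersection of an open set with a dyadic cube is carried by the
dyadic cubes of a sufficiently fine level. -/
theorem exists_level_le_volume_dyInner [Fintype ι] {l : ℕ} {κ : ι → ℤ} {U : Set (ι → ℝ)}
    (hU : IsOpen U) (hpos : 0 < volume (dyCube l κ ∩ U)) :
    ∃ L0, ∀ L ≥ L0, volume (dyCube l κ ∩ U) ≤ 2 * volume (dyInner L (dyCube l κ ∩ U)) := by
  set A := dyCube l κ ∩ U with hA
  have hfin : volume A ≠ ∞ := by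
    refine ((measure_mono inter_subset_left).trans_lt ?_).ne
    rw [volume_dyCube]
    exact ENNReal.pow_lt_top ENNReal.coe_lt_top
  have hun : ⋃ L, dyInner L A = A := by
    refine subset_antisymm (iUnion_subset fun L => dyInner_subset L A) fun x hx => ?_
    obtain ⟨δ, hδ, hball⟩ := Metric.isOpen_iff.1 hU x hx.2
    obtain ⟨L1, hL1⟩ := exists_dySide_lt (δ := ⟨δ, hδ.le⟩) hδ
    refine mem_iUnion.2 ⟨max l L1, fun y hy => ⟨?_, hball ?_⟩⟩
    · exact (dyIdx_eq_of_le (le_max_left l L1) hy).trans hx.1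
    · rw [Metric.mem_ball]
      refine (dist_le_of_mem_dyCube (l := max l L1) hy rfl).trans_lt ?_
      exact (NNReal.coe_le_coe.2 (dySide_anti (le_max_right l L1))).trans_lt hL1
  have hlim := tendsto_measure_iUnion_atTop (μ := volume) (s := fun L => dyInner L A)
    fun L L' h => dyInner_mono h A
  rw [hun] at hlim
  have hev := hlim.eventually (lt_mem_nhds (ENNReal.half_lt_self hpos.ne' hfin))
  obtain ⟨L0, hL0⟩ := Filter.eventually_atTop.1 hev
  refine ⟨L0, fun L hL => ?_⟩
  have := (hL0 L hL).le
  rw [ENNReal.div_le_iff_le_mul (by simp) (by simp)] at this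
  rwa [mul_comm] at this

/-- Given disjoint dyadic cubes filling a fixed proportion of every cube of level `L`, and an open
set inside each of them on which normalised Lebesgue measure obeys a Frostman bound, there is a step
density supported on these open sets that has the mass of Lebesgue measure on each cube of level
`L`, is comparable with it down to the scale of the small cubes, and obeys the Frostman bound
below. -/
theorem exists_step_density [Fintype ι] {L : ℕ} {S : Finset (ℕ × (ι → ℤ))} {C : ℝ≥0}
    {U : ℕ × (ι → ℤ) → Set (ι → ℝ)} {g : ℕ → ℝ≥0∞}
    (hlev : ∀ b ∈ S, L ≤ b.1)
    (hdis : ∀ b ∈ S, ∀ b' ∈ S, b ≠ b' → Disjoint (dyCube b.1 b.2) (dyCube b'.1 b'.2))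
    (hU : ∀ b ∈ S, IsOpen (U b)) (hpos : ∀ b ∈ S, 0 < volume (dyCube b.1 b.2 ∩ U b))
    (hmass : ∀ κ : ι → ℤ, dyCube L κ ⊆ dyCube 0 0 → ∃ T ⊆ S,
      (∀ b ∈ T, dyCube b.1 b.2 ⊆ dyCube L κ) ∧
      volume (dyCube L κ) ≤ C * ∑ b ∈ T, volume (dyCube b.1 b.2))
    (hfro : ∀ b ∈ S, ∀ l, b.1 ≤ l → ∀ κ : ι → ℤ, dyCube l κ ⊆ dyCube b.1 b.2 →
      volume (dyCube b.1 b.2) * volume (dyCube l κ ∩ U b) ≤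
        g l * volume (dyCube b.1 b.2 ∩ U b)) :
    ∃ (L' : ℕ) (φ : (ι → ℝ) → ℝ≥0∞), DyConst L' φ ∧ (∃ B : ℝ≥0, ∀ x, φ x ≤ B) ∧
      (∀ x, φ x ≠ 0 → ∃ b ∈ S, x ∈ U b) ∧
      (∀ κ : ι → ℤ, dyCube L κ ⊆ dyCube 0 0 →
        ∫⁻ x in dyCube L κ, φ x = volume (dyCube L κ)) ∧
      (∀ l, L ≤ l → ∀ κ : ι → ℤ,
        ∫⁻ x in dyCube l κ, φ x ≤ C * (volume (dyCube l κ) + 2 * g l)) := by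
  classical
  have hvol_ne_top : ∀ (l : ℕ) (κ : ι → ℤ), volume (dyCube l κ) ≠ ∞ := fun l κ => by
    rw [volume_dyCube]; exact (ENNReal.pow_lt_top ENNReal.coe_lt_top).ne
  have hvol_ne_zero : ∀ (l : ℕ) (κ : ι → ℤ), volume (dyCube l κ) ≠ 0 := fun l κ => by
    rw [volume_dyCube]
    exact pow_ne_zero _ (by simpa using (dySide_pos l).ne')
  choose! L0 hL0 using fun b (hb : b ∈ S) => exists_level_le_volume_dyInner (hU b hb) (hpos b hb)
  set L' := max L (S.sup L0) with hL'
  set R : ℕ × (ι → ℤ) → Set (ι → ℝ) := fun b => dyInner L' (dyCube b.1 b.2 ∩ U b) with hR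
  have hRm : ∀ b, MeasurableSet (R b) := fun b => measurableSet_dyInner _ _
  have hRb : ∀ b, R b ⊆ dyCube b.1 b.2 := fun b => (dyInner_subset _ _).trans inter_subset_left
  have hRU : ∀ b, R b ⊆ U b := fun b => (dyInner_subset _ _).trans inter_subset_right
  have hRhalf : ∀ b ∈ S, volume (dyCube b.1 b.2 ∩ U b) ≤ 2 * volume (R b) := fun b hb =>
    hL0 b hb L' ((Finset.le_sup hb).trans (le_max_right _ _))
  have hRpos : ∀ b ∈ S, volume (R b) ≠ 0 := fun b hb h => by
    have := hRhalf b hb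
    rw [h, mul_zero] at this
    exact absurd (hpos b hb) (not_lt.2 this)
  have hRtop : ∀ b, volume (R b) ≠ ∞ := fun b =>
    ((measure_mono (hRb b)).trans_lt (lt_top_iff_ne_top.2 (hvol_ne_top _ _))).ne
  -- the total mass of the small cubes in a cube of level `L`, and the normalising factor
  set mass : (ι → ℤ) → ℝ≥0∞ := fun κ =>
    ∑ b ∈ S with dyCube b.1 b.2 ⊆ dyCube L κ, volume (dyCube b.1 b.2) with hmassdef
  set w : (ι → ℤ) → ℝ≥0∞ := fun κ =>
    if dyCube L κ ⊆ dyCube 0 0 then volume (dyCube L κ) / mass κ else 0 with hw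
  have hmass' : ∀ κ : ι → ℤ, dyCube L κ ⊆ dyCube 0 0 → volume (dyCube L κ) ≤ C * mass κ := by
    intro κ hκ
    obtain ⟨T, hTS, hT, h⟩ := hmass κ hκ
    refine h.trans (mul_le_mul' le_rfl (Finset.sum_le_sum_of_subset fun b hb => ?_))
    exact Finset.mem_filter.2 ⟨hTS hb, hT b hb⟩
  have hmass0 : ∀ κ : ι → ℤ, dyCube L κ ⊆ dyCube 0 0 → mass κ ≠ 0 := fun κ hκ h0 => by
    have := hmass' κ hκ
    rw [h0, mul_zero] at this
    exact hvol_ne_zero _ _ (le_antisymm this zero_le)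
  have hmasstop : ∀ κ : ι → ℤ, mass κ ≠ ∞ := fun κ => by
    rw [hmassdef]
    exact ENNReal.sum_ne_top.2 fun b _ => hvol_ne_top _ _
  have hwC : ∀ κ, w κ ≤ C := by
    intro κ
    simp only [hw]
    split_ifs with h
    · exact ENNReal.div_le_of_le_mul (hmass' κ h)
    · exact zero_le
  set ψ : (ι → ℝ) → ℝ≥0∞ := fun x =>
    ∑ b ∈ S, (R b).indicator (fun _ => volume (dyCube b.1 b.2) / volume (R b)) x with hψ
  have hψc : DyConst L' ψ := fun x y hxy =>
    Finset.sum_congr rfl fun b _ => dyConst_indicator_dyInner _ _ _ x y hxy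
  have hψint : ∀ A : Set (ι → ℝ), MeasurableSet A → ∫⁻ x in A, ψ x =
      ∑ b ∈ S, volume (dyCube b.1 b.2) / volume (R b) * volume (R b ∩ A) := by
    intro A hA
    rw [hψ, lintegral_finsetSum _ fun b _ => measurable_const.indicator (hRm b)]
    refine Finset.sum_congr rfl fun b _ => ?_
    rw [lintegral_indicator_const (hRm b), Measure.restrict_apply (hRm b)]
  have hterm_sub : ∀ b ∈ S, ∀ A : Set (ι → ℝ), dyCube b.1 b.2 ⊆ A →
      volume (dyCube b.1 b.2) / volume (R b) * volume (R b ∩ A) = volume (dyCube b.1 b.2) := by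
    intro b hb A hA
    rw [inter_eq_left.2 ((hRb b).trans hA), ENNReal.div_mul_cancel (hRpos b hb) (hRtop b)]
  have hterm_dis : ∀ b : ℕ × (ι → ℤ), ∀ A : Set (ι → ℝ), Disjoint (dyCube b.1 b.2) A →
      volume (dyCube b.1 b.2) / volume (R b) * volume (R b ∩ A) = 0 := by
    intro b A hA
    rw [(hA.mono_left (hRb b)).inter_eq, measure_empty, mul_zero]
  set φ : (ι → ℝ) → ℝ≥0∞ := fun x => w (dyIdx L x) * ψ x with hφ
  have hφint : ∀ l, L ≤ l → ∀ (κ κ' : ι → ℤ), dyCube l κ' ⊆ dyCube L κ →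
      ∫⁻ x in dyCube l κ', φ x = w κ * ∫⁻ x in dyCube l κ', ψ x := by
    intro l hl κ κ' hsub
    rw [← lintegral_const_mul _ hψc.measurable]
    refine setLIntegral_congr_fun (measurableSet_dyCube _ _) fun x hx => ?_
    simp only [hφ]
    rw [mem_dyCube.1 (hsub hx)]
  refine ⟨L', φ, ?_, ?_, ?_, ?_, ?_⟩
  · intro x y hxy
    simp only [hφ]
    rw [dyIdx_eq_of_le (le_max_left L _) hxy, hψc x y hxy]
  · have hB : C * ∑ b ∈ S, volume (dyCube b.1 b.2) / volume (R b) ≠ ∞ :=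
      ENNReal.mul_ne_top ENNReal.coe_ne_top (ENNReal.sum_ne_top.2 fun b hb =>
        ENNReal.div_ne_top (hvol_ne_top _ _) (hRpos b hb))
    refine ⟨(C * ∑ b ∈ S, volume (dyCube b.1 b.2) / volume (R b)).toNNReal, fun x => ?_⟩
    rw [ENNReal.coe_toNNReal hB]
    refine mul_le_mul' (hwC _) (Finset.sum_le_sum fun b _ => ?_)
    exact indicator_le_self' (fun _ _ => zero_le) x
  · intro x hx
    obtain ⟨b, hb, hbx⟩ := Finset.exists_ne_zero_of_sum_ne_zero (right_ne_zero_of_mul hx)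
    refine ⟨b, hb, hRU b ?_⟩
    by_contra h
    exact hbx (indicator_of_notMem h _)
  · intro κ hκ
    rw [hφint L le_rfl κ κ subset_rfl, hψint _ (measurableSet_dyCube _ _)]
    have : ∑ b ∈ S, volume (dyCube b.1 b.2) / volume (R b) * volume (R b ∩ dyCube L κ) =
        mass κ := by
      rw [hmassdef]
      simp only
      rw [Finset.sum_filter]
      refine Finset.sum_congr rfl fun b hb => ?_
      split_ifs with h
      · exact hterm_sub b hb _ h
      · refine hterm_dis b _ ?_
        exact ((disjoint_or_subset_dyCube (hlev b hb) κ b.2).resolve_right h).symm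
    rw [this]
    simp only [hw]
    rw [if_pos hκ, ENNReal.div_mul_cancel (hmass0 κ hκ) (hmasstop κ)]
  · intro l hl κ
    obtain ⟨x0, hx0⟩ := dyCube_nonempty l κ
    have hsub : dyCube l κ ⊆ dyCube L (dyIdx L x0) := dyCube_subset_of_le hl rfl hx0
    rw [hφint l hl _ κ hsub, hψint _ (measurableSet_dyCube _ _)]
    refine mul_le_mul' (hwC _) ?_
    by_cases hex : ∃ b0 ∈ S, b0.1 ≤ l ∧ dyCube l κ ⊆ dyCube b0.1 b0.2
    · obtain ⟨b0, hb0, hl0, hsub0⟩ := hex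
      refine le_trans ?_ le_add_self
      rw [Finset.sum_eq_single_of_mem b0 hb0]
      · calc volume (dyCube b0.1 b0.2) / volume (R b0) * volume (R b0 ∩ dyCube l κ)
            ≤ volume (dyCube b0.1 b0.2) / volume (R b0) * volume (dyCube l κ ∩ U b0) := by
              refine mul_le_mul' le_rfl (measure_mono ?_)
              exact fun x hx => ⟨hx.2, hRU b0 hx.1⟩
          _ = volume (dyCube b0.1 b0.2) * volume (dyCube l κ ∩ U b0) / volume (R b0) := by
              rw [ENNReal.mul_div_right_comm]
          _ ≤ g l * (2 * volume (R b0)) / volume (R b0) := by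
              refine ENNReal.div_le_div_right ?_ _
              exact (hfro b0 hb0 l hl0 κ hsub0).trans (mul_le_mul' le_rfl (hRhalf b0 hb0))
          _ = 2 * g l := by
              rw [← mul_assoc, mul_comm (g l),
                ENNReal.mul_div_cancel_right (hRpos b0 hb0) (hRtop b0)]
      · intro b hb hne
        exact hterm_dis b _ ((hdis b hb b0 hb0 hne).mono_right hsub0)
    · push Not at hex
      refine le_trans ?_ le_self_add
      calc ∑ b ∈ S, volume (dyCube b.1 b.2) / volume (R b) * volume (R b ∩ dyCube l κ)
          ≤ ∑ b ∈ S with dyCube b.1 b.2 ⊆ dyCube l κ, volume (dyCube b.1 b.2) := by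
            rw [Finset.sum_filter]
            refine Finset.sum_le_sum fun b hb => ?_
            split_ifs with h
            · exact (hterm_sub b hb _ h).le
            · refine (hterm_dis b _ ?_).le
              rcases le_total b.1 l with hbl | hbl
              · exact (disjoint_or_subset_dyCube hbl b.2 κ).resolve_right (hex b hb hbl)
              · exact ((disjoint_or_subset_dyCube hbl κ b.2).resolve_right h).symm
        _ = volume (⋃ b ∈ S.filter (fun b => dyCube b.1 b.2 ⊆ dyCube l κ), dyCube b.1 b.2) := by
            rw [measure_biUnion_finset ?_ fun b _ => measurableSet_dyCube _ _]
            intro b hb b' hb' hne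
            exact hdis b (Finset.mem_filter.1 hb).1 b' (Finset.mem_filter.1 hb').1 hne
        _ ≤ volume (dyCube l κ) :=
            measure_mono (iUnion₂_subset fun b hb => (Finset.mem_filter.1 hb).2)

/-- The union of a dyadic cube and its neighbours of the same level. -/
def dyNear (l : ℕ) (κ : ι → ℤ) : Set (ι → ℝ) := {x | ∀ p, |dyIdx l x p - κ p| ≤ 1}

theorem dyNear_eq_biUnion [Fintype ι] [DecidableEq ι] (l : ℕ) (κ : ι → ℤ) :
    dyNear l κ = ⋃ κ' ∈ Fintype.piFinset fun p => Finset.Icc (κ p - 1) (κ p + 1),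
      dyCube l κ' := by
  ext x
  simp only [dyNear, mem_ofPred_eq, mem_iUnion, exists_prop, mem_dyCube, exists_eq_right',
    Fintype.mem_piFinset, Finset.mem_Icc, abs_le]
  exact forall_congr' fun p => by constructor <;> (intro h; omega)

theorem card_piFinset_Icc_one [Fintype ι] [DecidableEq ι] (κ : ι → ℤ) :
    (Fintype.piFinset fun p => Finset.Icc (κ p - 1) (κ p + 1)).card = 3 ^ Fintype.card ι := by
  rw [Fintype.card_piFinset, ← Finset.card_univ, ← Finset.prod_const]
  refine Finset.prod_congr rfl fun p _ => ?_
  rw [Int.card_Icc]; omega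

theorem volume_dyNear_le [Fintype ι] (l : ℕ) (κ : ι → ℤ) :
    volume (dyNear l κ) ≤ 3 ^ Fintype.card ι * volume (dyCube l κ) := by
  classical
  rw [dyNear_eq_biUnion]
  refine (measure_biUnion_finset_le _ _).trans ?_
  simp_rw [volume_dyCube]
  rw [Finset.sum_const, card_piFinset_Icc_one, nsmul_eq_mul]
  push_cast; rfl

theorem dyNear_subset_of_le {l l' : ℕ} (h : l ≤ l') {κ κ' : ι → ℤ} {x : ι → ℝ}
    (hx : x ∈ dyCube l κ) (hx' : x ∈ dyCube l' κ') : dyNear l' κ' ⊆ dyNear l κ := by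
  obtain ⟨k, rfl⟩ := Nat.exists_eq_add_of_le h
  intro y hy p
  have h1 := abs_le.1 (hy p)
  rw [← hx'] at h1
  rw [← hx, dyIdx_add l k y, dyIdx_add l k x, abs_le]
  have h2 : (0 : ℤ) < 2 ^ k := by positivity
  have a1 : dyIdx (l + k) y p / 2 ^ k ≤ (dyIdx (l + k) x p + 2 ^ k) / 2 ^ k :=
    Int.ediv_le_ediv h2 (by linarith [h1.2])
  have a2 : dyIdx (l + k) x p / 2 ^ k ≤ (dyIdx (l + k) y p + 2 ^ k) / 2 ^ k :=
    Int.ediv_le_ediv h2 (by linarith [h1.1])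
  rw [Int.add_ediv_of_dvd_right dvd_rfl, Int.ediv_self h2.ne'] at a1 a2
  constructor <;> linarith

/-- The maximal cubes of a finite family of dyadic cubes. -/
theorem exists_maximal_dyCubes (S : Finset (ℕ × (ι → ℤ))) :
    ∃ T ⊆ S, (∀ b ∈ T, ∀ b' ∈ T, b ≠ b' → Disjoint (dyCube b.1 b.2) (dyCube b'.1 b'.2)) ∧
      ∀ b ∈ S, ∃ b' ∈ T, b'.1 ≤ b.1 ∧ dyCube b.1 b.2 ⊆ dyCube b'.1 b'.2 := by
  classical
  refine ⟨S.filter fun b => ∀ b' ∈ S, dyCube b.1 b.2 ⊆ dyCube b'.1 b'.2 → b.1 ≤ b'.1,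
    Finset.filter_subset _ _, ?_, ?_⟩
  · have key : ∀ b b' : ℕ × (ι → ℤ), b ∈ S → b ≠ b' → b.1 ≤ b'.1 →
        (∀ c ∈ S, dyCube b'.1 b'.2 ⊆ dyCube c.1 c.2 → b'.1 ≤ c.1) →
        Disjoint (dyCube b.1 b.2) (dyCube b'.1 b'.2) := by
      intro b b' hb hne hle hmax
      refine (disjoint_or_subset_dyCube hle b.2 b'.2).resolve_right fun hsub => hne ?_
      have h1 : b.1 = b'.1 := le_antisymm hle (hmax b hb hsub)
      obtain ⟨x, hx⟩ := dyCube_nonempty b'.1 b'.2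
      have h2 := mem_dyCube.1 (hsub hx)
      rw [h1, mem_dyCube.1 hx] at h2
      exact Prod.ext h1 h2.symm
    intro b hb b' hb' hne
    rw [Finset.mem_filter] at hb hb'
    rcases le_total b.1 b'.1 with h | h
    · exact key b b' hb.1 hne h hb'.2
    · exact (key b' b hb'.1 hne.symm h hb.2).symm
  · intro b hb
    have hne : (S.filter fun b' => dyCube b.1 b.2 ⊆ dyCube b'.1 b'.2).Nonempty :=
      ⟨b, Finset.mem_filter.2 ⟨hb, subset_rfl⟩⟩
    obtain ⟨b0, hb0, hmin⟩ := Finset.exists_min_image _ Prod.fst hne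
    rw [Finset.mem_filter] at hb0
    refine ⟨b0, Finset.mem_filter.2 ⟨hb0.1, fun b' hb' hsub => ?_⟩, ?_, hb0.2⟩
    · exact hmin b' (Finset.mem_filter.2 ⟨hb', hb0.2.trans hsub⟩)
    · exact hmin b (Finset.mem_filter.2 ⟨hb, subset_rfl⟩)

end Packing

end WeightedApprox

namespace WeightedApprox

open MeasureTheory Set

/-! ### From balls to boxes -/

/-- The Frostman bound for Lebesgue measure on the neighbourhood of radii `r j` of a plane, inside a
ball of radius `ρ` and normalised to the volume of that ball. The two products are the volumes of
the neighbourhood in balls of radius `s` and `ρ`; since `min x y * max x y = x * y`, the bound says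
that `boxValue` at the scale `s` is at least `ε⁻¹ * ∏ max (r j) ρ`. -/
theorem IsGauge.pow_mul_prod_min_le {f : ℝ≥0 → ℝ≥0} {n m a : ℕ} (hf : IsGauge f (n * m) a)
    (hn : 1 ≤ n) (ha : 1 ≤ a) (ham : a ≤ m) {r : Fin m → ℝ≥0} {ρ s ε : ℝ≥0} (hs : 0 < s)
    (h : ∏ j, max (r j) ρ ≤ ε * boxContent f (n * m) r) :
    ρ ^ (n * m) * ∏ j, (min s (r j) * s ^ (n - 1)) ≤
      ε * f s * ∏ j, (min (r j) ρ * ρ ^ (n - 1)) := by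
  have haN : a ≤ n * m := ham.trans (Nat.le_mul_of_pos_left m hn)
  set X := ∏ j, max (r j) s with hX
  have hX0 : 0 < X := Finset.prod_pos fun j _ => lt_max_of_lt_right hs
  have hbox : s ^ (n * m) * boxContent f (n * m) r ≤ f s * X := by
    have := hf.boxContent_le_boxValue ha ham haN r hs
    unfold boxValue at this
    rw [div_mul_eq_mul_div, le_div_iff₀ (by positivity)] at this
    rwa [mul_comm]
  have e1 : (∏ j, (min s (r j) * s ^ (n - 1))) * X = s ^ (n * m) * ∏ j, r j := by
    rw [hX, ← Finset.prod_mul_distrib]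
    calc ∏ j, (min s (r j) * s ^ (n - 1) * max (r j) s)
        = ∏ j, (s ^ n * r j) := by
          refine Finset.prod_congr rfl fun j _ => ?_
          rw [max_comm, mul_right_comm, min_mul_max]
          obtain ⟨k, rfl⟩ := Nat.exists_eq_add_of_le' hn
          rw [Nat.add_sub_cancel, pow_succ]; ring
      _ = _ := by rw [Finset.prod_mul_distrib]; simp [pow_mul]
  have e2 : (∏ j, (min (r j) ρ * ρ ^ (n - 1))) * ∏ j, max (r j) ρ = ρ ^ (n * m) * ∏ j, r j := by
    rw [← Finset.prod_mul_distrib]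
    calc ∏ j, (min (r j) ρ * ρ ^ (n - 1) * max (r j) ρ)
        = ∏ j, (ρ ^ n * r j) := by
          refine Finset.prod_congr rfl fun j _ => ?_
          rw [mul_right_comm, min_mul_max]
          obtain ⟨k, rfl⟩ := Nat.exists_eq_add_of_le' hn
          rw [Nat.add_sub_cancel, pow_succ]; ring
      _ = _ := by rw [Finset.prod_mul_distrib]; simp [pow_mul]
  refine le_of_mul_le_mul_right ?_ hX0
  calc ρ ^ (n * m) * (∏ j, (min s (r j) * s ^ (n - 1))) * X
      = s ^ (n * m) * (ρ ^ (n * m) * ∏ j, r j) := by rw [mul_assoc, e1]; ring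
    _ = s ^ (n * m) * (∏ j, max (r j) ρ) * ∏ j, (min (r j) ρ * ρ ^ (n - 1)) := by
        rw [← e2]; ring
    _ ≤ s ^ (n * m) * (ε * boxContent f (n * m) r) * ∏ j, (min (r j) ρ * ρ ^ (n - 1)) := by gcongr
    _ = ε * (s ^ (n * m) * boxContent f (n * m) r) * ∏ j, (min (r j) ρ * ρ ^ (n - 1)) := by ring
    _ ≤ ε * (f s * X) * ∏ j, (min (r j) ρ * ρ ^ (n - 1)) := by gcongr
    _ = _ := by ring

/-- The thickening radius `ρ` is chosen so that `∏ max (r j) ρ` has a prescribed size. -/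
theorem exists_radius {m : ℕ} [NeZero m] {r : Fin m → ℝ≥0} {R B : ℝ≥0} (hr0 : ∀ j, 0 < r j)
    (hrR : ∀ j, r j ≤ R) (hB : ∏ j, r j ≤ B) :
    ∃ ρ, 0 < ρ ∧ ρ ≤ R ∧ ∏ j, max (r j) ρ = min B (R ^ m) := by
  obtain ⟨i, hi⟩ := Finite.exists_min r
  have hcont : Continuous fun ρ : ℝ≥0 => ∏ j, max (r j) ρ := by fun_prop
  have h1 : ∏ j, max (r j) (r i) = ∏ j, r j := Finset.prod_congr rfl fun j _ => max_eq_left (hi j)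
  have h2 : ∏ j, max (r j) R = R ^ m := by
    rw [Finset.prod_congr rfl fun j _ => max_eq_right (hrR j)]; simp
  have h3 : ∏ j, r j ≤ R ^ m := by
    rw [← h2]; exact Finset.prod_le_prod' fun j _ => le_max_left _ _
  have hmem : min B (R ^ m) ∈ Icc (∏ j, max (r j) (r i)) (∏ j, max (r j) R) := by
    rw [h1, h2]; exact ⟨le_min hB h3, min_le_right _ _⟩
  obtain ⟨ρ, hρ, hρe⟩ := intermediate_value_Icc (hrR i) hcont.continuousOn hmem
  exact ⟨ρ, (hr0 i).trans_le hρ.1, hρ.2, hρe⟩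

/-- For small radii the content `boxContent f N r` is much larger than the volume `∏ r j`, because
`f r / r ^ N` tends to infinity at `0`. -/
theorem IsGauge.prod_le_boxContent {f : ℝ≥0 → ℝ≥0} {N m a : ℕ} [NeZero m] (hf : IsGauge f N a)
    {ε : ℝ≥0} (hε : 0 < ε) : ∃ δ : ℝ≥0, 0 < δ ∧ ∀ r : Fin m → ℝ≥0, (∀ j, 0 < r j) →
      (∀ j, r j < δ) → ∏ j, r j ≤ ε * boxContent f N r := by
  obtain ⟨δ, hδ, h⟩ := hf.large ε⁻¹
  refine ⟨δ, hδ, fun r hr0 hrδ => ?_⟩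
  obtain ⟨i, hi⟩ := exists_boxContent_eq f N r
  have h1 := h (r i) (hr0 i) (hrδ i)
  have h2 : 1 ≤ ε * (f (r i) / r i ^ N) := by
    have hri := hr0 i
    rw [← mul_div_assoc, le_div_iff₀ (by positivity), one_mul]
    calc r i ^ N = ε * (ε⁻¹ * r i ^ N) := by field_simp
      _ ≤ ε * f (r i) := by gcongr
  rw [hi, boxValue, ← mul_assoc]
  calc ∏ j, r j ≤ ∏ j, max (r j) (r i) := Finset.prod_le_prod' fun j _ => le_max_left _ _
    _ ≤ _ := le_mul_of_one_le_left zero_le h2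

/-- The coordinatewise projection from matrices to the torus. -/
def toTorus {n m : ℕ} (x : Fin n × Fin m → ℝ) : Fin n × Fin m → UnitAddCircle := fun p => x p

theorem continuous_toTorus {n m : ℕ} : Continuous (toTorus (n := n) (m := m)) :=
  continuous_pi fun p => (AddCircle.continuous_mk' (1 : ℝ)).comp (continuous_apply p)

/-- The matrices `x` such that each `q x_j` lies at distance at most `δ j` from an integer. -/
def closedSlab {n m : ℕ} (q : Fin n → ℤ) (δ : Fin m → ℝ) : Set (Fin n × Fin m → ℝ) :=
  toTorus ⁻¹' torusSlab q δ

theorem isClosed_closedSlab {n m : ℕ} (q : Fin n → ℤ) (δ : Fin m → ℝ) :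
    IsClosed (closedSlab q δ) := (isClosed_torusSlab q δ).preimage continuous_toTorus

theorem torusForm_toTorus {n m : ℕ} (q : Fin n → ℤ) (x : Fin n × Fin m → ℝ) (j : Fin m) :
    torusForm m q (toTorus x) j = ((∑ i, (q i : ℝ) * x (i, j) : ℝ) : UnitAddCircle) := by
  rw [torusForm_apply]
  simp only [toTorus, ← AddCircle.coe_zsmul, zsmul_eq_mul]
  exact (map_sum (QuotientAddGroup.mk' (AddSubgroup.zmultiples (1 : ℝ))) _ _).symm

theorem mem_closedSlab_iff {n m : ℕ} {q : Fin n → ℤ} {δ : Fin m → ℝ} {x : Fin n × Fin m → ℝ} :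
    x ∈ closedSlab q δ ↔ ∀ j, distInt (∑ i, (q i : ℝ) * x (i, j)) ≤ δ j := by
  refine forall_congr' fun j => ?_
  rw [torusForm_toTorus, UnitAddCircle.norm_eq, distInt]

theorem slab_subset_closedSlab {n m : ℕ} (q : Fin n → ℤ) (δ : Fin m → ℝ) :
    slab q δ ⊆ closedSlab q δ := by
  intro x hx
  rw [mem_closedSlab_iff]
  intro j
  obtain ⟨p, hp⟩ := hx j
  exact (round_le _ p).trans hp.le

theorem closedBall_subset_dyNear {ι : Type*} [Fintype ι] {l : ℕ} {x : ι → ℝ} {s : ℝ}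
    (hs : s ≤ dySide l) : Metric.closedBall x s ⊆ dyNear l (dyIdx l x) := by
  intro y hy p
  have h1 : |y p - x p| ≤ dySide l := by
    rw [← Real.dist_eq]; exact (dist_le_pi_dist y x p).trans (hy.trans hs)
  rw [coe_dySide, le_div_iff₀ (by positivity), ← abs_of_pos (by positivity : (0 : ℝ) < 2 ^ l),
    ← abs_mul, sub_mul, abs_le] at h1
  unfold dyIdx
  rw [abs_le]
  have h2 : ⌊x p * 2 ^ l⌋ ≤ ⌊y p * 2 ^ l⌋ + 1 := by
    rw [← Int.floor_add_one]; exact Int.floor_mono (by linarith [h1.1])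
  have h3 : ⌊y p * 2 ^ l⌋ ≤ ⌊x p * 2 ^ l⌋ + 1 := by
    rw [← Int.floor_add_one]; exact Int.floor_mono (by linarith [h1.2])
  constructor <;> linarith

/-- The lower bound for the volume of a neighbourhood of radii `r j` in a cube of side comparable
with `ρ` that defines the cubes used in the construction. -/
noncomputable def slabBound {m : ℕ} (n : ℕ) (r : Fin m → ℝ≥0) (ρ : ℝ≥0) : ℝ≥0 :=
  (3 ^ (n * m) * (2 * (n : ℝ≥0) ^ (n - 1)) ^ m)⁻¹ * ∏ j, (min (r j) ρ * ρ ^ (n - 1))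

/-- A point of the thickened neighbourhood has a neighbouring dyadic cube, of side comparable with
`ρ`, of which the neighbourhood of radii `r j` fills a proportionate part. -/
theorem exists_good_dyCube {n m : ℕ} {q : Fin n → ℤ} (hq : q ≠ 0) {r : Fin m → ℝ≥0}
    (hr : ∀ j, 0 < r j) {ρ : ℝ≥0} (hρ : 0 < ρ) {l : ℕ} (hρl : 2 * ρ ≤ dySide l)
    {x : Fin n × Fin m → ℝ} (hx : x ∈ closedSlab q fun j => ‖q‖ * max (r j) ρ) :
    ∃ κ, x ∈ dyNear l κ ∧
      (slabBound n r ρ : ℝ≥0∞) ≤ volume (dyCube l κ ∩ slab q fun j => ‖q‖ * r j) := by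
  classical
  obtain ⟨i0, hi0, hmax, hnorm⟩ := exists_max_coord hq
  rw [coe_nnnorm] at hnorm
  have hn : 0 < n := Fin.pos i0
  rw [mem_closedSlab_iff] at hx
  have hlow := le_volume_slab_inter_closedBall hi0 hmax (r := fun j => (r j : ℝ))
    (fun j => hr j) (ρ := ρ) hρ (x := x) fun j => ⟨round _, by
      have := hx j
      rw [hnorm] at this
      exact this⟩
  rw [← hnorm] at hlow
  have e : ENNReal.ofReal (∏ j, (min (r j : ℝ) ρ / 2 * ((ρ : ℝ) / n) ^ (n - 1))) =
      (3 : ℝ≥0∞) ^ (n * m) * (slabBound n r ρ : ℝ≥0) := by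
    rw [← ENNReal.ofReal_coe_nnreal, ← ENNReal.ofReal_ofNat, ← ENNReal.ofReal_pow (by norm_num),
      ← ENNReal.ofReal_mul (by positivity)]
    congr 1
    unfold slabBound
    push_cast
    have hnR : (n : ℝ) ≠ 0 := by exact_mod_cast hn.ne'
    rw [mul_inv, mul_assoc, mul_inv_cancel_left₀ (by positivity)]
    have : ((2 * (n : ℝ) ^ (n - 1)) ^ m)⁻¹ = ∏ _j : Fin m, (2 * (n : ℝ) ^ (n - 1))⁻¹ := by
      rw [Finset.prod_const, Finset.card_univ, Fintype.card_fin, inv_pow]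
    rw [this, ← Finset.prod_mul_distrib]
    refine Finset.prod_congr rfl fun j _ => ?_
    rw [div_pow, mul_inv]
    ring
  rw [e] at hlow
  set κ0 := dyIdx l x with hκ0
  set T := Fintype.piFinset fun p => Finset.Icc (κ0 p - 1) (κ0 p + 1) with hT
  have hcov : volume ((slab q fun j => ‖q‖ * (r j : ℝ)) ∩ Metric.closedBall x (2 * ρ)) ≤
      ∑ κ ∈ T, volume (dyCube l κ ∩ slab q fun j => ‖q‖ * (r j : ℝ)) := by
    refine (measure_mono ?_).trans (measure_biUnion_finset_le T _)
    rintro y ⟨hy1, hy2⟩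
    have h := closedBall_subset_dyNear (l := l) (s := 2 * ρ) (by exact_mod_cast hρl) hy2
    rw [dyNear_eq_biUnion, mem_iUnion₂] at h
    obtain ⟨κ, hκ, hy⟩ := h
    exact mem_iUnion₂.2 ⟨κ, hκ, hy, hy1⟩
  have hcard : T.card = 3 ^ (n * m) := by
    rw [hT, card_piFinset_Icc_one]; simp
  have hex : ∃ κ ∈ T, (slabBound n r ρ : ℝ≥0∞) ≤
      volume (dyCube l κ ∩ slab q fun j => ‖q‖ * (r j : ℝ)) := by
    by_contra! hcon
    have h := ENNReal.sum_lt_sum_of_nonempty ⟨κ0, by simp [hT]⟩ hcon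
    rw [Finset.sum_const, hcard, nsmul_eq_mul] at h
    push_cast at h
    exact (hlow.trans hcov).not_gt h
  obtain ⟨κ, hκ, h⟩ := hex
  refine ⟨κ, fun p => ?_, h⟩
  have := Finset.mem_Icc.1 (Fintype.mem_piFinset.1 hκ p)
  rw [abs_le]
  constructor <;> linarith [this.1, this.2]

theorem volume_dyCube_inter_slab_le {n m : ℕ} {q : Fin n → ℤ} (hq : q ≠ 0) {r : Fin m → ℝ≥0}
    (hr1 : ∀ j, r j * ‖q‖₊ ≤ 1) {l : ℕ} (hl : dySide l * ‖q‖₊ ≤ 4) (κ : Fin n × Fin m → ℤ) :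
    volume (dyCube l κ ∩ slab q fun j => ‖q‖ * r j) ≤
      (((16 * (n : ℝ≥0) + 6) * 2 ^ (n - 1)) ^ m *
        ∏ j, (min (dySide l) (r j) * dySide l ^ (n - 1)) : ℝ≥0) := by
  obtain ⟨i0, hi0, hmax, hnorm⟩ := exists_max_coord hq
  rw [coe_nnnorm] at hnorm
  obtain ⟨a, ha⟩ := dyCube_nonempty l κ
  set s := dySide l with hs
  have hsub : dyCube l κ ∩ slab q (fun j => ‖q‖ * (r j : ℝ)) ⊆
      slab q (fun j => ‖q‖ * (r j : ℝ)) ∩ Metric.closedBall a s :=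
    fun x hx => ⟨hx.2, dist_le_of_mem_dyCube hx.1 ha⟩
  refine (measure_mono hsub).trans ((volume_slab_inter_closedBall_le hi0 hmax _
    (fun j => by positivity) a (NNReal.coe_nonneg s)).trans ?_)
  rw [← ENNReal.ofReal_coe_nnreal]
  refine ENNReal.ofReal_le_ofReal ?_
  push_cast
  have e : ((16 * (n : ℝ) + 6) * 2 ^ (n - 1)) ^ m =
      ∏ _j : Fin m, ((16 * (n : ℝ) + 6) * 2 ^ (n - 1)) := by simp
  rw [e, ← Finset.prod_mul_distrib]
  have hQ : 0 < ‖q‖ := norm_pos_iff.2 hq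
  refine Finset.prod_le_prod (fun j _ => by positivity) fun j _ => ?_
  rw [← hnorm]
  have h1 : (r j : ℝ) * ‖q‖ ≤ 1 := by exact_mod_cast hr1 j
  have h2 : (s : ℝ) * ‖q‖ ≤ 4 := by exact_mod_cast hl
  have hkey : min (2 * n * (s : ℝ)) ((2 * (n * (‖q‖ * s) + ‖q‖ * r j) + 1) *
      (2 * (‖q‖ * r j / ‖q‖))) ≤ (16 * n + 6) * min (s : ℝ) (r j) := by
    rw [mul_min_of_nonneg _ _ (by positivity : (0 : ℝ) ≤ 16 * n + 6)]
    refine min_le_min ?_ ?_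
    · gcongr
      have : (0 : ℝ) ≤ n := Nat.cast_nonneg n
      linarith
    · rw [mul_div_cancel_left₀ _ hQ.ne']
      have h3 : 2 * (n * (‖q‖ * s) + ‖q‖ * r j) + 1 ≤ 8 * (n : ℝ) + 3 := by
        have : (n : ℝ) * (‖q‖ * s) ≤ n * 4 := by gcongr; linarith
        linarith
      calc (2 * (n * (‖q‖ * s) + ‖q‖ * r j) + 1) * (2 * (r j : ℝ))
          ≤ (8 * (n : ℝ) + 3) * (2 * (r j : ℝ)) := by gcongr
        _ = _ := by ring
  calc min (2 * n * (s : ℝ)) ((2 * (n * (‖q‖ * s) + ‖q‖ * r j) + 1) *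
      (2 * (‖q‖ * r j / ‖q‖))) * (2 * s) ^ (n - 1)
      ≤ (16 * n + 6) * min (s : ℝ) (r j) * (2 * s) ^ (n - 1) := by gcongr
    _ = _ := by rw [mul_pow]; ring

/-- The constant in the Frostman bound for the normalised Lebesgue measure on a neighbourhood. -/
noncomputable def frostmanConst (n m : ℕ) : ℝ≥0 :=
  4 ^ (n * m) * ((16 * (n : ℝ≥0) + 6) * 2 ^ (n - 1)) ^ m *
    (3 ^ (n * m) * (2 * (n : ℝ≥0) ^ (n - 1)) ^ m)

/-- The Frostman bound for Lebesgue measure on `slab q`, inside one of the cubes of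
`exists_good_dyCube` and normalised to the volume of that cube. -/
theorem IsGauge.volume_mul_volume_inter_slab_le {f : ℝ≥0 → ℝ≥0} {n m a : ℕ}
    (hf : IsGauge f (n * m) a) (ha : 1 ≤ a) (ham : a ≤ m) {q : Fin n → ℤ} (hq : q ≠ 0)
    {r : Fin m → ℝ≥0} (hr1 : ∀ j, r j * ‖q‖₊ ≤ 1) {ρ ε : ℝ≥0} (hρ1 : ρ * ‖q‖₊ ≤ 1)
    (h : ∏ j, max (r j) ρ ≤ ε * boxContent f (n * m) r) {l0 l : ℕ} (hl0 : dySide l0 ≤ 4 * ρ)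
    (hl : l0 ≤ l) (κ0 κ : Fin n × Fin m → ℤ)
    (hgood : (slabBound n r ρ : ℝ≥0∞) ≤ volume (dyCube l0 κ0 ∩ slab q fun j => ‖q‖ * r j)) :
    volume (dyCube l0 κ0) * volume (dyCube l κ ∩ slab q fun j => ‖q‖ * r j) ≤
      (frostmanConst n m * ε * f (dySide l) : ℝ≥0) *
        volume (dyCube l0 κ0 ∩ slab q fun j => ‖q‖ * r j) := by
  obtain ⟨i0, -⟩ := exists_max_coord hq
  have hn : 1 ≤ n := Fin.pos i0
  have hls : dySide l ≤ 4 * ρ := (dySide_anti hl).trans hl0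
  have hl4 : dySide l * ‖q‖₊ ≤ 4 := by
    calc dySide l * ‖q‖₊ ≤ 4 * ρ * ‖q‖₊ := by gcongr
      _ = 4 * (ρ * ‖q‖₊) := by ring
      _ ≤ 4 * 1 := by gcongr
      _ = 4 := mul_one _
  have hkey := hf.pow_mul_prod_min_le hn ha ham (dySide_pos l) h
  refine le_trans ?_ (mul_le_mul' le_rfl hgood)
  rw [volume_dyCube]
  refine (mul_le_mul' le_rfl (volume_dyCube_inter_slab_le hq hr1 hl4 κ)).trans ?_
  have hcard : Fintype.card (Fin n × Fin m) = n * m := by simp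
  rw [hcard, ← ENNReal.coe_pow, ← ENNReal.coe_mul, ← ENNReal.coe_mul, ENNReal.coe_le_coe]
  set P := ∏ j, (min (dySide l) (r j) * dySide l ^ (n - 1)) with hP
  set P' := ∏ j, (min (r j) ρ * ρ ^ (n - 1)) with hP'
  have hD : (3 ^ (n * m) * (2 * (n : ℝ≥0) ^ (n - 1)) ^ m) ≠ 0 := by
    have : (0 : ℝ≥0) < n := by exact_mod_cast hn
    positivity
  calc dySide l0 ^ (n * m) * (((16 * (n : ℝ≥0) + 6) * 2 ^ (n - 1)) ^ m * P)
      ≤ (4 * ρ) ^ (n * m) * (((16 * (n : ℝ≥0) + 6) * 2 ^ (n - 1)) ^ m * P) := by gcongr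
    _ = 4 ^ (n * m) * ((16 * (n : ℝ≥0) + 6) * 2 ^ (n - 1)) ^ m * (ρ ^ (n * m) * P) := by
        rw [mul_pow]; ring
    _ ≤ 4 ^ (n * m) * ((16 * (n : ℝ≥0) + 6) * 2 ^ (n - 1)) ^ m * (ε * f (dySide l) * P') := by
        gcongr
    _ = frostmanConst n m * ε * f (dySide l) * slabBound n r ρ := by
        unfold frostmanConst slabBound
        rw [← hP']
        field_simp

end WeightedApprox

namespace WeightedApprox

open MeasureTheory Set

/-! ### Spreading mass over neighbourhoods of affine planes -/

theorem summable_of_summable_min_one {α : Type*} {x : α → ℝ≥0}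
    (h : Summable fun i => min (x i) 1) : Summable x := by
  rw [← NNReal.summable_coe] at h ⊢
  refine Summable.of_norm_bounded_eventually h ?_
  have h1 := h.tendsto_cofinite_zero.eventually (gt_mem_nhds one_pos)
  filter_upwards [h1] with i hi
  rw [NNReal.norm_eq]
  push_cast at hi ⊢
  rcases min_lt_iff.1 hi with h2 | h2
  · rw [min_eq_left h2.le]
  · exact absurd h2 (lt_irrefl _)

theorem dyCube_zero_zero {ι : Type*} :
    dyCube 0 (0 : ι → ℤ) = univ.pi fun _ : ι => Ico (0 : ℝ) 1 := by
  rw [dyCube_eq_pi]; simp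

theorem ae_restrict_of_ae_torus {n m : ℕ} {P : (Fin n × Fin m → UnitAddCircle) → Prop}
    (h : ∀ᵐ y, P y) : ∀ᵐ x ∂(volume.restrict (dyCube 0 (0 : Fin n × Fin m → ℤ))),
      P (toTorus x) := by
  have hmp : MeasurePreserving (toTorus (n := n) (m := m))
      (volume.restrict (dyCube 0 (0 : Fin n × Fin m → ℤ))) volume := by
    have h1 : MeasurePreserving (fun x : ℝ => (x : UnitAddCircle)) (volume.restrict (Ico 0 1))
        volume := by
      rw [Measure.restrict_congr_set Ico_ae_eq_Ioc]
      simpa using UnitAddCircle.measurePreserving_mk 0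
    rw [dyCube_zero_zero, volume_pi, Measure.restrict_pi_pi]
    exact measurePreserving_pi _ _ fun _ => h1
  exact hmp.quasiMeasurePreserving.ae h

theorem mem_Icc_of_dyCube_subset {ι : Type*} {L : ℕ} {κ : ι → ℤ}
    (h : dyCube L κ ⊆ dyCube 0 0) : κ ∈ Icc (0 : ι → ℤ) (fun _ => 2 ^ L) := by
  obtain ⟨x, hx⟩ := dyCube_nonempty L κ
  have key : ∀ p, κ p / 2 ^ L = 0 := fun p => by
    have h1 := dyIdx_add 0 L x p
    rw [zero_add, mem_dyCube.1 hx, mem_dyCube.1 (h hx)] at h1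
    exact h1.symm
  have h2 : (0 : ℤ) < 2 ^ L := by positivity
  refine ⟨fun p => ?_, fun p => ?_⟩
  · exact (Int.ediv_nonneg_iff_of_pos h2).1 (key p).ge
  · have := Int.lt_ediv_add_one_mul_self (κ p) h2
    rw [key p] at this
    simpa using this.le

theorem finite_dyCube_subset {ι : Type*} [Finite ι] (L : ℕ) :
    {κ : ι → ℤ | dyCube L κ ⊆ dyCube 0 0}.Finite := by
  classical
  have := Fintype.ofFinite ι
  exact (finite_Icc (0 : ι → ℤ) (fun _ => 2 ^ L)).subset fun κ hκ => mem_Icc_of_dyCube_subset hκ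

/-- A cube of a quarter of the side, surrounded by cubes that still lie in the original cube. -/
theorem dyCube_core_subset {ι : Type*} (L : ℕ) (κ : ι → ℤ) :
    dyCube (L + 2) (fun p => 4 * κ p + 1) ⊆ dyCube L κ := by
  intro x hx
  ext p
  rw [dyIdx_add L 2, mem_dyCube.1 hx]
  change (4 * κ p + 1) / 2 ^ 2 = κ p
  omega

theorem dyCube_subset_of_mem_core {ι : Type*} {L l : ℕ} (hl : L + 2 ≤ l) {κ κ' : ι → ℤ}
    {x : ι → ℝ} (hx : x ∈ dyCube (L + 2) fun p => 4 * κ p + 1) (hx' : x ∈ dyNear l κ') :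
    dyCube l κ' ⊆ dyCube L κ := by
  intro y hy
  have h1 : y ∈ dyNear l (dyIdx l x) := fun p => by
    rw [mem_dyCube.1 hy, abs_sub_comm]; exact hx' p
  have h2 := dyNear_subset_of_le hl hx rfl h1
  ext p
  have h3 : -1 ≤ dyIdx (L + 2) y p - (4 * κ p + 1) ∧ dyIdx (L + 2) y p - (4 * κ p + 1) ≤ 1 :=
    abs_le.1 (h2 p)
  rw [dyIdx_add L 2]
  omega

theorem volume_dyCube_eq_core {ι : Type*} [Fintype ι] (L : ℕ) (κ : ι → ℤ) :
    volume (dyCube L κ) =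
      4 ^ Fintype.card ι * volume (dyCube (L + 2) fun p => 4 * κ p + 1) := by
  rw [volume_dyCube, volume_dyCube, ← mul_pow]
  congr 1
  unfold dySide
  rw [pow_add]
  norm_cast
  rw [mul_comm ((1 / 2 : ℝ≥0) ^ L), ← mul_assoc]
  norm_num

/-- Finitely many of countably many sets that cover almost everything cover half of the measure. -/
theorem exists_finset_volume_le {α ι κ : Type*} [Countable ι] [Finite κ] [MeasurableSpace α]
    {μ : Measure α} {D : κ → Set α} (hD : ∀ k, μ (D k) ≠ ∞)
    {A : ι → Set α} (h : ∀ k, ∀ᵐ x ∂(μ.restrict (D k)), ∃ i, x ∈ A i)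
    (hA : ∀ i, MeasurableSet (A i)) :
    ∃ F : Finset ι, ∀ k, μ (D k) ≤ 2 * μ (D k ∩ ⋃ i ∈ F, A i) := by
  classical
  have hone : ∀ k, ∃ F : Finset ι, μ (D k) ≤ 2 * μ (D k ∩ ⋃ i ∈ F, A i) := by
    intro k
    rcases eq_or_ne (μ (D k)) 0 with h0 | h0
    · exact ⟨∅, by simp [h0]⟩
    have hmono : Monotone fun F : Finset ι => ⋃ i ∈ F, A i := fun F F' hF =>
      biUnion_subset_biUnion_left hF
    have hsup := hmono.measure_iUnion (μ := μ.restrict (D k))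
    have hfull : μ.restrict (D k) (⋃ F : Finset ι, ⋃ i ∈ F, A i) = μ (D k) := by
      rw [← Measure.restrict_apply_univ (μ := μ) (D k)]
      refine measure_congr ?_
      filter_upwards [h k] with x hx
      obtain ⟨i, hi⟩ := hx
      refine eq_iff_iff.2 ⟨fun _ => trivial, fun _ => ?_⟩
      exact mem_iUnion.2 ⟨{i}, by simpa using hi⟩
    rw [hfull] at hsup
    have hlt : μ (D k) / 2 < ⨆ F : Finset ι, μ.restrict (D k) (⋃ i ∈ F, A i) :=
      (ENNReal.half_lt_self h0 (hD k)).trans_eq hsup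
    obtain ⟨F, hF⟩ := lt_iSup_iff.1 hlt
    refine ⟨F, ?_⟩
    rw [Measure.restrict_apply (F.measurableSet_biUnion fun i _ => hA i), inter_comm] at hF
    rw [mul_comm]
    exact (ENNReal.div_le_iff_le_mul (by simp) (by simp)).1 hF.le
  choose F hF using hone
  have := Fintype.ofFinite κ
  refine ⟨Finset.univ.biUnion F, fun k => (hF k).trans ?_⟩
  refine mul_le_mul_right (measure_mono (inter_subset_inter_right _ ?_)) 2
  exact biUnion_subset_biUnion_left (Finset.subset_biUnion_of_mem F (Finset.mem_univ k))

theorem exists_level_near {ρ : ℝ≥0} (hρ : 0 < ρ) {L : ℕ} (h : 2 * ρ ≤ dySide L) :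
    ∃ l, L ≤ l ∧ 2 * ρ ≤ dySide l ∧ dySide l ≤ 4 * ρ := by
  have h1 : 2 * ρ ≤ 1 := h.trans (pow_le_one₀ zero_le (by norm_num))
  obtain ⟨l, hl1, hl2⟩ := exists_nat_pow_near_of_lt_one (K := ℝ≥0) (y := 1 / 2)
    (by positivity : 0 < 2 * ρ) h1 (by norm_num) (by rw [div_lt_one] <;> norm_num)
  refine ⟨l, ?_, hl2, ?_⟩
  · by_contra! hlt
    exact (h.trans (dySide_anti (Nat.succ_le_of_lt hlt))).not_gt hl1
  · rw [pow_succ] at hl1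
    have : dySide l * (1 / 2) < 2 * ρ := hl1
    calc dySide l = 2 * (dySide l * (1 / 2)) := by rw [mul_comm, mul_assoc]; norm_num
      _ ≤ 2 * (2 * ρ) := by gcongr
      _ = 4 * ρ := by rw [← mul_assoc]; norm_num

theorem slabBound_pos {n m : ℕ} (hn : 0 < n) {r : Fin m → ℝ≥0} (hr : ∀ j, 0 < r j) {ρ : ℝ≥0}
    (hρ : 0 < ρ) : 0 < slabBound n r ρ := by
  have : (0 : ℝ≥0) < n := by exact_mod_cast hn
  exact mul_pos (by positivity)
    (Finset.prod_pos fun j _ => mul_pos (lt_min (hr j) hρ) (by positivity))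

/-- If almost every point of the unit cube lies in one of the thickened neighbourhoods, of radii
`max (r i j) (ρ i)`, then Lebesgue measure can be spread over finitely many of the neighbourhoods of
radii `r i j` without creating mass concentrations beyond `f`. -/
theorem exists_density_slabs {f : ℝ≥0 → ℝ≥0} {n m a : ℕ} (hf : IsGauge f (n * m) a) (ha : 1 ≤ a)
    (ham : a ≤ m) {ι : Type*} [Countable ι] {q : ι → Fin n → ℤ} (hq : ∀ i, q i ≠ 0)
    {r : ι → Fin m → ℝ≥0} (hr0 : ∀ i j, 0 < r i j) (hr1 : ∀ i j, r i j * ‖q i‖₊ ≤ 1)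
    {ε : ℝ≥0} {ρ : ι → ℝ≥0} (hρ0 : ∀ i, 0 < ρ i) (hρ1 : ∀ i, ρ i * ‖q i‖₊ ≤ 1)
    (hρ : ∀ i, ∏ j, max (r i j) (ρ i) ≤ ε * boxContent f (n * m) (r i))
    {L : ℕ} (hρL : ∀ i, 2 * ρ i ≤ dySide (L + 2))
    (hae : ∀ᵐ x ∂(volume.restrict (dyCube 0 (0 : Fin n × Fin m → ℤ))),
      ∃ i, x ∈ closedSlab (q i) fun j => ‖q i‖ * max (r i j) (ρ i)) :
    ∃ (L' : ℕ) (φ : (Fin n × Fin m → ℝ) → ℝ≥0∞) (F : Finset ι), DyConst L' φ ∧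
      (∃ B : ℝ≥0, ∀ x, φ x ≤ B) ∧
      (∀ x, φ x ≠ 0 → ∃ i ∈ F, x ∈ closedSlab (q i) fun j => ‖q i‖ * r i j) ∧
      (∀ κ, dyCube L κ ⊆ dyCube 0 0 → ∫⁻ x in dyCube L κ, φ x = volume (dyCube L κ)) ∧
      (∀ l, L ≤ l → ∀ κ, ∫⁻ x in dyCube l κ, φ x ≤
        (2 * 12 ^ (n * m) : ℝ≥0) *
          (volume (dyCube l κ) + 2 * (frostmanConst n m * ε * f (dySide l) : ℝ≥0))) := by
  classical
  -- the sides of the small cubes are comparable with `ρ`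
  choose lev hlevL hlev2 hlev4 using fun i => exists_level_near (hρ0 i) (hρL i)
  set A : ι → Set (Fin n × Fin m → ℝ) :=
    fun i => closedSlab (q i) fun j => ‖q i‖ * max (r i j) (ρ i) with hA
  set 𝒟 : Set (Fin n × Fin m → ℤ) := {κ | dyCube L κ ⊆ dyCube 0 0} with h𝒟
  have h𝒟fin : Finite 𝒟 := (finite_dyCube_subset L).to_subtype
  -- the neighbours of the cubes that meet the central part of a cube of level `L` lie in that cube
  have hcore : ∀ κ : 𝒟, dyCube (L + 2) (fun p => 4 * κ.1 p + 1) ⊆ dyCube 0 0 := fun κ =>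
    (dyCube_core_subset L κ.1).trans κ.2
  obtain ⟨F, hF⟩ := exists_finset_volume_le (μ := volume) (A := A)
    (D := fun κ : 𝒟 => dyCube (L + 2) fun p => 4 * κ.1 p + 1)
    (fun κ => by
      rw [volume_dyCube]
      exact ENNReal.pow_ne_top ENNReal.coe_ne_top)
    (fun κ => ae_mono (Measure.restrict_mono (hcore κ) le_rfl) hae)
    (fun i => (isClosed_closedSlab _ _).measurableSet)
  set Good : ι → ℕ × (Fin n × Fin m → ℤ) → Prop := fun i b => b.1 = lev i ∧
    dyCube b.1 b.2 ⊆ dyCube 0 0 ∧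
    (slabBound n (r i) (ρ i) : ℝ≥0∞) ≤
      volume (dyCube b.1 b.2 ∩ slab (q i) fun j => ‖q i‖ * r i j) with hGood
  have h𝔟 : {b | ∃ i ∈ F, Good i b}.Finite := by
    refine (F.finite_toSet.biUnion fun i _ =>
      (finite_dyCube_subset (ι := Fin n × Fin m) (lev i)).image (Prod.mk (lev i))).subset ?_
    rintro ⟨l, κ⟩ ⟨i, hi, h1, h2, -⟩
    refine mem_iUnion₂.2 ⟨i, hi, κ, ?_, ?_⟩
    · dsimp only at h1 h2; rw [h1] at h2; exact h2
    · exact Prod.ext h1.symm rfl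
  obtain ⟨S, hS𝔟, hSdis, hSmax⟩ := exists_maximal_dyCubes h𝔟.toFinset
  have hSgood : ∀ b ∈ S, ∃ i ∈ F, Good i b := fun b hb => h𝔟.mem_toFinset.1 (hS𝔟 hb)
  have hne : Nonempty ι := by
    by_contra hemp
    rw [not_nonempty_iff] at hemp
    have h0 : ∀ᵐ x ∂(volume.restrict (dyCube 0 (0 : Fin n × Fin m → ℤ))), False :=
      hae.mono fun x hx => hx.elim fun i _ => isEmptyElim i
    rw [ae_iff] at h0
    simp [volume_dyCube, dySide] at h0
  choose! idx hidxF hidxlev hidxsub hidxgood using hSgood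
  have hn : 0 < n := by
    obtain ⟨i⟩ := hne
    obtain ⟨i0, -⟩ := exists_max_coord (hq i)
    exact Fin.pos i0
  obtain ⟨L', φ, hφc, hφb, hφU, hφm, hφf⟩ := exists_step_density (L := L) (S := S)
    (C := 2 * 12 ^ (n * m)) (U := fun b => slab (q (idx b)) fun j => ‖q (idx b)‖ * r (idx b) j)
    (g := fun l => (frostmanConst n m * ε * f (dySide l) : ℝ≥0))
    (fun b hb => by
      rw [hidxlev b hb]; exact (Nat.le_add_right L 2).trans (hlevL _))
    hSdis (fun b _ => isOpen_slab _ _)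
    (fun b hb => lt_of_lt_of_le
      (by exact_mod_cast slabBound_pos hn (hr0 _) (hρ0 _)) (hidxgood b hb))
    (fun κ hκ => by
      refine ⟨S.filter fun b => dyCube b.1 b.2 ⊆ dyCube L κ, Finset.filter_subset _ _,
        fun b hb => (Finset.mem_filter.1 hb).2, ?_⟩
      have hcov : (dyCube (L + 2) fun p => 4 * κ p + 1) ∩ (⋃ i ∈ F, A i) ⊆
          ⋃ b ∈ S.filter fun b => dyCube b.1 b.2 ⊆ dyCube L κ, dyNear b.1 b.2 := by
        rintro x ⟨hxD, hxA⟩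
        obtain ⟨i, hiF, hxi⟩ := mem_iUnion₂.1 hxA
        obtain ⟨κ', hκ', hgood⟩ := exists_good_dyCube (hq i) (hr0 i) (hρ0 i) (hlev2 i) hxi
        have hsub := dyCube_subset_of_mem_core (hlevL i) hxD hκ'
        obtain ⟨b, hbS, hble, hbsub⟩ := hSmax (lev i, κ')
          (h𝔟.mem_toFinset.2 ⟨i, hiF, rfl, hsub.trans hκ, hgood⟩)
        obtain ⟨y, hy⟩ := dyCube_nonempty (lev i) κ'
        refine mem_iUnion₂.2 ⟨b, Finset.mem_filter.2 ⟨hbS, ?_⟩,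
          dyNear_subset_of_le hble (hbsub hy) hy hκ'⟩
        refine dyCube_subset_of_le ?_ (hsub hy) (hbsub hy)
        rw [hidxlev b hbS]
        exact (Nat.le_add_right L 2).trans (hlevL _)
      have hcard : Fintype.card (Fin n × Fin m) = n * m := by simp
      calc volume (dyCube L κ)
          = 4 ^ (n * m) * volume (dyCube (L + 2) fun p => 4 * κ p + 1) := by
            rw [volume_dyCube_eq_core, hcard]
        _ ≤ 4 ^ (n * m) * (2 * ∑ b ∈ S.filter fun b => dyCube b.1 b.2 ⊆ dyCube L κ,
              3 ^ (n * m) * volume (dyCube b.1 b.2)) := by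
            gcongr
            refine (hF ⟨κ, hκ⟩).trans ?_
            gcongr
            refine (measure_mono hcov).trans ((measure_biUnion_finset_le _ _).trans ?_)
            refine Finset.sum_le_sum fun b _ => ?_
            rw [← hcard]
            exact volume_dyNear_le _ _
        _ = _ := by
            rw [← Finset.mul_sum]
            push_cast
            rw [show (12 : ℝ≥0∞) = 4 * 3 by norm_num, mul_pow]
            ring)
    (fun b hb l hl κ _ => by
      have hlev := hidxlev b hb
      exact hf.volume_mul_volume_inter_slab_le ha ham (hq _) (hr1 _) (hρ1 _) (hρ _)
        (by rw [hlev]; exact hlev4 _) hl b.2 κ (hidxgood b hb))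
  refine ⟨L', φ, F, hφc, hφb, fun x hx => ?_, hφm, hφf⟩
  obtain ⟨b, hb, hxb⟩ := hφU x hx
  exact ⟨idx b, hidxF b hb, slab_subset_closedSlab _ _ hxb⟩

theorem finite_norm_le {ι : Type*} {n : ℕ} {q : ι → Fin n → ℤ} (hinj : Function.Injective q)
    (B : ℝ) : {i | ‖q i‖ ≤ B}.Finite := by
  have h : (Metric.closedBall (0 : Fin n → ℤ) B).Finite :=
    (isCompact_closedBall (0 : Fin n → ℤ) B).finite_of_discrete
  refine (h.preimage hinj.injOn).subset fun i hi => ?_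
  simpa using hi

/-- The mass transference step. For `q` outside a finite set, thicken the radii to `max (r i j) ρ`
with `∏ max (r i j) ρ = min (ε * boxContent f (n * m) (r i)) (‖q i‖ ^ (-m))`. The divergence of the
series makes the thickened neighbourhoods cover almost every point, and `ρ` is such that Lebesgue
measure can be concentrated on the original neighbourhoods with Frostman constant `ε`. -/
theorem distributes_slabs {f : ℝ≥0 → ℝ≥0} {n m a : ℕ} [NeZero m] (hf : IsGauge f (n * m) a)
    (ha : 1 ≤ a) (ham : a ≤ m) {ι : Type*} [Countable ι] {q : ι → Fin n → ℤ}
    (hinj : Function.Injective q) {l : Fin n} {σ : ℤ} (hσ : ∀ i, 0 < σ * q i l)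
    {c : ℝ} (hc : 0 < c) (hdiv : ∀ i, ∀ d : ℕ, (d : ℤ) ∣ q i l → c * d ≤ d.totient)
    {r : ι → Fin m → ℝ≥0} (hr0 : ∀ i j, 0 < r i j) (hr1 : ∀ i j, r i j * ‖q i‖₊ ≤ 1)
    (hsum : ¬ Summable fun i => boxContent f (n * m) (r i) * ‖q i‖₊ ^ m) (E : Finset ι) :
    Distributes f (2 * 12 ^ (n * m))
      {x | ∃ i ∉ E, x ∈ closedSlab (q i) fun j => ‖q i‖ * r i j} := by
  classical
  have hq : ∀ i, q i ≠ 0 := fun i h => by have := hσ i; simp [h] at this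
  have hQ : ∀ i, 0 < ‖q i‖₊ := fun i => by simpa using hq i
  intro ε' hε' L
  set C : ℝ≥0 := 2 * 12 ^ (n * m) with hC
  set D : ℝ≥0 := C * 2 * frostmanConst n m + 1 with hD
  set ε : ℝ≥0 := ε' / D with hε
  have hD0 : 0 < D := by positivity
  have hε0 : 0 < ε := by positivity
  obtain ⟨δ, hδ0, hδ⟩ := hf.prod_le_boxContent (m := m) hε0
  set B : ℝ≥0 := max (2 / dySide (L + 2)) (2 / δ) with hB
  set E' : Finset ι := E ∪ (finite_norm_le hinj B).toFinset with hE'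
  have hbig : ∀ i : {i // i ∉ E'}, B < ‖q i‖₊ := by
    intro i
    by_contra! h
    exact i.2 (Finset.mem_union_right _ ((finite_norm_le hinj B).mem_toFinset.2
      (by exact_mod_cast h)))
  have hr1' : ∀ i j, r i j ≤ 1 / ‖q i‖₊ := fun i j => (le_div_iff₀ (hQ i)).2 (hr1 i j)
  have hex : ∀ i : {i // i ∉ E'}, ∃ ρ, 0 < ρ ∧ ρ ≤ 1 / ‖q i‖₊ ∧
      ∏ j, max (r i j) ρ = min (ε * boxContent f (n * m) (r i)) ((1 / ‖q i‖₊) ^ m) := by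
    intro i
    refine exists_radius (hr0 i) (hr1' i) (hδ _ (hr0 i) fun j => (hr1' i j).trans_lt ?_)
    have h : 2 / δ < ‖q i‖₊ := (le_max_right _ _).trans_lt (hbig i)
    rw [div_lt_iff₀ hδ0] at h
    rw [div_lt_iff₀ (hQ i), mul_comm]
    exact lt_of_le_of_lt (by norm_num) h
  choose ρ hρ0 hρR hρ using hex
  have hρ1 : ∀ i, ρ i * ‖q i‖₊ ≤ 1 := fun i => (le_div_iff₀ (hQ i)).1 (hρR i)
  -- the thickened neighbourhoods cover almost everything, by the zero-one law on the torus
  have htor := ae_infinite_torusSlab (q := fun i : {i // i ∉ E'} => q i)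
    (hinj.comp Subtype.val_injective) (fun i => hσ i) hc (fun i => hdiv i)
    (δ := fun i j => ‖q i‖ * max (r i j) (ρ i)) (fun i j => by positivity)
    (fun i j => by
      have h : max (r i j) (ρ i) * ‖q i‖₊ ≤ 1 := by
        rw [max_mul_of_nonneg _ _ zero_le]; exact max_le (hr1 i j) (hρ1 i)
      rw [mul_comm]
      exact_mod_cast h)
    (by
      intro hs
      have e : ∀ i : {i // i ∉ E'}, ∏ j, ‖q i‖ * ((max (r i j) (ρ i) : ℝ≥0) : ℝ) =
          ((min (ε * (boxContent f (n * m) (r i) * ‖q i‖₊ ^ m)) 1 : ℝ≥0) : ℝ) := by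
        intro i
        have : ∏ j, ‖q i‖₊ * max (r i j) (ρ i) =
            min (ε * (boxContent f (n * m) (r i) * ‖q i‖₊ ^ m)) 1 := by
          rw [Finset.prod_mul_distrib, hρ i, mul_min_of_nonneg _ _ zero_le, Finset.prod_const,
            Finset.card_univ, Fintype.card_fin, ← mul_pow, mul_one_div_cancel (hQ i).ne', one_pow]
          congr 1; ring
        rw [← this]; push_cast; rfl
      simp only [e] at hs
      rw [NNReal.summable_coe] at hs
      have h2 := summable_of_summable_min_one hs
      rw [← NNReal.summable_coe] at h2
      push_cast at h2
      rw [summable_mul_left_iff (NNReal.coe_ne_zero.2 hε0.ne')] at h2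
      refine hsum (NNReal.summable_coe.1 ?_)
      push_cast
      exact (Finset.summable_compl_iff E').1 h2)
  obtain ⟨L', φ, F, hφc, hφb, hφA, hφm, hφf⟩ := exists_density_slabs hf ha ham
    (q := fun i : {i // i ∉ E'} => q i) (r := fun i => r i) (ρ := ρ) (ε := ε) (L := L)
    (fun i => hq i) (fun i => hr0 i) (fun i => hr1 i) hρ0 hρ1
    (fun i => (hρ i).le.trans (min_le_left _ _))
    (fun i => by
      have h : 2 / dySide (L + 2) < ‖q i‖₊ := (le_max_left _ _).trans_lt (hbig i)
      rw [div_lt_iff₀ (dySide_pos _)] at h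
      calc 2 * ρ i ≤ 2 * (1 / ‖q i‖₊) := by gcongr; exact hρR i
        _ ≤ dySide (L + 2) := by
          rw [mul_one_div, div_le_iff₀ (hQ i), mul_comm]; exact h.le)
    (ae_restrict_of_ae_torus (htor.mono fun x hx => hx.nonempty))
  refine ⟨L', φ, ⋃ i ∈ F, closedSlab (q i) fun j => ‖q i‖ * r i j, hφc.measurable, hφc, hφb,
    F.finite_toSet.isClosed_biUnion fun i _ => isClosed_closedSlab _ _, ?_, fun x hx => ?_, hφm,
    fun l hl κ => (hφf l hl κ).trans ?_⟩
  · refine iUnion₂_subset fun i _ x hx => ⟨i, fun h => i.2 ?_, hx⟩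
    exact Finset.mem_union_left _ h
  · simpa using hφA x hx
  · rw [mul_add]
    refine add_le_add_right ?_ _
    rw [← ENNReal.coe_ofNat, ← ENNReal.coe_mul, ← ENNReal.coe_mul, ← ENNReal.coe_mul,
      ENNReal.coe_le_coe]
    calc C * (2 * (frostmanConst n m * ε * f (dySide l)))
        = C * 2 * frostmanConst n m * ε * f (dySide l) := by ring
      _ ≤ D * ε * f (dySide l) := by gcongr; exact le_self_add
      _ = ε' * f (dySide l) := by rw [hε, mul_div_cancel₀ _ hD0.ne']

end WeightedApprox

namespace WeightedApprox

/-! ### Integers with few small prime factors -/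

/-- Integers `N` for which `∑ 1 / p` over the prime factors is at most `4`; for such `N` the ratio
`φ(d) / d` is bounded below on all divisors `d` of `N`. -/
def IsRough (N : ℕ) : Prop := ∑ p ∈ N.primeFactors, (p : ℝ)⁻¹ ≤ 4

/-- The inequality `1 - x ≥ exp (-2 x)` for `x = 1 / p ≤ 1 / 2`. -/
theorem exp_neg_two_mul_inv_le {p : ℕ} (hp : 2 ≤ p) :
    Real.exp (-(2 * (p : ℝ)⁻¹)) ≤ 1 - (p : ℝ)⁻¹ := by
  have hp' : (2 : ℝ) ≤ p := by exact_mod_cast hp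
  have h1 : 0 < 1 - (p : ℝ)⁻¹ := by
    have : (p : ℝ)⁻¹ ≤ 2⁻¹ := by gcongr
    linarith
  rw [← Real.le_log_iff_exp_le h1]
  refine le_trans ?_ (Real.one_sub_inv_le_log_of_pos h1)
  have h2 : (1 : ℝ) - (p : ℝ)⁻¹ = (p - 1) / p := by field_simp
  have hp1 : (0 : ℝ) < p - 1 := by linarith
  rw [h2, inv_div, ← sub_nonneg]
  have : 1 - (p : ℝ) / (p - 1) - -(2 * (p : ℝ)⁻¹) = (p - 2) / (p * (p - 1)) := by
    field_simp; ring
  rw [this]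
  exact div_nonneg (by linarith) (by positivity)

theorem IsRough.exp_mul_le_totient {N : ℕ} (h : IsRough N) (hN : N ≠ 0) {d : ℕ} (hd : d ∣ N) :
    Real.exp (-8) * d ≤ d.totient := by
  have e : (d.totient : ℝ) = d * ∏ p ∈ d.primeFactors, (1 - (p : ℝ)⁻¹) := by
    have := Nat.totient_eq_mul_prod_factors d
    have h2 := congrArg (fun x : ℚ => (x : ℝ)) this
    push_cast at h2
    exact h2
  rw [e, mul_comm]
  gcongr
  calc Real.exp (-8) ≤ Real.exp (∑ p ∈ d.primeFactors, -(2 * (p : ℝ)⁻¹)) := by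
        rw [Real.exp_le_exp, Finset.sum_neg_distrib, ← Finset.mul_sum, neg_le_neg_iff]
        have h1 : ∑ p ∈ d.primeFactors, (p : ℝ)⁻¹ ≤ ∑ p ∈ N.primeFactors, (p : ℝ)⁻¹ :=
          Finset.sum_le_sum_of_subset_of_nonneg (Nat.primeFactors_mono hd hN)
            fun p _ _ => by positivity
        unfold IsRough at h
        linarith
    _ = ∏ p ∈ d.primeFactors, Real.exp (-(2 * (p : ℝ)⁻¹)) := Real.exp_sum _ _
    _ ≤ _ := Finset.prod_le_prod (fun p _ => (Real.exp_pos _).le) fun p hp =>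
        exp_neg_two_mul_inv_le (Nat.prime_of_mem_primeFactors hp).two_le

open Classical in
/-- At least half of the integers in `[B, 2B)` are rough. -/
theorem le_two_mul_card_isRough (B : ℕ) :
    B ≤ 2 * ((Finset.Ico B (2 * B)).filter IsRough).card := by
  rcases Nat.eq_zero_or_pos B with rfl | hB
  · simp
  -- the average of `∑ 1 / p` over `[B, 2B)` is at most `2 ∑ 1 / p² ≤ 2`
  have hsum : ∑ N ∈ Finset.Ico B (2 * B), ∑ p ∈ N.primeFactors, (p : ℝ)⁻¹ ≤ 2 * B := by
    calc ∑ N ∈ Finset.Ico B (2 * B), ∑ p ∈ N.primeFactors, (p : ℝ)⁻¹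
        ≤ ∑ N ∈ Finset.Ioc 0 (2 * B), ∑ p ∈ Finset.Ioc 1 (2 * B),
            if p ∣ N then (p : ℝ)⁻¹ else 0 := by
          have hsub : Finset.Ico B (2 * B) ⊆ Finset.Ioc 0 (2 * B) := fun N hN => by
            simp only [Finset.mem_Ico, Finset.mem_Ioc] at hN ⊢; omega
          refine (Finset.sum_le_sum_of_subset_of_nonneg hsub fun N _ _ =>
            Finset.sum_nonneg fun p _ => by positivity).trans ?_
          refine Finset.sum_le_sum fun N hN => ?_
          rw [← Finset.sum_filter]
          refine Finset.sum_le_sum_of_subset_of_nonneg (fun p hp => ?_) fun p _ _ => by positivity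
          rw [Finset.mem_Ioc] at hN
          have h1 := Nat.prime_of_mem_primeFactors hp
          have h2 := Nat.dvd_of_mem_primeFactors hp
          have h3 := Nat.le_of_dvd hN.1 h2
          simp only [Finset.mem_filter, Finset.mem_Ioc]
          exact ⟨⟨h1.one_lt, h3.trans hN.2⟩, h2⟩
      _ = ∑ p ∈ Finset.Ioc 1 (2 * B), ((2 * B / p : ℕ) : ℝ) * (p : ℝ)⁻¹ := by
          rw [Finset.sum_comm]
          refine Finset.sum_congr rfl fun p _ => ?_
          rw [← Finset.sum_filter, Finset.sum_const, Nat.Ioc_filter_dvd_card_eq_div, nsmul_eq_mul]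
      _ ≤ ∑ p ∈ Finset.Ioc 1 (2 * B), 2 * B * ((p : ℝ) ^ 2)⁻¹ := by
          refine Finset.sum_le_sum fun p _ => ?_
          have : ((2 * B / p : ℕ) : ℝ) ≤ 2 * B * (p : ℝ)⁻¹ := by
            have := Nat.cast_div_le (α := ℝ) (m := 2 * B) (n := p)
            push_cast at this
            rwa [div_eq_mul_inv] at this
          calc ((2 * B / p : ℕ) : ℝ) * (p : ℝ)⁻¹ ≤ 2 * B * (p : ℝ)⁻¹ * (p : ℝ)⁻¹ := by gcongr
            _ = _ := by rw [mul_assoc, ← mul_inv, sq]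
      _ ≤ 2 * B * 1 := by
          rw [← Finset.mul_sum]
          gcongr
          refine (sum_Ioc_inv_sq_le_sub one_ne_zero (by omega)).trans ?_
          simp
      _ = _ := mul_one _
  have hbad : 4 * (((Finset.Ico B (2 * B)).filter fun N => ¬ IsRough N).card : ℝ) ≤ 2 * B := by
    refine le_trans ?_ hsum
    rw [mul_comm, ← nsmul_eq_mul, ← Finset.sum_const]
    refine (Finset.sum_le_sum fun N hN => ?_).trans
      (Finset.sum_le_sum_of_subset_of_nonneg (Finset.filter_subset (fun N => ¬ IsRough N) _)
        fun N _ _ => Finset.sum_nonneg fun p _ => by positivity)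
    exact (not_le.1 (Finset.mem_filter.1 hN).2).le
  have hbad' : 2 * ((Finset.Ico B (2 * B)).filter fun N => ¬ IsRough N).card ≤ B := by
    have : (2 : ℝ) * (((Finset.Ico B (2 * B)).filter fun N => ¬ IsRough N).card : ℝ) ≤ B := by
      linarith
    exact_mod_cast this
  have htot := Finset.card_filter_add_card_filter_not (s := Finset.Ico B (2 * B)) IsRough
  rw [Nat.card_Ico] at htot
  omega

/-- A positive proportion of the integers in `(k / 4, k]` is rough. -/
theorem exists_finset_isRough {k : ℕ} (hk : 0 < k) : ∃ s : Finset ℕ, k ≤ 8 * s.card ∧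
    ∀ N ∈ s, IsRough N ∧ N ≤ k ∧ k < 4 * N := by
  classical
  refine ⟨(Finset.Ico (k / 4 + 1) (2 * (k / 4 + 1))).filter IsRough, ?_, fun N hN => ?_⟩
  · have := le_two_mul_card_isRough (k / 4 + 1)
    omega
  · rw [Finset.mem_filter, Finset.mem_Ico] at hN
    exact ⟨hN.2, by omega, by omega⟩

/-! ### Thinning a divergent series -/

open Classical in
/-- If `h k` is at most a constant times `h k'` for `k / 4 < k' ≤ k`, then the series over all
indices is comparable with the series over the rough ones. -/
theorem tsum_le_tsum_isRough {h : ℕ → ℝ≥0∞} {K : ℝ≥0∞} (h0 : h 0 = 0)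
    (hK : ∀ k k', k' ≤ k → k < 4 * k' → h k ≤ K * h k') :
    ∑' k, h k ≤ 24 * K * ∑' k, if IsRough k then h k else 0 := by
  -- bound each term by an average over the rough indices below it, then interchange the sums
  have hstep : ∀ k, h k ≤ ∑' k', if IsRough k' ∧ k' ≤ k ∧ k < 4 * k' then
      8 * K * (k : ℝ≥0∞)⁻¹ * h k' else 0 := by
    intro k
    rcases Nat.eq_zero_or_pos k with rfl | hk
    · simp [h0]
    obtain ⟨s, hs, hsk⟩ := exists_finset_isRough hk
    refine le_trans ?_ (ENNReal.sum_le_tsum s)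
    have hk0 : (k : ℝ≥0∞) ≠ 0 := by exact_mod_cast hk.ne'
    calc h k = (k : ℝ≥0∞)⁻¹ * k * h k := by
          rw [ENNReal.inv_mul_cancel hk0 (ENNReal.natCast_ne_top k), one_mul]
      _ ≤ (k : ℝ≥0∞)⁻¹ * (8 * s.card : ℕ) * h k := by gcongr
      _ = ∑ _k' ∈ s, 8 * (k : ℝ≥0∞)⁻¹ * h k := by
          rw [Finset.sum_const, nsmul_eq_mul]; push_cast; ring
      _ ≤ _ := by
          refine Finset.sum_le_sum fun k' hk' => ?_
          rw [if_pos (hsk k' hk')]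
          calc 8 * (k : ℝ≥0∞)⁻¹ * h k ≤ 8 * (k : ℝ≥0∞)⁻¹ * (K * h k') := by
                gcongr; exact hK k k' (hsk k' hk').2.1 (hsk k' hk').2.2
            _ = _ := by ring
  refine (ENNReal.tsum_le_tsum hstep).trans ?_
  rw [ENNReal.tsum_comm, ← ENNReal.tsum_mul_left]
  refine ENNReal.tsum_le_tsum fun k' => ?_
  by_cases hr : IsRough k'
  · rcases Nat.eq_zero_or_pos k' with rfl | hk'
    · simp
    rw [if_pos hr, tsum_eq_sum (s := Finset.Ico k' (4 * k')) fun k hk => ?_]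
    · have hk0 : (k' : ℝ≥0∞) ≠ 0 := by exact_mod_cast hk'.ne'
      calc ∑ k ∈ Finset.Ico k' (4 * k'), (if IsRough k' ∧ k' ≤ k ∧ k < 4 * k' then
              8 * K * (k : ℝ≥0∞)⁻¹ * h k' else 0)
          ≤ ∑ _k ∈ Finset.Ico k' (4 * k'), 8 * K * (k' : ℝ≥0∞)⁻¹ * h k' := by
            refine Finset.sum_le_sum fun k hk => ?_
            rw [Finset.mem_Ico] at hk
            rw [if_pos ⟨hr, hk⟩]
            gcongr
            exact hk.1
        _ = 24 * K * ((k' : ℝ≥0∞)⁻¹ * k') * h k' := by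
            rw [Finset.sum_const, Nat.card_Ico, show 4 * k' - k' = 3 * k' by omega, nsmul_eq_mul]
            push_cast
            ring
        _ = _ := by rw [ENNReal.inv_mul_cancel hk0 (ENNReal.natCast_ne_top k'), mul_one]
    · rw [if_neg]
      rw [Finset.mem_Ico] at hk
      exact fun hc => hk hc.2
  · simp [hr]

theorem tsum_eq_tsum_funSplitAt {n : ℕ} (l : Fin n) (u : (Fin n → ℤ) → ℝ≥0∞) :
    ∑' q, u q = ∑' (q' : {j // j ≠ l} → ℤ) (k : ℤ), u ((Equiv.funSplitAt l ℤ).symm (k, q')) := by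
  rw [← (Equiv.funSplitAt l ℤ).symm.tsum_eq,
    ENNReal.tsum_prod (f := fun k q' => u ((Equiv.funSplitAt l ℤ).symm (k, q'))),
    ENNReal.tsum_comm]

theorem tsum_int_eq_tsum_nat {σ : ℤ} (hσ : σ = 1 ∨ σ = -1) {u : ℤ → ℝ≥0∞}
    (hu : ∀ k, ¬ 0 < σ * k → u k = 0) : ∑' k, u k = ∑' k : ℕ, u (σ * k) := by
  have hinj : Function.Injective fun k : ℕ => σ * (k : ℤ) := by
    intro k k' h
    rcases hσ with rfl | rfl <;> simpa using h
  refine (hinj.tsum_eq fun k hk => ?_).symm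
  have : 0 < σ * k := by
    by_contra h
    exact hk (hu k h)
  refine ⟨(σ * k).toNat, ?_⟩
  dsimp only
  rw [Int.toNat_of_nonneg this.le, ← mul_assoc]
  rcases hσ with rfl | rfl <;> simp

open Classical in
/-- For a function that varies regularly away from `0` within each orthant, a divergent series stays
divergent when one coordinate is restricted to rough integers of a fixed sign: apply
`tsum_le_tsum_isRough` on the lines parallel to that coordinate axis. -/
theorem exists_isRough_of_regular {n : ℕ} {u : (Fin n → ℤ) → ℝ≥0∞} {K : ℝ≥0∞} (hK : K ≠ ∞)
    (hu : ∀ q q', q ≠ 0 → (∀ i, 0 ≤ q i * q' i ∧ |q i| ≤ |q' i|) → ‖q'‖ ≤ 4 * ‖q‖ →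
      u q' ≤ K * u q)
    (h : ∑' q : {q : Fin n → ℤ // q ≠ 0}, u q = ∞) :
    ∃ (l : Fin n) (σ : ℤ), ∑' q, (if 0 < σ * q l ∧ IsRough (q l).natAbs then u q else 0) = ∞ := by
  by_contra! hcon
  have hline : ∀ (l : Fin n) (σ : ℤ), σ = 1 ∨ σ = -1 →
      ∑' q, (if 0 < σ * q l then u q else 0) < ∞ := by
    intro l σ hσ
    refine lt_of_le_of_lt ?_ (ENNReal.mul_lt_top (a := 24 * K)
      (ENNReal.mul_lt_top (by simp) hK.lt_top) (hcon l σ).lt_top)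
    rw [tsum_eq_tsum_funSplitAt l, tsum_eq_tsum_funSplitAt l, ← ENNReal.tsum_mul_left]
    refine ENNReal.tsum_le_tsum fun q' => ?_
    have hl : ∀ k, (Equiv.funSplitAt l ℤ).symm (k, q') l = k := fun k => by simp
    have hj : ∀ k j, (hj : j ≠ l) → (Equiv.funSplitAt l ℤ).symm (k, q') j = q' ⟨j, hj⟩ :=
      fun k j hj => by simp [hj]
    simp only [hl]
    rw [tsum_int_eq_tsum_nat hσ fun k hk => if_neg hk,
      tsum_int_eq_tsum_nat hσ fun k hk => if_neg fun hc => hk hc.1]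
    have hs : ∀ k : ℕ, 0 < σ * (σ * (k : ℤ)) ↔ 0 < k := fun k => by
      rw [← mul_assoc]; rcases hσ with rfl | rfl <;> simp
    have ha : ∀ k : ℕ, (σ * (k : ℤ)).natAbs = k := fun k => by
      rcases hσ with rfl | rfl <;> simp
    simp only [hs, ha]
    refine (tsum_le_tsum_isRough (K := K) (by simp) fun k k' hk1 hk2 => ?_).trans
      (mul_le_mul_right (ENNReal.tsum_le_tsum fun k => ?_) _)
    · rw [if_pos (by omega), if_pos (by omega)]
      refine hu _ _ (fun h0 => ?_) (fun i => ?_) ?_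
      · have := congrFun h0 l
        rw [hl] at this
        rcases hσ with rfl | rfl <;> simp at this <;> omega
      · by_cases hi : i = l
        · subst hi
          rw [hl, hl]
          have : (k' : ℤ) ≤ k := by exact_mod_cast hk1
          refine ⟨?_, ?_⟩
          · rcases hσ with rfl | rfl <;> simp <;> positivity
          · rcases hσ with rfl | rfl <;> simpa using hk1
        · rw [hj _ i hi, hj _ i hi]
          exact ⟨mul_self_nonneg _, le_rfl⟩
      · refine (pi_norm_le_iff_of_nonneg (by positivity)).2 fun i => ?_
        set v := (Equiv.funSplitAt l ℤ).symm (σ * (k' : ℤ), q') with hv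
        have hvi : ‖v i‖ ≤ ‖v‖ := norm_le_pi_norm v i
        by_cases hi : i = l
        · subst hi
          rw [hl]
          have e1 : ‖v i‖ = k' := by
            rw [hv, hl]; rcases hσ with rfl | rfl <;> simp
          have e2 : ‖σ * (k : ℤ)‖ = k := by rcases hσ with rfl | rfl <;> simp
          rw [e2]
          have : (k : ℝ) ≤ 4 * k' := by exact_mod_cast hk2.le
          linarith
        · rw [hj _ i hi]
          have e1 : v i = q' ⟨i, hi⟩ := hj _ i hi
          rw [← e1]
          linarith [norm_nonneg (v i)]
    · split_ifs <;> simp_all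
  have hle : ∑' q : {q : Fin n → ℤ // q ≠ 0}, u q ≤
      ∑ l : Fin n, (∑' q, (if 0 < (1 : ℤ) * q l then u q else 0) +
        ∑' q, (if 0 < (-1 : ℤ) * q l then u q else 0)) := by
    simp_rw [← ENNReal.tsum_add]
    rw [← Summable.tsum_finsetSum fun _ _ => ENNReal.summable]
    refine le_trans (ENNReal.tsum_le_tsum fun q => ?_) (ENNReal.tsum_comp_le_tsum_of_injective
      Subtype.val_injective _)
    obtain ⟨l, hl⟩ := Function.ne_iff.1 q.2
    refine le_trans ?_ (Finset.single_le_sum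
      (f := fun l => (if 0 < (1 : ℤ) * q.1 l then u q else 0) + (if 0 < (-1 : ℤ) * q.1 l then u q else 0)) (fun _ _ => zero_le) (Finset.mem_univ l))
    rcases lt_or_gt_of_ne hl with h1 | h1
    · rw [if_pos (c := 0 < (-1 : ℤ) * q.1 l) (by simpa using h1)]; exact le_add_self
    · rw [if_pos (by simpa using h1)]; exact le_self_add
  rw [h, top_le_iff] at hle
  refine absurd hle (ENNReal.sum_lt_top.2 fun l _ => ?_).ne
  exact ENNReal.add_lt_top.2 ⟨hline l 1 (Or.inl rfl), hline l (-1) (Or.inr rfl)⟩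

open Classical in
/-- For a function of the maximum norm, the coordinate to be restricted can be taken different from
one that attains the maximum; on the lines parallel to its axis the function is constant. -/
theorem exists_isRough_of_univariable {n : ℕ} (hn : 2 ≤ n) {u : (Fin n → ℤ) → ℝ≥0∞}
    (hu : ∀ q q', ‖q‖ = ‖q'‖ → u q = u q')
    (h : ∑' q : {q : Fin n → ℤ // q ≠ 0}, u q = ∞) :
    ∃ (l : Fin n) (σ : ℤ), ∑' q, (if 0 < σ * q l ∧ IsRough (q l).natAbs then u q else 0) = ∞ := by
  by_contra! hcon
  have hline : ∀ i : Fin n, ∑' q, (if q ≠ 0 ∧ ‖q‖ = ‖q i‖ then u q else 0) < ∞ := by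
    intro i
    have : Nontrivial (Fin n) := Fin.nontrivial_iff_two_le.2 hn
    obtain ⟨l, hli⟩ := exists_ne i
    refine lt_of_le_of_lt ?_ (ENNReal.mul_lt_top (a := 24) (by simp) (hcon l 1).lt_top)
    rw [tsum_eq_tsum_funSplitAt l, tsum_eq_tsum_funSplitAt l, ← ENNReal.tsum_mul_left]
    refine ENNReal.tsum_le_tsum fun q' => ?_
    set w : ℤ → Fin n → ℤ := fun k => (Equiv.funSplitAt l ℤ).symm (k, q') with hw
    have hl : ∀ k, w k l = k := fun k => by simp [hw]
    have hj : ∀ k j, (hj : j ≠ l) → w k j = q' ⟨j, hj⟩ := fun k j hj => by simp [hw, hj]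
    change ∑' k, (if w k ≠ 0 ∧ ‖w k‖ = ‖w k i‖ then u (w k) else 0) ≤
      24 * ∑' k, (if 0 < 1 * w k l ∧ IsRough (w k l).natAbs then u (w k) else 0)
    by_cases hex : ∃ k0, w k0 ≠ 0 ∧ ‖w k0‖ = ‖w k0 i‖
    swap
    · push Not at hex
      rw [ENNReal.tsum_eq_zero.2 fun k => if_neg fun hc => hex k hc.1 hc.2]
      exact zero_le
    obtain ⟨k0, hk0, hk0i⟩ := hex
    set Q := (q' ⟨i, hli.symm⟩).natAbs with hQ
    have hwi : ∀ k, ‖w k i‖ = Q := fun k => by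
      rw [hj k i hli.symm, hQ, Int.norm_eq_abs, Nat.cast_natAbs, Int.cast_abs]
    have hQpos : 0 < Q := by
      have h1 : 0 < ‖w k0‖ := norm_pos_iff.2 hk0
      rw [hk0i, hwi] at h1
      exact_mod_cast h1
    have hnorm : ∀ k : ℤ, |k| ≤ Q → ‖w k‖ = Q := by
      intro k hk
      refine le_antisymm ((pi_norm_le_iff_of_nonneg (Nat.cast_nonneg Q)).2 fun j => ?_) ?_
      · by_cases hjl : j = l
        · subst hjl
          rw [hl, Int.norm_eq_abs]; exact_mod_cast hk
        · rw [hj k j hjl, ← hj k0 j hjl, ← hwi k0, ← hk0i]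
          exact norm_le_pi_norm _ j
      · rw [← hwi k]; exact norm_le_pi_norm _ i
    set U := u (w 0) with hU
    have hUk : ∀ k : ℤ, |k| ≤ Q → u (w k) = U := fun k hk =>
      hu _ _ ((hnorm k hk).trans (hnorm 0 (by simp)).symm)
    obtain ⟨s, hs, hsk⟩ := exists_finset_isRough hQpos
    calc ∑' k, (if w k ≠ 0 ∧ ‖w k‖ = ‖w k i‖ then u (w k) else 0)
        ≤ ∑ _k ∈ Finset.Icc (-(Q : ℤ)) Q, U := by
          rw [tsum_eq_sum (s := Finset.Icc (-(Q : ℤ)) Q) fun k hk => if_neg fun hc => hk ?_]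
          · refine Finset.sum_le_sum fun k hk => ?_
            rw [Finset.mem_Icc, ← abs_le] at hk
            rw [hUk k hk]
            split_ifs <;> simp
          · have h1 : ‖w k l‖ ≤ ‖w k‖ := norm_le_pi_norm _ l
            rw [hc.2, hwi, hl, Int.norm_eq_abs] at h1
            rw [Finset.mem_Icc, ← abs_le]
            exact_mod_cast h1
      _ = ((2 * Q + 1 : ℕ) : ℝ≥0∞) * U := by
          rw [Finset.sum_const, Int.card_Icc, nsmul_eq_mul]
          congr 2; omega
      _ ≤ ((24 * s.card : ℕ) : ℝ≥0∞) * U := by gcongr; omega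
      _ = 24 * ∑ _k ∈ s.map (Nat.castEmbedding (R := ℤ)), U := by
          rw [Finset.sum_const, Finset.card_map, nsmul_eq_mul]; push_cast; ring
      _ ≤ 24 * ∑ k ∈ s.map (Nat.castEmbedding (R := ℤ)),
            (if 0 < 1 * w k l ∧ IsRough (w k l).natAbs then u (w k) else 0) := by
          refine mul_le_mul_right (Finset.sum_le_sum fun k hk => ?_) _
          obtain ⟨N, hN, rfl⟩ := Finset.mem_map.1 hk
          obtain ⟨h1, h2, h3⟩ := hsk N hN
          have e : ((Nat.castEmbedding (R := ℤ)) N) = (N : ℤ) := rfl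
          rw [e, hl, if_pos ⟨by omega, by simpa using h1⟩,
            hUk N (by rw [Nat.abs_cast]; exact_mod_cast h2)]
      _ ≤ _ := by gcongr; exact ENNReal.sum_le_tsum _
  have hle : ∑' q : {q : Fin n → ℤ // q ≠ 0}, u q ≤
      ∑ i : Fin n, ∑' q, (if q ≠ 0 ∧ ‖q‖ = ‖q i‖ then u q else 0) := by
    rw [← Summable.tsum_finsetSum fun _ _ => ENNReal.summable]
    refine le_trans (ENNReal.tsum_le_tsum fun q => ?_) (ENNReal.tsum_comp_le_tsum_of_injective
      Subtype.val_injective _)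
    obtain ⟨i, -, -, hi⟩ := exists_max_coord q.2
    refine le_trans ?_ (Finset.single_le_sum (f := fun i => if q.1 ≠ 0 ∧ ‖q.1‖ = ‖q.1 i‖ then u q
      else 0) (fun _ _ => zero_le) (Finset.mem_univ i))
    rw [if_pos ⟨q.2, by rw [Int.norm_eq_abs, ← hi, coe_nnnorm]⟩]
  rw [h, top_le_iff] at hle
  exact absurd hle (ENNReal.sum_lt_top.2 fun i _ => hline i).ne

end WeightedApprox

namespace WeightedApprox

open Set

/-! ### Infinite Hausdorff measure in the divergence case -/

theorem exists_pos_le_add {f : ℝ≥0 → ℝ≥0} (hf : Continuous f) {x η ε : ℝ≥0} (hx : x < η)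
    (hε : 0 < ε) : ∃ y, x < y ∧ y ≤ η ∧ f y ≤ f x + ε := by
  have h1 : ∀ᶠ y in 𝓝[>] x, f y < f x + ε :=
    ((hf.tendsto x).mono_left nhdsWithin_le_nhds).eventually
      (gt_mem_nhds (lt_add_of_pos_right _ hε))
  have h2 : ∀ᶠ y in 𝓝[>] x, y ∈ Ioc x η := Ioc_mem_nhdsGT hx
  have : (𝓝[>] x).NeBot := nhdsGT_neBot_of_exists_gt ⟨η, hx⟩
  obtain ⟨y, hy1, hy2⟩ := (h1.and h2).exists
  exact ⟨y, hy2.1, hy2.2, hy1.le⟩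

/-- Sets that can carry arbitrarily large amounts of mass without mass concentrations beyond `f`
have infinite Hausdorff `f`-measure. -/
theorem hausdorffMeasure_eq_top {f : ℝ≥0 → ℝ≥0} (hf : IsDimensionFunction f) {n m a : ℕ}
    (hg : IsGauge f (n * m) a) {C : ℝ≥0} {A : ℕ → Set (Fin n × Fin m → ℝ)}
    (hA : ∀ k, Distributes f C (A k)) {E : Set (MatSpace n m)}
    (hE : ∀ x ∈ Icc 0 1 ∩ ⋂ k, A k, WithLp.toLp 2 x ∈ E) : hausdorffMeasure f E = ∞ := by
  have hg' : IsGauge f (Fintype.card (Fin n × Fin m)) a := by simpa using hg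
  set D : ℝ≥0∞ := 5 ^ Fintype.card (Fin n × Fin m) with hD
  have key : ∀ M : ℝ≥0, (M : ℝ≥0∞) ≤ D * (hausdorffMeasure f E + 1) := by
    intro M
    obtain ⟨η, hη, hcov⟩ := exists_scale_forall_cover hg' hA M
    have hpre : hausdorffPre f (η / 2) E ≤ hausdorffMeasure f E :=
      le_iSup₂_of_le (η / 2 : ℝ) (by positivity) le_rfl
    have hD0 : D ≠ 0 := by simp [hD]
    have hDt : D ≠ ∞ := by simp [hD]
    refine le_trans ?_ (mul_le_mul_right (add_le_add_left hpre 1) D)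
    rw [mul_comm, ← ENNReal.div_le_iff hD0 hDt, ← tsub_le_iff_right]
    refine le_iInf fun c => le_iInf fun r => le_iInf fun hdiam => le_iInf fun hcover => ?_
    rw [tsub_le_iff_right, ENNReal.div_le_iff hD0 hDt, mul_comm]
    obtain ⟨ε, hε0, hε⟩ := ENNReal.exists_pos_sum_of_countable one_ne_zero ℕ
    set d : ℕ → ℝ≥0 := fun i => (Metric.diam (Metric.closedBall (c i) (r i : ℝ))).toNNReal with hd
    have hdη : ∀ i, d i < η := fun i => by
      have h1 : d i ≤ η / 2 := Real.toNNReal_le_iff_le_coe.2 (by push_cast; exact hdiam i)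
      exact h1.trans_lt (half_lt_self hη)
    -- slightly larger open balls in the maximum norm contain the given closed balls
    choose ρ hρd hρη hρf using fun i => exists_pos_le_add hf.continuous (hdη i) (hε0 i)
    refine (hcov (fun i => (c i).ofLp) ρ (fun i => (zero_le).trans_lt (hρd i)) hρη ?_).trans ?_
    · intro x hx
      obtain ⟨i, hi⟩ := mem_iUnion.1 (hcover (hE x hx))
      refine mem_iUnion.2 ⟨i, ?_⟩
      rw [Metric.mem_ball]
      refine lt_of_le_of_lt ?_ (NNReal.coe_lt_coe.2 (hρd i))
      have h1 : dist (WithLp.toLp 2 x) (c i) ≤ d i := by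
        rw [hd, Real.coe_toNNReal _ Metric.diam_nonneg]
        exact Metric.dist_le_diam_of_mem Metric.isBounded_closedBall hi
          (Metric.mem_closedBall_self (r i).2)
      refine (dist_pi_le_iff (NNReal.coe_nonneg _)).2 fun p => le_trans ?_ h1
      rw [dist_eq_norm, dist_eq_norm]
      exact PiLp.norm_apply_le (WithLp.toLp 2 x - c i) p
    · gcongr
      calc ∑' i, (f (ρ i) : ℝ≥0∞) ≤ ∑' i, ((f (d i) : ℝ≥0∞) + ε i) :=
            ENNReal.tsum_le_tsum fun i => by exact_mod_cast hρf i
        _ = ∑' i, (f (d i) : ℝ≥0∞) + ∑' i, (ε i : ℝ≥0∞) := ENNReal.tsum_add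
        _ ≤ _ := by gcongr
  by_contra htop
  have hfin : D * (hausdorffMeasure f E + 1) ≠ ∞ :=
    ENNReal.mul_ne_top (by simp [hD]) (ENNReal.add_ne_top.2 ⟨htop, by simp⟩)
  have := key ((D * (hausdorffMeasure f E + 1)).toNNReal + 1)
  rw [ENNReal.coe_add, ENNReal.coe_toNNReal hfin] at this
  exact (ENNReal.lt_add_right hfin (by simp)).not_ge this

theorem pos_of_t_ne_zero {n m : ℕ} {f : ℝ≥0 → ℝ≥0} (hf : f 0 = 0)
    {Ψ : Fin m → (Fin n → ℤ) → ℝ≥0} {q : Fin n → ℤ} (h : t Ψ f q ≠ 0) (j : Fin m) : 0 < Ψ j q := by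
  by_contra h0
  have h0' : Ψ j q = 0 := by simpa using h0
  refine h (le_antisymm (ciInf_le_of_le (OrderBot.bddBelow _) j ?_) zero_le)
  simp [h0', hf]

open Classical in
/-- The divergence case for bounded `Ψ`, once the series is known to diverge over vectors with a
rough coordinate of constant sign: the neighbourhoods of all but finitely many such `q` distribute
mass in the sense of `Distributes`, and the points common to all these unions lie in `W Ψ`. -/
theorem hausdorffMeasure_W_eq_top {n m a : ℕ} [NeZero m] {f : ℝ≥0 → ℝ≥0}
    (hf : IsDimensionFunction f) (hg : IsGauge f (n * m) a) (ha : 1 ≤ a) (ham : a ≤ m)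
    {Ψ : Fin m → (Fin n → ℤ) → ℝ≥0} {B : ℝ≥0} (hB : ∀ j q, Ψ j q ≤ B) {l : Fin n} {σ : ℤ}
    (h : ∑' q : Fin n → ℤ, (if 0 < σ * q l ∧ IsRough (q l).natAbs then
      (t Ψ f q : ℝ≥0∞) * (‖q‖₊ : ℝ≥0∞) ^ m else 0) = ∞) :
    hausdorffMeasure f (W Ψ) = ∞ := by
  set ι := {q : Fin n → ℤ // (0 < σ * q l ∧ IsRough (q l).natAbs) ∧ t Ψ f q ≠ 0} with hι
  have hne : ∀ q : ι, q.1 ≠ 0 := fun q h0 => by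
    have := q.2.1.1
    rw [h0] at this
    simp at this
  -- strict inequalities in `W` need a factor less than `1`
  set s : ℝ≥0 := (B + 2)⁻¹ with hs
  have hs0 : 0 < s := by positivity
  have hs1 : s < 1 := inv_lt_one_of_one_lt₀ (by
    calc (1 : ℝ≥0) < 2 := by norm_num
      _ ≤ B + 2 := le_add_self)
  set r : ι → Fin m → ℝ≥0 := fun q j => s * (Ψ j q.1 / ‖q.1‖₊) with hr
  have hrq : ∀ q j, r q j * ‖q.1‖₊ = s * Ψ j q.1 := fun q j => by
    have := norm_pos_of_ne_zero (hne q)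
    rw [hr]
    field_simp
  have hΨ0 : ∀ (q : ι) j, 0 < Ψ j q.1 := fun q j => pos_of_t_ne_zero hf.map_zero q.2.2 j
  have hr0 : ∀ q j, 0 < r q j := fun q j => by
    have := norm_pos_of_ne_zero (hne q)
    have := hΨ0 q j
    positivity
  have hsum : ¬ Summable fun q : ι => boxContent f (n * m) (r q) * ‖q.1‖₊ ^ m := by
    intro hS
    have h1 : Summable fun q : ι => s ^ (n * m) * (t Ψ f q.1 * ‖q.1‖₊ ^ m) := by
      refine NNReal.summable_of_le (fun q => ?_) hS
      rw [← mul_assoc, t_eq_boxContent hf.map_zero Ψ (hne q)]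
      gcongr
      exact hg.pow_mul_boxContent_le (Nat.le_mul_of_pos_left m (Fin.pos l)) hs0 hs1.le _
    have h2 : ∑' q : ι, (s : ℝ≥0∞) ^ (n * m) * ((t Ψ f q.1 : ℝ≥0∞) * (‖q.1‖₊ : ℝ≥0∞) ^ m) ≠ ∞ := by
      have := ENNReal.tsum_coe_ne_top_iff_summable.2 h1
      push_cast at this
      exact this
    rw [ENNReal.tsum_mul_left] at h2
    have h3 : ∑' q : ι, (t Ψ f q.1 : ℝ≥0∞) * (‖q.1‖₊ : ℝ≥0∞) ^ m = ∞ := by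
      rw [← h]
      refine (tsum_congr fun q => ?_).trans (Subtype.val_injective.tsum_eq fun q hq => ?_)
      · exact (if_pos q.2.1).symm
      · rw [Function.mem_support] at hq
        have hc : 0 < σ * q l ∧ IsRough (q l).natAbs := by
          by_contra hc
          exact hq (if_neg hc)
        rw [if_pos hc] at hq
        exact ⟨⟨q, hc, fun h0 => hq (by rw [h0]; simp)⟩, rfl⟩
    rw [h3] at h2
    exact h2 (ENNReal.mul_top (by simp [hs0.ne']))
  obtain ⟨_⟩ := nonempty_encodable ι
  have hfin : ∀ k : ℕ, {q : ι | Encodable.encode q < k}.Finite := fun k =>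
    (finite_Iio k).preimage Encodable.encode_injective.injOn
  refine hausdorffMeasure_eq_top hf hg (C := 2 * 12 ^ (n * m))
    (A := fun k => {x | ∃ i ∉ (hfin k).toFinset,
      x ∈ closedSlab i.1 fun j => ‖i.1‖ * r i j}) (fun k => ?_) ?_
  · refine distributes_slabs hg ha ham (q := fun q : ι => q.1) Subtype.val_injective
      (l := l) (σ := σ) (fun q => q.2.1.1) (Real.exp_pos (-8)) (fun q d hd => ?_) hr0
      (fun q j => ?_) hsum _
    · refine q.2.1.2.exp_mul_le_totient ?_ (Int.natCast_dvd.1 hd)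
      have := q.2.1.1
      rw [Ne, Int.natAbs_eq_zero]
      intro h0
      simp [h0] at this
    · rw [hrq]
      calc s * Ψ j q.1 ≤ s * (B + 2) := by gcongr; exact (hB j q.1).trans le_self_add
        _ = 1 := inv_mul_cancel₀ (by positivity)
  · rintro x ⟨hx01, hx⟩
    refine ⟨fun p => ⟨hx01.1 p, hx01.2 p⟩, ?_⟩
    have hinf : {q : ι | x ∈ closedSlab q.1 fun j => ‖q.1‖ * r q j}.Infinite := by
      intro hf
      obtain ⟨k, hk⟩ := (hf.image Encodable.encode).bddAbove
      obtain ⟨q, hq, hxq⟩ := mem_iInter.1 hx (k + 1)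
      refine hq ((hfin _).mem_toFinset.2 ?_)
      exact Nat.lt_succ_of_le (hk (mem_image_of_mem _ hxq))
    refine (hinf.image Subtype.val_injective.injOn).mono ?_
    rintro _ ⟨q, hq, rfl⟩ j
    refine lt_of_le_of_lt (mem_closedSlab_iff.1 hq j) ?_
    have e : ‖q.1‖ * (r q j : ℝ) = ((s * Ψ j q.1 : ℝ≥0) : ℝ) := by
      rw [← hrq]; push_cast; ring
    rw [e, NNReal.coe_lt_coe]
    exact mul_lt_of_lt_one_left (hΨ0 q j) hs1

end WeightedApprox

namespace WeightedApprox

open Set MeasureTheory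

/-! ### Economical covers in the convergence case -/

theorem hausdorffPre_le_tsum {X : Type*} [PseudoMetricSpace X] [Nonempty X] {f : ℝ≥0 → ℝ≥0}
    (hf : IsDimensionFunction f) {ι : Type*} [Countable ι] {η : ℝ} (hη : 0 ≤ η) {E : Set X}
    (c : ι → X) (R : ι → ℝ≥0) (hR : ∀ i, 2 * (R i : ℝ) ≤ η)
    (hE : E ⊆ ⋃ i, Metric.closedBall (c i) (R i)) :
    hausdorffPre f η E ≤ ∑' i, (f (2 * R i) : ℝ≥0∞) := by
  obtain ⟨_⟩ := nonempty_encodable ι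
  have hinj : Function.Injective (Encodable.encode (α := ι)) := Encodable.encode_injective
  set c' : ℕ → X := Function.extend Encodable.encode c fun _ => Classical.arbitrary X with hc'
  set R' : ℕ → ℝ≥0 := Function.extend Encodable.encode R 0 with hR'
  have hR'0 : ∀ k, k ∉ range (Encodable.encode (α := ι)) → R' k = 0 := fun k hk =>
    Function.extend_apply' _ _ _ hk
  have hdiam : ∀ k, Metric.diam (Metric.closedBall (c' k) (R' k)) ≤ 2 * R' k := fun k =>
    Metric.diam_closedBall (R' k).2
  refine iInf_le_of_le c' (iInf_le_of_le R' (iInf_le_of_le (fun k => (hdiam k).trans ?_)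
    (iInf_le_of_le (hE.trans ?_) ?_)))
  · by_cases hk : k ∈ range (Encodable.encode (α := ι))
    · obtain ⟨i, rfl⟩ := hk
      rw [hR', hinj.extend_apply]
      exact hR i
    · rw [hR'0 k hk]; simpa using hη
  · refine iUnion_subset fun i => ?_
    refine subset_trans ?_ (subset_iUnion _ (Encodable.encode i))
    rw [hc', hR', hinj.extend_apply, hinj.extend_apply]
  · calc ∑' k, (f (Metric.diam (Metric.closedBall (c' k) (R' k : ℝ))).toNNReal : ℝ≥0∞)
        ≤ ∑' k, (f (2 * R' k) : ℝ≥0∞) := by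
          refine ENNReal.tsum_le_tsum fun k => ENNReal.coe_le_coe.2 (hf.monotone ?_)
          exact Real.toNNReal_le_iff_le_coe.2 (by push_cast; exact hdiam k)
      _ = ∑' i : ι, (f (2 * R' (Encodable.encode i)) : ℝ≥0∞) := by
          refine (hinj.tsum_eq fun k hk => ?_).symm
          by_contra h
          rw [Function.mem_support, hR'0 k h] at hk
          simp [hf.map_zero] at hk
      _ = _ := by
          refine tsum_congr fun i => ?_
          rw [hR', hinj.extend_apply]

theorem dist_le_card_mul {ι : Type*} [Fintype ι] {x y : EuclideanSpace ℝ ι} {d : ℝ} (hd : 0 ≤ d)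
    (h : ∀ p, |x p - y p| ≤ d) : dist x y ≤ Fintype.card ι * d := by
  have h1 : dist x y ^ 2 ≤ (Fintype.card ι * d) ^ 2 := by
    rw [EuclideanSpace.dist_sq_eq]
    calc ∑ p, dist (x p) (y p) ^ 2 ≤ ∑ _p : ι, d ^ 2 := by
          refine Finset.sum_le_sum fun p _ => ?_
          rw [Real.dist_eq]
          exact pow_le_pow_left₀ (abs_nonneg _) (h p) 2
      _ = Fintype.card ι * d ^ 2 := by simp
      _ ≤ (Fintype.card ι) ^ 2 * d ^ 2 := by
          gcongr
          exact_mod_cast Nat.le_self_pow two_ne_zero _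
      _ = _ := by ring
  exact le_of_sq_le_sq h1 (by positivity)

/-- The points of the unit cube that satisfy the inequalities for the single vector `q`. -/
def solutionSet {n m : ℕ} (Ψ : Fin m → (Fin n → ℤ) → ℝ≥0) (q : Fin n → ℤ) : Set (MatSpace n m) :=
  {x | x ∈ unitCube n m ∧ ∀ j, distInt (rowMul q x j) < Ψ j q}

/-- The solution set is covered by at most `K |q| ^ m s ^ (-n m) ∏ max (ψ_j(q) / |q|) s` balls of
radius comparable with `s`: dyadic cubes of side about `s` that meet the solution set lie in a
slightly larger neighbourhood, and can be counted by volume. -/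
theorem exists_cubes_cover_solutionSet {n m : ℕ} {Ψ : Fin m → (Fin n → ℤ) → ℝ≥0} {q : Fin n → ℤ}
    (hq : q ≠ 0) {s : ℝ≥0} (hs : 0 < s) (hs1 : s ≤ 1) :
    ∃ T : Finset (MatSpace n m), solutionSet Ψ q ⊆
        ⋃ c ∈ T, Metric.closedBall c ((n * m : ℕ) * (2 * s) : ℝ≥0) ∧
      (T.card : ℝ≥0) * s ^ (n * m) ≤
        (((8 * n + 3) * (4 * n + 2) : ℕ) * 4 ^ (n - 1)) ^ m * ‖q‖₊ ^ m *
          ∏ j, max (Ψ j q / ‖q‖₊) s := by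
  classical
  obtain ⟨i0, hi0, hmax, hnorm⟩ := exists_max_coord hq
  rw [coe_nnnorm] at hnorm
  have hQ1 : (1 : ℝ) ≤ ‖q‖ := by
    rw [hnorm]; exact_mod_cast Int.one_le_abs hi0
  have hQ0 : 0 < ‖q‖ := one_pos.trans_le hQ1
  obtain ⟨l, -, hl2, hl4⟩ := exists_level_near (ρ := s / 2) (by positivity) (L := 0) (by
    rw [mul_div_cancel₀ _ two_ne_zero]; simpa [dySide] using hs1)
  rw [mul_div_cancel₀ _ two_ne_zero] at hl2
  have hl4 : dySide l ≤ 2 * s := by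
    refine hl4.trans_eq ?_
    rw [show (4 : ℝ≥0) = 2 * 2 by norm_num, mul_assoc, mul_div_cancel₀ _ two_ne_zero]
  set r : Fin m → ℝ≥0 := fun j => max (Ψ j q / ‖q‖₊) s with hr
  set δ : Fin m → ℝ := fun j => ‖q‖ * ((2 * n + 1) * r j) with hδ
  set Tκ : Set (Fin n × Fin m → ℤ) :=
    {κ | ∃ x ∈ solutionSet Ψ q, x.ofLp ∈ dyCube l κ} with hTκ
  have hsub : ∀ κ ∈ Tκ, dyCube l κ ⊆ slab q δ ∩ Metric.closedBall 0 2 := by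
    rintro κ ⟨x, ⟨hx01, hx⟩, hxκ⟩ y hy
    have hd : ∀ p, |y p - x p| ≤ dySide l := fun p => by
      rw [← Real.dist_eq]
      exact (dist_le_pi_dist y x.ofLp p).trans (dist_le_of_mem_dyCube hy hxκ)
    refine ⟨fun j => ⟨round (rowMul q x j), ?_⟩, ?_⟩
    · have h1 : |∑ i, (q i : ℝ) * y (i, j) - rowMul q x j| ≤ n * (‖q‖ * dySide l) := by
        rw [hnorm]
        exact sum_mul_sub_le hmax fun i => hd (i, j)
      have h2 := hx j
      unfold distInt at h2
      have h3 : (Ψ j q : ℝ) ≤ ‖q‖ * r j := by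
        have : Ψ j q ≤ ‖q‖₊ * r j := by
          calc Ψ j q = ‖q‖₊ * (Ψ j q / ‖q‖₊) := by
                rw [mul_div_cancel₀ _ (norm_pos_of_ne_zero hq).ne']
            _ ≤ _ := by gcongr; exact le_max_left _ _
        exact_mod_cast this
      have h4 : (dySide l : ℝ) ≤ 2 * r j := by
        have : dySide l ≤ 2 * r j := hl4.trans (by gcongr; exact le_max_right _ _)
        exact_mod_cast this
      calc |∑ i, (q i : ℝ) * y (i, j) - round (rowMul q x j)|
          ≤ |∑ i, (q i : ℝ) * y (i, j) - rowMul q x j| +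
              |rowMul q x j - round (rowMul q x j)| := abs_sub_le _ _ _
        _ < n * (‖q‖ * dySide l) + Ψ j q := add_lt_add_of_le_of_lt h1 h2
        _ ≤ n * (‖q‖ * (2 * r j)) + ‖q‖ * r j := by gcongr
        _ = δ j := by rw [hδ]; ring
    · rw [mem_closedBall_zero_iff]
      refine (pi_norm_le_iff_of_nonneg zero_le_two).2 fun p => ?_
      have h1 := hd p
      have h2 : (dySide l : ℝ) ≤ 1 := by
        exact_mod_cast (pow_le_one₀ zero_le (by norm_num) : (1 / 2 : ℝ≥0) ^ l ≤ 1)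
      have h3 := hx01 p
      rw [abs_le] at h1
      rw [Real.norm_eq_abs, abs_le]
      constructor <;> linarith [h1.1, h1.2, h3.1, h3.2]
  have hTfin : Tκ.Finite := by
    refine (finite_Icc (0 : Fin n × Fin m → ℤ) (fun _ => 2 ^ l)).subset ?_
    rintro κ ⟨x, ⟨hx01, -⟩, hxκ⟩
    rw [← mem_dyCube.1 hxκ]
    refine ⟨fun p => Int.floor_nonneg.2 (mul_nonneg (hx01 p).1 (by positivity)), fun p => ?_⟩
    have h1 : x.ofLp p * 2 ^ l ≤ 2 ^ l := mul_le_of_le_one_left (by positivity) (hx01 p).2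
    have h2 : ⌊x.ofLp p * 2 ^ l⌋ ≤ ⌊((2 ^ l : ℤ) : ℝ)⌋ := Int.floor_mono (by push_cast; exact h1)
    rwa [Int.floor_intCast] at h2
  have hchoose : ∀ κ ∈ hTfin.toFinset, ∃ x ∈ solutionSet Ψ q, x.ofLp ∈ dyCube l κ :=
    fun κ hκ => hTfin.mem_toFinset.1 hκ
  choose! ctr hctr hctrκ using hchoose
  refine ⟨hTfin.toFinset.image ctr, fun x hx => ?_, ?_⟩
  · set κ := dyIdx l x.ofLp with hκ
    have hκT : κ ∈ hTfin.toFinset := hTfin.mem_toFinset.2 ⟨x, hx, rfl⟩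
    refine mem_iUnion₂.2 ⟨ctr κ, Finset.mem_image_of_mem _ hκT, ?_⟩
    rw [Metric.mem_closedBall]
    have h1 := dist_le_card_mul (x := x) (y := ctr κ) (d := dySide l) (NNReal.coe_nonneg _)
      fun p => by
        rw [← Real.dist_eq]
        exact (dist_le_pi_dist x.ofLp (ctr κ).ofLp p).trans
          (dist_le_of_mem_dyCube rfl (hctrκ κ hκT))
    refine h1.trans ?_
    have hcard : Fintype.card (Fin n × Fin m) = n * m := by simp
    rw [hcard]
    push_cast
    have : (dySide l : ℝ) ≤ 2 * s := by exact_mod_cast hl4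
    gcongr
  · have hvol : (hTfin.toFinset.card : ℝ≥0∞) * (dySide l : ℝ≥0∞) ^ (n * m) ≤
        volume (slab q δ ∩ Metric.closedBall 0 2) := by
      calc (hTfin.toFinset.card : ℝ≥0∞) * (dySide l : ℝ≥0∞) ^ (n * m)
          = ∑ κ ∈ hTfin.toFinset, volume (dyCube l κ) := by
            simp_rw [volume_dyCube]; simp
        _ = volume (⋃ κ ∈ hTfin.toFinset, dyCube l κ) :=
            (measure_biUnion_finset (fun κ _ κ' _ h => disjoint_dyCube h)
              fun κ _ => measurableSet_dyCube l κ).symm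
        _ ≤ _ := measure_mono (iUnion₂_subset fun κ hκ => hsub κ (hTfin.mem_toFinset.1 hκ))
    have hup := hvol.trans (volume_slab_inter_closedBall_le hi0 hmax δ
      (fun j => by positivity) 0 zero_le_two)
    have hprod : ∏ j, (min (2 * (n : ℝ) * 2) ((2 * (n * (|(q i0 : ℝ)| * 2) + δ j) + 1) *
        (2 * (δ j / |(q i0 : ℝ)|))) * (2 * 2) ^ (n - 1)) ≤
        ((((8 * n + 3) * (4 * n + 2) : ℕ) * 4 ^ (n - 1)) ^ m * ‖q‖₊ ^ m * ∏ j, r j : ℝ≥0) := by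
      push_cast
      have e : ((8 * (n : ℝ) + 3) * (4 * n + 2) * 4 ^ (n - 1)) ^ m * ‖q‖ ^ m * ∏ j, (r j : ℝ) =
          ∏ j, ((8 * (n : ℝ) + 3) * (4 * n + 2) * 4 ^ (n - 1) * ‖q‖ * r j) := by
        rw [Finset.prod_mul_distrib, ← mul_pow]; simp
      rw [e, ← hnorm]
      refine Finset.prod_le_prod (fun j _ => by positivity) fun j _ => ?_
      have hδq : δ j / ‖q‖ = (2 * n + 1) * r j := by rw [hδ]; field_simp
      rw [hδq]
      have hn0 : (0 : ℝ) ≤ n := Nat.cast_nonneg n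
      have hr0 : (0 : ℝ) ≤ r j := NNReal.coe_nonneg _
      have hmin : min (2 * (n : ℝ) * 2) ((2 * (n * (‖q‖ * 2) + δ j) + 1) *
          (2 * ((2 * n + 1) * (r j : ℝ)))) ≤ (8 * (n : ℝ) + 3) * (4 * n + 2) * (‖q‖ * r j) := by
        rcases le_total (r j : ℝ) 1 with h1 | h1
        · refine (min_le_right _ _).trans ?_
          have h2 : 2 * (n * (‖q‖ * 2) + δ j) + 1 ≤ (8 * n + 3) * ‖q‖ := by
            have : δ j ≤ ‖q‖ * ((2 * n + 1) * 1) := by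
              change ‖q‖ * ((2 * n + 1) * (r j : ℝ)) ≤ _
              gcongr
            linarith
          calc (2 * (n * (‖q‖ * 2) + δ j) + 1) * (2 * ((2 * n + 1) * (r j : ℝ)))
              ≤ ((8 * n + 3) * ‖q‖) * (2 * ((2 * n + 1) * (r j : ℝ))) := by gcongr
            _ = _ := by ring
        · refine (min_le_left _ _).trans ?_
          have h2 : (1 : ℝ) ≤ ‖q‖ * r j := one_le_mul_of_one_le_of_one_le hQ1 h1
          calc 2 * (n : ℝ) * 2 ≤ (8 * (n : ℝ) + 3) * (4 * n + 2) * 1 := by nlinarith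
            _ ≤ _ := by gcongr
      calc _ ≤ (8 * (n : ℝ) + 3) * (4 * n + 2) * (‖q‖ * r j) * (2 * 2) ^ (n - 1) := by gcongr
        _ = _ := by norm_num; ring
    have hfin := hup.trans (ENNReal.ofReal_le_ofReal hprod)
    rw [ENNReal.ofReal_coe_nnreal] at hfin
    have hfin' : (hTfin.toFinset.card : ℝ≥0) * dySide l ^ (n * m) ≤
        (((8 * n + 3) * (4 * n + 2) : ℕ) * 4 ^ (n - 1)) ^ m * ‖q‖₊ ^ m * ∏ j, r j := by
      exact_mod_cast hfin
    refine le_trans ?_ hfin'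
    gcongr
    exact Finset.card_image_le

end WeightedApprox

namespace WeightedApprox

open Set

theorem solutionSet_eq_empty {n m : ℕ} {Ψ : Fin m → (Fin n → ℤ) → ℝ≥0} {q : Fin n → ℤ} {j : Fin m}
    (h : Ψ j q = 0) : solutionSet Ψ q = ∅ := by
  refine eq_empty_of_forall_notMem fun x hx => ?_
  have := hx.2 j
  rw [h] at this
  exact absurd this (not_lt.2 (abs_nonneg _))

/-- The `f`-volume of a solution set is at most a constant times `t_q |q|^m`, at any scale, once
`t_q |q|^m` is small. -/
theorem exists_cover_solutionSet {n m a : ℕ} [NeZero m] {f : ℝ≥0 → ℝ≥0}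
    (hg : IsGauge f (n * m) a) (hn : 1 ≤ n) (ham : a ≤ m) :
    ∃ C : ℝ≥0, ∀ η : ℝ≥0, 0 < η → ∃ δ : ℝ≥0, 0 < δ ∧
      ∀ (Ψ : Fin m → (Fin n → ℤ) → ℝ≥0) (q : Fin n → ℤ), q ≠ 0 → t Ψ f q * ‖q‖₊ ^ m < δ →
        ∃ (T : Finset (MatSpace n m)) (R : ℝ≥0), 2 * R ≤ η ∧
          solutionSet Ψ q ⊆ ⋃ c ∈ T, Metric.closedBall c (R : ℝ) ∧
          T.card * f (2 * R) ≤ C * (t Ψ f q * ‖q‖₊ ^ m) := by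
  set K1 : ℝ≥0 := (((8 * n + 3) * (4 * n + 2) : ℕ) * 4 ^ (n - 1)) ^ m with hK1
  set D : ℝ≥0 := 4 * (n * m : ℕ) with hD
  have hm : 1 ≤ m := NeZero.one_le
  have hN : 1 ≤ n * m := Nat.mul_pos hn hm
  have hD1 : 1 ≤ D := by
    have : (1 : ℝ≥0) ≤ (n * m : ℕ) := by exact_mod_cast hN
    calc (1 : ℝ≥0) ≤ 4 * 1 := by norm_num
      _ ≤ 4 * (n * m : ℕ) := by gcongr
  have hD0 : 0 < D := one_pos.trans_le hD1
  refine ⟨D ^ (n * m) * K1, fun η hη => ?_⟩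
  set s0 : ℝ≥0 := min 1 (η / D) with hs0
  have hs00 : 0 < s0 := lt_min one_pos (by positivity)
  refine ⟨f s0 * s0 ^ m / s0 ^ (n * m), by have := hg.pos s0 hs00; positivity,
    fun Ψ q hq hsmall => ?_⟩
  by_cases h0 : ∃ j, Ψ j q = 0
  · obtain ⟨j, hj⟩ := h0
    exact ⟨∅, 0, by simp, by simp [solutionSet_eq_empty hj], by simp⟩
  push Not at h0
  have hQ := norm_pos_of_ne_zero hq
  set r : Fin m → ℝ≥0 := fun j => Ψ j q / ‖q‖₊ with hr
  obtain ⟨i, hi⟩ := exists_boxContent_eq f (n * m) r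
  set s := r i with hs
  have hspos : 0 < s := div_pos (pos_iff_ne_zero.2 (h0 i)) hQ
  have ht : t Ψ f q = f s / s ^ (n * m) * ∏ j, max (r j) s := by
    rw [t_eq_boxContent hg.dim.map_zero Ψ hq, hi, boxValue]
  -- `boxValue` is at least a positive constant at scales `s ≥ s0`
  have hss0 : s ≤ s0 := by
    by_contra! hlt
    refine hsmall.not_ge ?_
    have hQ1 : 1 ≤ ‖q‖₊ := by
      obtain ⟨i0, hi0, -, hnorm⟩ := exists_max_coord hq
      rw [← NNReal.coe_le_coe, hnorm, NNReal.coe_one]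
      exact_mod_cast Int.one_le_abs hi0
    calc f s0 * s0 ^ m / s0 ^ (n * m) ≤ f s / s ^ (n * m) * s ^ m := by
          rw [div_mul_eq_mul_div, div_le_div_iff₀ (by positivity) (by positivity)]
          have h1 := hg.lower_mid s0 s hs00 hlt.le
          have haN : a ≤ n * m := ham.trans (Nat.le_mul_of_pos_left m hn)
          have e1 : ∀ x : ℝ≥0, x ^ (n * m) = x ^ (n * m - a) * x ^ a := fun x => by
            rw [← pow_add, Nat.sub_add_cancel haN]
          have e2 : ∀ x : ℝ≥0, x ^ m = x ^ (m - a) * x ^ a := fun x => by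
            rw [← pow_add, Nat.sub_add_cancel ham]
          rw [e1 s, e1 s0, e2 s, e2 s0]
          calc f s0 * (s0 ^ (m - a) * s0 ^ a) * (s ^ (n * m - a) * s ^ a)
              = f s0 * s ^ (n * m - a) * (s0 ^ (m - a) * s0 ^ a * s ^ a) := by ring
            _ ≤ f s * s0 ^ (n * m - a) * (s ^ (m - a) * s0 ^ a * s ^ a) := by gcongr
            _ = _ := by ring
      _ ≤ f s / s ^ (n * m) * ∏ j, max (r j) s := by
          gcongr
          calc s ^ m = ∏ _j : Fin m, s := by simp
            _ ≤ _ := Finset.prod_le_prod' fun j _ => le_max_right _ _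
      _ = t Ψ f q * 1 := by rw [ht, mul_one]
      _ ≤ t Ψ f q * ‖q‖₊ ^ m := by gcongr; exact one_le_pow₀ hQ1
  obtain ⟨T, hT, hTc⟩ := exists_cubes_cover_solutionSet (Ψ := Ψ) hq hspos
    (hss0.trans (min_le_left _ _))
  have e2R : 2 * ((n * m : ℕ) * (2 * s)) = D * s := by
    rw [hD]
    calc (2 : ℝ≥0) * ((n * m : ℕ) * (2 * s)) = 2 * 2 * (n * m : ℕ) * s := by ring
      _ = _ := by norm_num
  refine ⟨T, (n * m : ℕ) * (2 * s), ?_, hT, ?_⟩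
  · rw [e2R]
    calc D * s ≤ D * (η / D) := by gcongr; exact hss0.trans (min_le_right _ _)
      _ = η := mul_div_cancel₀ _ hD0.ne'
  · rw [e2R]
    calc (T.card : ℝ≥0) * f (D * s) ≤ T.card * (D ^ (n * m) * f s) := by
          gcongr; exact hg.map_mul_le hD1 s
      _ = D ^ (n * m) * (f s / s ^ (n * m)) * (T.card * s ^ (n * m)) := by field_simp
      _ ≤ D ^ (n * m) * (f s / s ^ (n * m)) * (K1 * ‖q‖₊ ^ m * ∏ j, max (r j) s) := by gcongr
      _ = _ := by rw [ht]; ring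

/-- The convergence case, by the Borel–Cantelli argument for the covers of the solution sets. -/
theorem hausdorffMeasure_W_eq_zero {n m a : ℕ} [NeZero m] {f : ℝ≥0 → ℝ≥0}
    (hg : IsGauge f (n * m) a) (hn : 1 ≤ n) (ham : a ≤ m) {Ψ : Fin m → (Fin n → ℤ) → ℝ≥0}
    (h : tSum Ψ f < ∞) : hausdorffMeasure f (W Ψ) = 0 := by
  classical
  obtain ⟨C, hC⟩ := exists_cover_solutionSet (f := f) hg hn ham
  refine le_antisymm (iSup₂_le fun η hη => ?_) zero_le
  obtain ⟨δ, hδ, hcov⟩ := hC ⟨η, hη.le⟩ hη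
  set u : {q : Fin n → ℤ // q ≠ 0} → ℝ≥0∞ :=
    fun q => (t Ψ f q.1 : ℝ≥0∞) * (‖q.1‖₊ : ℝ≥0∞) ^ m with hu
  have hsum : ∑' q, u q ≠ ∞ := h.ne
  have hfin : {q | (δ : ℝ≥0∞) ≤ u q}.Finite :=
    ENNReal.finite_const_le_of_tsum_ne_top hsum (by simpa using hδ.ne')
  have htail : Filter.Tendsto (fun s : Finset {q : Fin n → ℤ // q ≠ 0} =>
      C * ∑' q : {q // q ∉ s}, u q) Filter.atTop (𝓝 (C * 0)) :=
    ENNReal.Tendsto.const_mul (ENNReal.tendsto_tsum_compl_atTop_zero hsum)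
      (Or.inr ENNReal.coe_ne_top)
  rw [mul_zero] at htail
  refine ge_of_tendsto htail ?_
  filter_upwards [Filter.eventually_ge_atTop hfin.toFinset] with s hs
  have hex : ∀ q : {q // q ∉ s}, ∃ (T : Finset (MatSpace n m)) (R : ℝ≥0), 2 * R ≤ ⟨η, hη.le⟩ ∧
      solutionSet Ψ q.1.1 ⊆ ⋃ c ∈ T, Metric.closedBall c (R : ℝ) ∧
      T.card * f (2 * R) ≤ C * (t Ψ f q.1.1 * ‖q.1.1‖₊ ^ m) := by
    intro q
    refine hcov Ψ q.1.1 q.1.2 ?_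
    have h1 : q.1 ∉ hfin.toFinset := fun hq => q.2 (hs hq)
    rw [Set.Finite.mem_toFinset, mem_ofPred_eq, not_le] at h1
    change (t Ψ f q.1.1 : ℝ≥0∞) * (‖q.1.1‖₊ : ℝ≥0∞) ^ m < δ at h1
    exact_mod_cast h1
  choose T R hRη hT hTC using hex
  refine (hausdorffPre_le_tsum hg.dim hη.le (ι := Σ q : {q // q ∉ s}, T q)
    (fun p => (p.2 : MatSpace n m)) (fun p => R p.1) (fun p => by exact_mod_cast hRη p.1)
    ?_).trans ?_
  · rintro x ⟨hx01, hx⟩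
    have hfin' : (insert 0 (Subtype.val '' (s : Set {q : Fin n → ℤ // q ≠ 0}))).Finite :=
      (s.finite_toSet.image _).insert 0
    obtain ⟨q, hq, hqs⟩ := hx.exists_notMem_finite hfin'
    rw [mem_insert_iff, not_or] at hqs
    have hqs' : (⟨q, hqs.1⟩ : {q : Fin n → ℤ // q ≠ 0}) ∉ s := fun hmem =>
      hqs.2 ⟨_, hmem, rfl⟩
    obtain ⟨c, hc, hxc⟩ := mem_iUnion₂.1 (hT ⟨⟨q, hqs.1⟩, hqs'⟩ ⟨hx01, hq⟩)
    exact mem_iUnion.2 ⟨⟨⟨⟨q, hqs.1⟩, hqs'⟩, ⟨c, hc⟩⟩, hxc⟩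
  · rw [ENNReal.tsum_sigma fun (q : {q // q ∉ s}) (_ : T q) => (f (2 * R q) : ℝ≥0∞),
      ← ENNReal.tsum_mul_left]
    refine ENNReal.tsum_le_tsum fun q => ?_
    rw [tsum_fintype, Finset.sum_const, Finset.card_univ, Fintype.card_coe, nsmul_eq_mul]
    change _ ≤ (C : ℝ≥0∞) * ((t Ψ f q.1.1 : ℝ≥0∞) * (‖q.1.1‖₊ : ℝ≥0∞) ^ m)
    exact_mod_cast hTC q

/-! ### Tuples that are non-increasing on the whole lattice -/

/-- The tuple is bounded below along the vectors `(-k, …, -k)` with `k` large, and among the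
multiples `k y` of a point `y` of a torus infinitely many are close to `0`. -/
theorem W_eq_unitCube_of_antitone {n m : ℕ} (hn : 1 ≤ n) {Ψ : Fin m → (Fin n → ℤ) → ℝ≥0}
    (hΨ : ∀ j, Antitone (Ψ j)) {q₀ : Fin n → ℤ} (hq₀ : ∀ j, 0 < Ψ j q₀) :
    W Ψ = unitCube n m := by
  refine subset_antisymm (fun x hx => hx.1) fun x hx => ⟨hx, ?_⟩
  have : Nonempty (Fin n) := ⟨⟨0, hn⟩⟩
  set y : Fin m → UnitAddCircle := fun j => ((∑ i, x (i, j) : ℝ) : UnitAddCircle) with hy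
  obtain ⟨ε, hε, hεΨ⟩ : ∃ ε : ℝ, 0 < ε ∧ ∀ j, ε ≤ Ψ j q₀ := by
    rcases isEmpty_or_nonempty (Fin m) with hm | hm
    · exact ⟨1, one_pos, fun j => isEmptyElim j⟩
    · obtain ⟨j₀, hj₀⟩ := Finite.exists_min fun j => Ψ j q₀
      exact ⟨Ψ j₀ q₀, hq₀ j₀, fun j => hj₀ j⟩
  have hrec : ∃ᶠ k : ℕ in Filter.atTop, k • y ∈ Metric.ball (0 : Fin m → UnitAddCircle) ε := by
    have h1 := mapClusterPt_self_zsmul_atTop_nsmul y 0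
    rw [zero_smul] at h1
    exact h1.frequently (Metric.ball_mem_nhds 0 hε)
  have hinf := Nat.frequently_atTop_iff_infinite.1
    (hrec.and_eventually (Filter.eventually_ge_atTop (∑ i, (q₀ i).natAbs)))
  have hinj : Function.Injective fun (k : ℕ) (_ : Fin n) => -(k : ℤ) := fun k k' h => by
    simpa using congrFun h (Classical.arbitrary _)
  refine (hinf.image hinj.injOn).mono ?_
  rintro _ ⟨k, ⟨hk, hkq⟩, rfl⟩ j
  have hle : (fun _ : Fin n => -(k : ℤ)) ≤ q₀ := fun i => by
    have := (Finset.single_le_sum (f := fun i => (q₀ i).natAbs) (fun _ _ => Nat.zero_le _)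
      (Finset.mem_univ i)).trans hkq
    dsimp only at this ⊢
    omega
  refine lt_of_lt_of_le ?_ ((hεΨ j).trans (NNReal.coe_le_coe.2 (hΨ j hle)))
  have e : ((rowMul (fun _ : Fin n => -(k : ℤ)) x j : ℝ) : UnitAddCircle) = -((k • y) j) := by
    have : rowMul (fun _ : Fin n => -(k : ℤ)) x j = -(k • ∑ i, x (i, j)) := by
      unfold rowMul
      rw [← Finset.mul_sum]
      push_cast
      rw [nsmul_eq_mul, neg_mul]
    rw [this, AddCircle.coe_neg, AddCircle.coe_nsmul]
    rfl
  rw [distInt, ← UnitAddCircle.norm_eq, e, norm_neg]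
  exact (norm_le_pi_norm _ j).trans_lt (mem_ball_zero_iff.1 hk)

theorem hausdorffMeasure_mono {X : Type*} [PseudoMetricSpace X] (f : ℝ≥0 → ℝ≥0) {E E' : Set X}
    (h : E ⊆ E') : hausdorffMeasure f E ≤ hausdorffMeasure f E' :=
  iSup₂_mono fun _ _ => iInf_mono fun _ => iInf_mono fun _ => iInf_mono fun _ =>
    iInf_mono' fun hc => ⟨h.trans hc, le_rfl⟩

end WeightedApprox

namespace WeightedApprox

/-! ### The zero–infinity law -/

theorem t_le_of_radial {n m a : ℕ} [NeZero m] {f : ℝ≥0 → ℝ≥0} (hg : IsGauge f (n * m) a)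
    (ha : 1 ≤ a) (ham : a ≤ m) (hn : 1 ≤ n) {Ψ : Fin m → (Fin n → ℤ) → ℝ≥0}
    (hΨ : ∀ j, IsRadiallyNonincreasing (Ψ j)) {q q' : Fin n → ℤ} (hq : q ≠ 0)
    (h : ∀ i, 0 ≤ q i * q' i ∧ |q i| ≤ |q' i|) : t Ψ f q' ≤ t Ψ f q := by
  have hnorm : ‖q‖₊ ≤ ‖q'‖₊ := by
    rw [← NNReal.coe_le_coe, coe_nnnorm, coe_nnnorm]
    refine (pi_norm_le_iff_of_nonneg (norm_nonneg _)).2 fun i => ?_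
    refine le_trans ?_ (norm_le_pi_norm q' i)
    rw [Int.norm_eq_abs, Int.norm_eq_abs]
    exact_mod_cast (h i).2
  have hQ := norm_pos_of_ne_zero hq
  have hq' : q' ≠ 0 := fun h0 => by
    rw [h0, nnnorm_zero] at hnorm
    exact hnorm.not_gt hQ
  rw [t_eq_boxContent hg.dim.map_zero Ψ hq, t_eq_boxContent hg.dim.map_zero Ψ hq']
  refine hg.boxContent_mono ha ham (ham.trans (Nat.le_mul_of_pos_left m hn)) fun j => ?_
  gcongr
  exact hΨ j q q' h

theorem t_eq_of_univariable {n m : ℕ} {f : ℝ≥0 → ℝ≥0} {Ψ : Fin m → (Fin n → ℤ) → ℝ≥0}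
    (hΨ : ∀ j, IsUnivariable (Ψ j)) {q q' : Fin n → ℤ} (h : ‖q‖₊ = ‖q'‖₊) :
    t Ψ f q = t Ψ f q' := by
  have hq : ∀ j, Ψ j q = Ψ j q' := fun j => hΨ j q q' h
  unfold t K
  simp only [hq, h]

open Classical in
theorem exists_isRough_tsum_eq_top {n m a : ℕ} [NeZero m] {f : ℝ≥0 → ℝ≥0}
    (hg : IsGauge f (n * m) a) (ha : 1 ≤ a) (ham : a ≤ m) (hn : 1 ≤ n)
    {Ψ : Fin m → (Fin n → ℤ) → ℝ≥0}
    (hΨ : (2 ≤ n ∧ ∀ j, IsUnivariable (Ψ j)) ∨ ∀ j, IsRadiallyNonincreasing (Ψ j))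
    (h : tSum Ψ f = ∞) :
    ∃ (l : Fin n) (σ : ℤ), ∑' q : Fin n → ℤ, (if 0 < σ * q l ∧ IsRough (q l).natAbs then
      (t Ψ f q : ℝ≥0∞) * (‖q‖₊ : ℝ≥0∞) ^ m else 0) = ∞ := by
  rcases hΨ with ⟨hn2, hΨ⟩ | hΨ
  · refine exists_isRough_of_univariable hn2 (fun q q' hqq' => ?_) h
    have hqq'' : ‖q‖₊ = ‖q'‖₊ := NNReal.eq hqq'
    rw [t_eq_of_univariable hΨ hqq'', hqq'']
  · refine exists_isRough_of_regular (K := 4 ^ m) (by simp) (fun q q' hq hqq' hnorm => ?_) h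
    have hnorm' : ‖q'‖₊ ≤ 4 * ‖q‖₊ := by exact_mod_cast hnorm
    have ht := t_le_of_radial (f := f) hg ha ham hn hΨ hq hqq'
    calc (t Ψ f q' : ℝ≥0∞) * (‖q'‖₊ : ℝ≥0∞) ^ m
        ≤ (t Ψ f q : ℝ≥0∞) * ((4 * ‖q‖₊ : ℝ≥0) : ℝ≥0∞) ^ m := by gcongr
      _ = _ := by rw [ENNReal.coe_mul, mul_pow]; push_cast; ring

end WeightedApprox

theorem theorem1p6 (n m : ℕ) (hn : 1 ≤ n)
    (Ψ : Fin m → (Fin n → ℤ) → ℝ≥0)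
    (f : ℝ≥0 → ℝ≥0) (hf : IsDimensionFunction f)
    (hfnm : Prec f ((n : ℝ) * m))
    (a : ℕ) (ha1 : 1 ≤ a) (ham : a ≤ m - 1)
    (hfl : SuccEq ((n : ℝ) * m - a) f)
    (hfu : PrecEq f ((n : ℝ) * m - a + 1))
    (hΨ : (2 ≤ n ∧ ∀ j, IsUnivariable (Ψ j)) ∨ IsNonincreasingTuple Ψ) :
    (tSum Ψ f < ∞ → hausdorffMeasure f (W Ψ) = 0) ∧
    (tSum Ψ f = ∞ →
      (IsNonincreasingTuple Ψ ∨ ∀ j, BddAbove (Set.range (Ψ j))) →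
      hausdorffMeasure f (W Ψ) = hausdorffMeasure f (unitCube n m)) := by
  have ham' : a ≤ m := by omega
  have : NeZero m := ⟨by omega⟩
  have hg : IsGauge f (n * m) a := isGauge_of_prec hn hf hfnm ham' hfl hfu
  refine ⟨hausdorffMeasure_W_eq_zero hg hn ham', fun hsum hcase => ?_⟩
  by_cases hanti : ∀ j, Antitone (Ψ j)
  · obtain ⟨q, hq⟩ : ∃ q : {q : Fin n → ℤ // q ≠ 0}, t Ψ f q.1 ≠ 0 := by
      by_contra! hzero
      have h0 : tSum Ψ f = 0 := ENNReal.tsum_eq_zero.2 fun q => by simp [hzero q]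
      rw [h0] at hsum
      exact ENNReal.zero_ne_top hsum
    rw [W_eq_unitCube_of_antitone hn hanti fun j => pos_of_t_ne_zero hf.map_zero hq j]
  have hred : (2 ≤ n ∧ ∀ j, IsUnivariable (Ψ j)) ∨ ∀ j, IsRadiallyNonincreasing (Ψ j) :=
    hΨ.imp_right fun h => h.resolve_right hanti
  have hbdd : ∀ j, ∃ B : ℝ≥0, ∀ q, Ψ j q ≤ B := by
    intro j
    rcases hcase with hmono | hbdd
    · exact ⟨Ψ j 0, fun q => hmono.resolve_right hanti j 0 q fun l => by simp⟩
    · obtain ⟨B, hB⟩ := hbdd j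
      exact ⟨B, fun q => hB (Set.mem_range_self q)⟩
  choose B hB using hbdd
  obtain ⟨l, σ, hlσ⟩ := exists_isRough_tsum_eq_top hg ha1 ham' hn hred hsum
  have htop : hausdorffMeasure f (W Ψ) = ∞ :=
    hausdorffMeasure_W_eq_top hf hg ha1 ham' (B := ∑ j, B j) (fun j q => (hB j q).trans
      (Finset.single_le_sum (fun _ _ => zero_le) (Finset.mem_univ j))) hlσ
  refine le_antisymm (hausdorffMeasure_mono f fun x hx => hx.1) ?_
  rw [htop]
  exact le_top
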